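/- **Definitions.** A monotone CNF $\varphi$ over the variables $x_1,\dots,x_n$ is a set of clauses, each clause a set of variables; $\|\varphi\|$ is the total number of literal occurrences in $\varphi$. It is *prime* if each of its clauses is a prime implicate of the monotone Boolean function $f$ represented by $\varphi$. *GYO operations*: (1) if a variable $x$ occurs in exactly one clause $c$, remove $x$ from $c$; (2) if distinct clauses $c,c'$ satisfy $c\subseteq c'$, remove $c$. A *GYO-reduction* of $\varphi$ is a sequence of such operations that leads from $\varphi$ to the CNF $0$ whose only clause is the empty clause. $\varphi$ is *$\alpha$-acyclic* if $\varphi=1$ (no clauses) or $\varphi$ has a GYO-reduction. For an ordering $b_1,\dots,b_n$ of the variables let $\varphi_i$ be the CNF of all clauses of $\varphi$ that contain only variables among $b_1,\dots,b_i$, and let $\Delta^i=\varphi_i\setminus\varphi_{i-1}$; $\varphi$ is *$k$-degenerate* if there is an ordering with $|\Delta^i|\le k$ for all $i=1,\dots,n$. *Dualization* is the problem of listing, given $\varphi$ (with clauses, and variables in clauses, in any order), the clauses of the prime CNF of the dual function $f^d(x)=\neg f(\neg x)$, each exactly once; as sets of variables these are the prime implicants of $f$. The *delay* is the maximal time until the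 first item is output, between two consecutive items, and from the last item (or the start, if there is none) until the algorithm halts, measured in unit-cost steps of a random access machine whose only arithmetic operations are successor and predecessor (with base-plus-offset memory addressing). **Theorem.** 1. There are one program and one constant $C$ such that for all $n\ge 0$ and all $\alpha$-acyclic prime monotone CNFs $\varphi$ over $n$ variables, the program solves Dualization for $\varphi$ with delay at most $C\cdot(\|\varphi\|\cdot n^2+1)$; that is, with $O(\|\varphi\|\cdot n^2)$ delay, where the summand $1$ matters only for the constant CNFs ($\|\varphi\|\cdot n^2=0$). 2. Every $\alpha$-acyclic prime monotone CNF is $1$-degenerate. 3. More precisely, let $\varphi$ be a prime monotone CNF with a GYO-reduction $a$. There is an ordering of the variables that is the reverse of the order in which $a$ removes variables (if $a$ removes $x$ before $y$, then $y$ precedes $x$ in the ordering), and every such ordering satisfies $|\Delta^i|\le 1$ for all $i$. -/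

import Mathlib

namespace MonotoneDual

/-! ### Boolean functions, clauses, terms, prime monotone CNFs -/

/-- Boolean functions of the variables `x_0, …, x_{n-1}`, ordered pointwise with `false < true`. -/
abbrev BoolFun (n : ℕ) : Type := (Fin n → Bool) → Bool

/-- The literal `(x, true)` is the variable `x`, and `(x, false)` is its complement. -/
abbrev Literal (n : ℕ) : Type := Fin n × Bool

/-- Clauses and terms are sets of literals with at most one literal for each variable. -/
def IsConsistent {n : ℕ} (t : Finset (Literal n)) : Prop :=
  ∀ x : Fin n, ¬ ((x, true) ∈ t ∧ (x, false) ∈ t)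

/-- The conjunction of the literals in `t`. -/
def termFun {n : ℕ} (t : Finset (Literal n)) : BoolFun n :=
  fun v => decide (∀ l ∈ t, v l.1 = l.2)

/-- The disjunction of the literals in `c`. -/
def clauseFun {n : ℕ} (c : Finset (Literal n)) : BoolFun n :=
  fun v => decide (∃ l ∈ c, v l.1 = l.2)

/-- `t` is a prime implicant of `f`: a term `t ≤ f` such that no term `t' > t` satisfies
`t' ≤ f`. -/
def IsPrimeImplicant {n : ℕ} (f : BoolFun n) (t : Finset (Literal n)) : Prop :=
  IsConsistent t ∧ termFun t ≤ f ∧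
    ¬ ∃ t' : Finset (Literal n), IsConsistent t' ∧ termFun t' ≤ f ∧ termFun t < termFun t'

/-- `c` is a prime implicate of `f`: a clause `c ≥ f` such that no clause `c' < c` satisfies
`c' ≥ f`. -/
def IsPrimeImplicate {n : ℕ} (f : BoolFun n) (c : Finset (Literal n)) : Prop :=
  IsConsistent c ∧ f ≤ clauseFun c ∧
    ¬ ∃ c' : Finset (Literal n), IsConsistent c' ∧ f ≤ clauseFun c' ∧ clauseFun c' < clauseFun c

/-- The dual function `f^d(x) = ¬ f(¬ x)`. -/
def dual {n : ℕ} (f : BoolFun n) : BoolFun n :=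
  fun v => !(f fun x => !(v x))

/-- The set of positive literals of the variables in `s`. -/
def positive {n : ℕ} (s : Finset (Fin n)) : Finset (Literal n) :=
  s.image fun x => (x, true)

/-- A monotone CNF, as a set of clauses; a monotone clause is given by its set of variables. -/
abbrev CNF (n : ℕ) : Type := Finset (Finset (Fin n))

/-- The monotone Boolean function represented by `φ`. -/
def CNF.fn {n : ℕ} (φ : CNF n) : BoolFun n :=
  fun v => decide (∀ c ∈ φ, clauseFun (positive c) v = true)

/-- All clauses of `φ` are prime implicates of the function that `φ` represents. -/
def CNF.IsPrime {n : ℕ} (φ : CNF n) : Prop :=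
  ∀ c ∈ φ, IsPrimeImplicate φ.fn (positive c)

/-- The length `‖φ‖`: the number of literal occurrences in `φ`. -/
def CNF.length {n : ℕ} (φ : CNF n) : ℕ := ∑ c ∈ φ, c.card

/-! ### GYO-reductions and `α`-acyclicity -/

/-- The operations in a GYO-reduction: removal of a variable from the only clause that contains
it, and removal of a clause. -/
inductive GYOOp (n : ℕ) : Type
  | var (x : Fin n) : GYOOp n
  | clause (c : Finset (Fin n)) : GYOOp n

/-- `GYO φ a ψ`: the sequence `a` of operations is a GYO-reduction of `φ` to `ψ`. -/
inductive GYO {n : ℕ} : CNF n → List (GYOOp n) → CNF n → Prop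
  | nil (φ : CNF n) : GYO φ [] φ
  | removeVar {φ ψ : CNF n} {a : List (GYOOp n)} (x : Fin n) (c : Finset (Fin n)) :
      c ∈ φ → x ∈ c → (∀ d ∈ φ, x ∈ d → d = c) →
      GYO (insert (c.erase x) (φ.erase c)) a ψ → GYO φ (GYOOp.var x :: a) ψ
  | removeClause {φ ψ : CNF n} {a : List (GYOOp n)} (c d : Finset (Fin n)) :
      c ∈ φ → d ∈ φ → c ≠ d → c ⊆ d →
      GYO (φ.erase c) a ψ → GYO φ (GYOOp.clause c :: a) ψ

/-- `φ` is `α`-acyclic: `φ = 1` (no clauses), or some GYO-reduction leads from `φ` to the CNF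
`0` whose only clause is the empty clause. -/
def CNF.AlphaAcyclic {n : ℕ} (φ : CNF n) : Prop :=
  φ = ∅ ∨ ∃ a : List (GYOOp n), GYO φ a {∅}

/-! ### Degenerate CNFs -/

/-- For the variable ordering `σ 0, σ 1, …, σ (n-1)`, the CNF obtained from `φ` by fixing to `1`
all variables but the first `i` ones. A clause that contains a fixed variable disappears, and the
other clauses are unchanged. -/
def CNF.initialPart {n : ℕ} (φ : CNF n) (σ : Equiv.Perm (Fin n)) (i : ℕ) : CNF n :=
  φ.filter fun c => ∀ x ∈ c, (σ.symm x : ℕ) < i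

/-- The clauses that appear when the variable `σ i` is released. -/
def CNF.delta {n : ℕ} (φ : CNF n) (σ : Equiv.Perm (Fin n)) (i : Fin n) : CNF n :=
  φ.initialPart σ (i + 1) \ φ.initialPart σ i

/-- The variable ordering `σ` witnesses that `φ` is `k`-degenerate. -/
def CNF.IsDegenerateVia {n : ℕ} (φ : CNF n) (k : ℕ) (σ : Equiv.Perm (Fin n)) : Prop :=
  ∀ i : Fin n, (φ.delta σ i).card ≤ k

/-- `φ` is `k`-degenerate. -/
def CNF.IsDegenerate {n : ℕ} (φ : CNF n) (k : ℕ) : Prop :=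
  ∃ σ : Equiv.Perm (Fin n), φ.IsDegenerateVia k σ

/-- The variable ordering `σ` is the reverse of the order in which `a` removes variables: if `a`
removes `x` before it removes `y`, then `y` precedes `x` in the ordering. -/
def ReversesRemovals {n : ℕ} (σ : Equiv.Perm (Fin n)) (a : List (GYOOp n)) : Prop :=
  ∀ x y : Fin n, [GYOOp.var x, GYOOp.var y].Sublist a → σ.symm y < σ.symm x

/-! ### Random access machines with output

A program works on finitely many registers and on a memory with random access, which both hold
natural numbers. Every assignment, output operation and test takes one unit of time. The only
arithmetic operations are the successor and the predecessor (memory is addressed as base plus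
offset), so that the largest number stored grows by at most one in a unit of time, apart from
the finitely many constants of the program. -/

/-- Programs. Registers are named by natural numbers. -/
inductive Prog : Type
  /-- `R[r] := k` -/
  | set (r k : ℕ) : Prog
  /-- `R[r] := R[s]` -/
  | copy (r s : ℕ) : Prog
  /-- `R[r] := R[r] + 1` -/
  | inc (r : ℕ) : Prog
  /-- `R[r] := R[r] - 1`, where `0 - 1 = 0` -/
  | dec (r : ℕ) : Prog
  /-- `R[r] := M[R[a] + R[i]]` -/
  | load (r a i : ℕ) : Prog
  /-- `M[R[a] + R[i]] := R[r]` -/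
  | store (a i r : ℕ) : Prog
  /-- write `R[r]` to the output -/
  | write (r : ℕ) : Prog
  /-- declare that the current item of the output is complete -/
  | endItem : Prog
  /-- `p; q` -/
  | seq (p q : Prog) : Prog
  /-- `if R[a] < R[b] then p else q` -/
  | ite (a b : ℕ) (p q : Prog) : Prog
  /-- `while R[a] < R[b] do p` -/
  | loop (a b : ℕ) (p : Prog) : Prog

/-- The contents of the registers and of the memory. -/
structure State : Type where
  reg : ℕ → ℕ
  mem : ℕ → ℕ

/-- What can be observed in one unit of time: nothing, an output of a number, or the completion
of an item of the output. -/
inductive Event : Type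
  | tick : Event
  | write (k : ℕ) : Event
  | endItem : Event

/-- `R[r] := k` -/
def State.setReg (s : State) (r k : ℕ) : State :=
  { s with reg := Function.update s.reg r k }

/-- `M[a] := k` -/
def State.setMem (s : State) (a k : ℕ) : State :=
  { s with mem := Function.update s.mem a k }

/-- `Runs p s tr s'`: started in the state `s`, the program `p` halts in the state `s'`, and `tr`
is the sequence of events of this run, one event for each unit of time. -/
inductive Runs : Prog → State → List Event → State → Prop
  | set (s : State) (r k : ℕ) : Runs (.set r k) s [.tick] (s.setReg r k)
  | copy (s : State) (r r' : ℕ) : Runs (.copy r r') s [.tick] (s.setReg r (s.reg r'))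
  | inc (s : State) (r : ℕ) : Runs (.inc r) s [.tick] (s.setReg r (s.reg r + 1))
  | dec (s : State) (r : ℕ) : Runs (.dec r) s [.tick] (s.setReg r (s.reg r - 1))
  | load (s : State) (r a i : ℕ) :
      Runs (.load r a i) s [.tick] (s.setReg r (s.mem (s.reg a + s.reg i)))
  | store (s : State) (a i r : ℕ) :
      Runs (.store a i r) s [.tick] (s.setMem (s.reg a + s.reg i) (s.reg r))
  | write (s : State) (r : ℕ) : Runs (.write r) s [.write (s.reg r)] s
  | endItem (s : State) : Runs .endItem s [.endItem] s
  | seq {p q : Prog} {s s' s'' : State} {u w : List Event} :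
      Runs p s u s' → Runs q s' w s'' → Runs (.seq p q) s (u ++ w) s''
  | iteTrue {a b : ℕ} {p q : Prog} {s s' : State} {u : List Event} :
      s.reg a < s.reg b → Runs p s u s' → Runs (.ite a b p q) s (.tick :: u) s'
  | iteFalse {a b : ℕ} {p q : Prog} {s s' : State} {u : List Event} :
      ¬ s.reg a < s.reg b → Runs q s u s' → Runs (.ite a b p q) s (.tick :: u) s'
  | loopTrue {a b : ℕ} {p : Prog} {s s' s'' : State} {u w : List Event} :
      s.reg a < s.reg b → Runs p s u s' → Runs (.loop a b p) s' w s'' →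
      Runs (.loop a b p) s (.tick :: (u ++ w)) s''
  | loopFalse {a b : ℕ} {p : Prog} {s : State} :
      ¬ s.reg a < s.reg b → Runs (.loop a b p) s [.tick] s

/-- The numbers that are written in a sequence of events. -/
def written : List Event → List ℕ
  | [] => []
  | .tick :: u => written u
  | .write k :: u => k :: written u
  | .endItem :: u => written u

/-- `OutputsWithDelay D tr ws`: the run with the events `tr` outputs the items `ws` one after the
other, such that at most `D` units of time pass until the first item is complete, between the
completion of an item and that of the next one, and from the completion of the last item (from
the start, if there is none) until the machine halts. -/
inductive OutputsWithDelay (D : ℕ) : List Event → List (List ℕ) → Prop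
  | halt (u : List Event) : Event.endItem ∉ u → written u = [] → u.length ≤ D →
      OutputsWithDelay D u []
  | item (u : List Event) {tr : List Event} {ws : List (List ℕ)} :
      Event.endItem ∉ u → u.length + 1 ≤ D → OutputsWithDelay D tr ws →
      OutputsWithDelay D (u ++ Event.endItem :: tr) (written u :: ws)

/-! ### Input, output, and dualization -/

/-- `I` lists the clauses of `φ`, and the variables of each clause, in some order and without
repetition. -/
def IsListing {n : ℕ} (I : List (List (Fin n))) (φ : CNF n) : Prop :=
  (∀ c ∈ I, c.Nodup) ∧ (I.map List.toFinset).Nodup ∧ (I.map List.toFinset).toFinset = φ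

/-- The input of the machine: the number of variables, the number of clauses, and for each clause
its number of variables followed by its variables. -/
def encode {n : ℕ} (I : List (List (Fin n))) : List ℕ :=
  n :: I.length :: I.flatMap fun c => c.length :: c.map fun x => (x : ℕ)

/-- The input is in the memory from address `0` on, and everything else is `0`. -/
def initialState {n : ℕ} (I : List (List (Fin n))) : State where
  reg := fun _ => 0
  mem := fun a => (encode I).getD a 0

/-- The list of numbers `w` represents the monotone clause (or term) `t`: it lists the variables of
`t` in some order and without repetition. -/
def Represents {n : ℕ} (w : List ℕ) (t : Finset (Literal n)) : Prop :=
  ∃ l : List (Fin n), l.Nodup ∧ (l.map fun x => (x : ℕ)) = w ∧ positive l.toFinset = t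

/-- On every input that lists the monotone CNF `φ` of a function `f`, the program `P` halts after
it has output, with delay at most `D`, the clauses of the prime CNF of the dual `f^d` (that is, all
prime implicates of `f^d`), each of them once. The same sets of variables are the terms of the
prime DNF of `f` (that is, all prime implicants of `f`). -/
def DualizesWithDelay (P : Prog) {n : ℕ} (φ : CNF n) (D : ℕ) : Prop :=
  ∀ I : List (List (Fin n)), IsListing I φ →
    ∃ (tr : List Event) (s : State) (ws : List (List ℕ)) (ts : List (Finset (Literal n))),
      Runs P (initialState I) tr s ∧ OutputsWithDelay D tr ws ∧
      List.Forall₂ Represents ws ts ∧ ts.Nodup ∧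
      (∀ t : Finset (Literal n), t ∈ ts ↔ IsPrimeImplicate (dual φ.fn) t) ∧
      (∀ t : Finset (Literal n), t ∈ ts ↔ IsPrimeImplicant φ.fn t)

end MonotoneDual

open MonotoneDual

/-! Acyclicity enters only through 1-degeneracy. Let an ordering reverse the removals of a
GYO-reduction, and let `c`, `c'` be clauses with the same last variable `x`. Variables removed
before `x` come after `x` in the ordering, so they lie in neither clause. Hence, until `x` is
removed, each of `c`, `c'` is still contained in some clause of the current CNF. When `x` is
removed, only one clause contains `x`, and this clause contains `c ∪ c'`. Undoing operations never
destroys such a superset, so some clause of `φ` contains `c ∪ c'` (`GYO.exists_superset_union`). The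
clauses of a prime CNF form an antichain, so `c = c'` (`GYO.isDegenerateVia`).

For the algorithm, the prime implicants of `f` are the minimal transversals of `φ`, and they are the
prime implicates of the dual as well. In a 1-degenerate CNF, every nonempty family of nonempty
clauses has a member with a private variable, namely the last variable that occurs in the family.
Hence the clauses can be arranged as `c 0, …, c (m - 1)` such that each has a variable that is
absent from its predecessors, and `m ≤ n`.

The search tree has as nodes at level `j` the minimal transversals of `c 0, …, c (j - 1)`. A child
of `T` is `T` itself or `T` with one element of `c j` added, if this is a minimal transversal for
the next level. Every node has exactly one parent (`Admissible.parent_unique`,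
`MinTrans.exists_parent`), so each solution is exactly one leaf (`leaves_spec`). The new variable of
`c j` guarantees a child (`MinTrans.exists_child`), so there are no dead ends. Between consecutive
leaves the search climbs part of one path and descends part of another. A path offers `∑ (|c j| +
1)` candidates, which is `O(‖φ‖)` for nonempty clauses, and each is tested in time `O(n²)`
(`AtNode.outputs`).

The program is verified with timed postconditions (`Ex`) over an explicit memory layout (`Env`). -/

namespace MonotoneDual

/-! ### Prime implicants and minimal transversals -/

/-- `s` meets all clauses of `φ`. -/
def CNF.IsTransversal {n : ℕ} (φ : CNF n) (s : Finset (Fin n)) : Prop :=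
  ∀ c ∈ φ, ∃ x ∈ c, x ∈ s

/-- `s` is a transversal of `φ` that is minimal under inclusion. -/
def CNF.IsMinTransversal {n : ℕ} (φ : CNF n) (s : Finset (Fin n)) : Prop :=
  φ.IsTransversal s ∧ ∀ s' ⊆ s, φ.IsTransversal s' → s' = s

theorem mem_positive {n : ℕ} {s : Finset (Fin n)} {l : Literal n} :
    l ∈ positive s ↔ l.1 ∈ s ∧ l.2 = true := by
  obtain ⟨x, b⟩ := l
  simp only [positive, Finset.mem_image, Prod.mk.injEq]
  constructor
  · rintro ⟨y, hy, rfl, rfl⟩; exact ⟨hy, rfl⟩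
  · rintro ⟨h, h'⟩; exact ⟨x, h, rfl, h'.symm⟩

theorem positive_injective {n : ℕ} : Function.Injective (positive (n := n)) := by
  intro s t h
  ext x
  have := congrArg (fun u => (x, true) ∈ u) h
  simpa [mem_positive] using this

theorem isConsistent_positive {n : ℕ} (s : Finset (Fin n)) : IsConsistent (positive s) := by
  rintro x ⟨-, h⟩
  simp [mem_positive] at h

theorem termFun_eq_true {n : ℕ} {t : Finset (Literal n)} {v : Fin n → Bool} :
    termFun t v = true ↔ ∀ l ∈ t, v l.1 = l.2 := by simp [termFun]

theorem clauseFun_eq_true {n : ℕ} {t : Finset (Literal n)} {v : Fin n → Bool} :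
    clauseFun t v = true ↔ ∃ l ∈ t, v l.1 = l.2 := by simp [clauseFun]

theorem clauseFun_positive {n : ℕ} {c : Finset (Fin n)} {v : Fin n → Bool} :
    clauseFun (positive c) v = true ↔ ∃ x ∈ c, v x = true := by
  rw [clauseFun_eq_true]
  constructor
  · rintro ⟨l, hl, h⟩
    rw [mem_positive] at hl
    exact ⟨l.1, hl.1, by rw [h, hl.2]⟩
  · rintro ⟨x, hx, h⟩
    exact ⟨(x, true), mem_positive.2 ⟨hx, rfl⟩, h⟩

theorem CNF.fn_eq_true {n : ℕ} {φ : CNF n} {v : Fin n → Bool} :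
    φ.fn v = true ↔ ∀ c ∈ φ, ∃ x ∈ c, v x = true := by
  simp [CNF.fn, clauseFun_positive]

theorem BoolFun.le_iff {n : ℕ} {f g : BoolFun n} :
    f ≤ g ↔ ∀ v, f v = true → g v = true := by
  rw [Pi.le_def]
  exact forall_congr' fun v => by cases f v <;> cases g v <;> simp

theorem termFun_positive_le_fn {n : ℕ} {φ : CNF n} {s : Finset (Fin n)} :
    termFun (positive s) ≤ φ.fn ↔ φ.IsTransversal s := by
  rw [BoolFun.le_iff]
  constructor
  · intro h c hc
    have := h (fun x => decide (x ∈ s)) (termFun_eq_true.2 fun l hl => by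
      rw [mem_positive] at hl; simp [hl.1, hl.2])
    obtain ⟨x, hx, hs⟩ := CNF.fn_eq_true.1 this c hc
    exact ⟨x, hx, by simpa using hs⟩
  · intro h v hv
    rw [CNF.fn_eq_true]
    intro c hc
    obtain ⟨x, hx, hs⟩ := h c hc
    exact ⟨x, hx, termFun_eq_true.1 hv (x, true) (mem_positive.2 ⟨hs, rfl⟩)⟩

theorem termFun_le_termFun {n : ℕ} {t u : Finset (Literal n)} (h : u ⊆ t) :
    termFun t ≤ termFun u := by
  rw [BoolFun.le_iff]
  intro v hv
  rw [termFun_eq_true] at hv ⊢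
  exact fun l hl => hv l (h hl)

/-- If a literal of `u` were missing from `t`, then flipping that literal and otherwise following
`t` would satisfy `t` but not `u`. Thus the order on consistent terms is reverse inclusion. -/
theorem subset_of_termFun_le {n : ℕ} {t u : Finset (Literal n)} (ht : IsConsistent t)
    (h : termFun t ≤ termFun u) : u ⊆ t := by
  intro l hl
  rw [BoolFun.le_iff] at h
  by_contra hlt
  have := h (fun x => if x = l.1 then !l.2 else decide ((x, true) ∈ t)) (by
    rw [termFun_eq_true]
    rintro ⟨x, b⟩ hx
    by_cases hxl : x = l.1
    · subst hxl
      have : b ≠ l.2 := by rintro rfl; exact hlt hx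
      simp only [if_true]
      cases b <;> cases hl2 : l.2 <;> simp_all
    · simp only [hxl, if_false]
      cases b
      · have := ht x
        simp_all
      · simp [hx])
  have := termFun_eq_true.1 this l hl
  simp at this

/-- The set of variables that occur positively in `t`. -/
def positivePart {n : ℕ} (t : Finset (Literal n)) : Finset (Fin n) :=
  Finset.univ.filter fun x => (x, true) ∈ t

theorem positive_positivePart_subset {n : ℕ} (t : Finset (Literal n)) :
    positive (positivePart t) ⊆ t := by
  rintro ⟨x, b⟩ h
  simp only [mem_positive, positivePart, Finset.mem_filter, Finset.mem_univ, true_and] at h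
  obtain ⟨h, rfl⟩ := h
  exact h

/-- Tested on the assignment that makes exactly the positively occurring variables true. Consistency
makes it satisfy `t`, and a monotone clause can only be satisfied there by such a variable. -/
theorem isTransversal_positivePart {n : ℕ} {φ : CNF n} {t : Finset (Literal n)}
    (ht : IsConsistent t) (h : termFun t ≤ φ.fn) : φ.IsTransversal (positivePart t) := by
  rw [BoolFun.le_iff] at h
  have := h (fun x => decide ((x, true) ∈ t)) (by
    rw [termFun_eq_true]
    rintro ⟨x, b⟩ hx
    cases b
    · have := ht x
      simp_all
    · simp [hx])
  intro c hc
  obtain ⟨x, hx, h'⟩ := CNF.fn_eq_true.1 this c hc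
  exact ⟨x, hx, by simpa [positivePart] using h'⟩

/-- Dropping the negative literals of an implicant of a monotone function leaves an implicant, so
prime implicants are positive. Maximality among terms then becomes minimality under inclusion. -/
theorem isPrimeImplicant_iff {n : ℕ} {φ : CNF n} {t : Finset (Literal n)} :
    IsPrimeImplicant φ.fn t ↔ ∃ s, positive s = t ∧ φ.IsMinTransversal s := by
  constructor
  · rintro ⟨hc, hle, hmax⟩
    have key : ∀ s, φ.IsTransversal s → positive s ⊆ t → positive s = t := by
      intro s hs hst
      refine Finset.Subset.antisymm hst ?_
      by_contra hn
      refine hmax ⟨positive s, isConsistent_positive s, termFun_positive_le_fn.2 hs,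
        lt_of_le_not_ge (termFun_le_termFun hst) fun h => ?_⟩
      exact hn (subset_of_termFun_le (isConsistent_positive s) h)
    have hp := isTransversal_positivePart hc hle
    have he := key _ hp (positive_positivePart_subset t)
    refine ⟨positivePart t, he, hp, fun s' hs' ht' => ?_⟩
    refine positive_injective ((key s' ht' ?_).trans he.symm)
    refine (Finset.image_subset_image hs').trans (positive_positivePart_subset t)
  · rintro ⟨s, rfl, hs, hmin⟩
    refine ⟨isConsistent_positive s, termFun_positive_le_fn.2 hs, ?_⟩
    rintro ⟨t', hc', hle', hlt⟩
    have hsub := subset_of_termFun_le (isConsistent_positive s) hlt.le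
    have hp := isTransversal_positivePart hc' hle'
    have hss : positivePart t' ⊆ s := by
      intro x hx
      have := hsub (positive_positivePart_subset t' (mem_positive.2 ⟨hx, rfl⟩ : (x, true) ∈ _))
      exact (mem_positive.1 this).1
    have := hmin _ hss hp
    refine hlt.not_ge (termFun_le_termFun ?_)
    rw [← this]
    exact positive_positivePart_subset t'

theorem dual_le_dual {n : ℕ} {f g : BoolFun n} : dual f ≤ dual g ↔ g ≤ f := by
  simp only [BoolFun.le_iff, dual]
  constructor
  · intro h v
    have := h (fun x => !v x)
    simp only [Bool.not_not] at this
    cases hf : f v <;> cases hg : g v <;> simp_all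
  · intro h v
    have := h (fun x => !v x)
    revert this
    cases f fun x => !v x <;> cases g fun x => !v x <;> simp

/-- De Morgan. Since dualization reverses the order, it turns statements about implicates into
statements about implicants. -/
theorem clauseFun_eq_dual {n : ℕ} (t : Finset (Literal n)) : clauseFun t = dual (termFun t) := by
  funext v
  rw [Bool.eq_iff_iff, clauseFun_eq_true]
  simp only [dual, termFun, Bool.not_eq_true', decide_eq_false_iff_not, not_forall]
  constructor
  · rintro ⟨l, hl, h⟩
    exact ⟨l, hl, by rw [h]; simp⟩
  · rintro ⟨l, hl, h⟩
    refine ⟨l, hl, ?_⟩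
    revert h
    cases v l.1 <;> cases l.2 <;> simp

theorem isPrimeImplicate_dual_iff {n : ℕ} {f : BoolFun n} {t : Finset (Literal n)} :
    IsPrimeImplicate (dual f) t ↔ IsPrimeImplicant f t := by
  simp only [IsPrimeImplicate, IsPrimeImplicant, clauseFun_eq_dual, dual_le_dual,
    lt_iff_le_not_ge]

/-- A proper subclause would be an implicate strictly below `d`. This antichain property is all that
is used of primality. -/
theorem CNF.IsPrime.eq_of_subset {n : ℕ} {φ : CNF n} (h : φ.IsPrime) {c d : Finset (Fin n)}
    (hc : c ∈ φ) (hd : d ∈ φ) (hcd : c ⊆ d) : c = d := by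
  by_contra hne
  refine (h d hd).2.2 ⟨positive c, isConsistent_positive c, (h c hc).2.1, ?_⟩
  rw [clauseFun_eq_dual, clauseFun_eq_dual, lt_iff_le_not_ge, dual_le_dual, dual_le_dual]
  refine ⟨termFun_le_termFun (Finset.image_subset_image hcd), fun hle => hne ?_⟩
  refine Finset.Subset.antisymm hcd fun x hx => ?_
  exact (mem_positive.1 (subset_of_termFun_le (isConsistent_positive c) hle
    (mem_positive.2 ⟨hx, rfl⟩ : (x, true) ∈ _))).1

/-! ### GYO-reductions -/

theorem GYO.exists_mem_of_var_mem {n : ℕ} {φ ψ : CNF n} {a : List (GYOOp n)} (h : GYO φ a ψ)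
    {x : Fin n} (hx : GYOOp.var x ∈ a) : ∃ c ∈ φ, x ∈ c := by
  induction h with
  | nil => simp at hx
  | removeVar y c hc hy hu _ ih =>
    by_cases hxy : x = y
    · subst hxy; exact ⟨c, hc, hy⟩
    · obtain ⟨d, hd, hxd⟩ := ih (by simpa [hxy] using hx)
      rcases Finset.mem_insert.1 hd with rfl | hd
      · exact ⟨c, hc, Finset.mem_of_mem_erase hxd⟩
      · exact ⟨d, Finset.mem_of_mem_erase hd, hxd⟩
  | removeClause c d hc hd hne hsub _ ih =>
    obtain ⟨e, he, hxe⟩ := ih (by simpa using hx)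
    exact ⟨e, Finset.mem_of_mem_erase he, hxe⟩

/-- After its removal `x` occurs in no clause, and no operation introduces a variable. So a
reduction removes each variable at most once. -/
theorem GYO.not_var_mem {n : ℕ} {φ ψ : CNF n} {a : List (GYOOp n)} {x : Fin n}
    {c : Finset (Fin n)} (hu : ∀ d ∈ φ, x ∈ d → d = c)
    (h : GYO (insert (c.erase x) (φ.erase c)) a ψ) : GYOOp.var x ∉ a := by
  intro hx
  obtain ⟨d, hd, hxd⟩ := h.exists_mem_of_var_mem hx
  rcases Finset.mem_insert.1 hd with rfl | hd
  · simp at hxd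
  · exact Finset.ne_of_mem_erase hd (hu d (Finset.mem_of_mem_erase hd) hxd)

/-- Being contained in some clause is the property followed through a reduction. Only the removal of
one of its own variables can deprive a set of it. -/
theorem exists_superset_removeVar {n : ℕ} {φ : CNF n} {x : Fin n} {c e : Finset (Fin n)}
    (h : ∃ d ∈ φ, e ⊆ d) (hx : x ∉ e) : ∃ d ∈ insert (c.erase x) (φ.erase c), e ⊆ d := by
  obtain ⟨d, hd, hed⟩ := h
  by_cases hdc : d = c
  · subst hdc
    exact ⟨_, Finset.mem_insert_self _ _, Finset.subset_erase.2 ⟨hed, hx⟩⟩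
  · exact ⟨d, Finset.mem_insert_of_mem (Finset.mem_erase.2 ⟨hdc, hd⟩), hed⟩

theorem exists_superset_removeClause {n : ℕ} {φ : CNF n} {c d e : Finset (Fin n)}
    (hd : d ∈ φ) (hne : c ≠ d) (hsub : c ⊆ d) (h : ∃ d ∈ φ, e ⊆ d) :
    ∃ d ∈ φ.erase c, e ⊆ d := by
  obtain ⟨u, hu, heu⟩ := h
  by_cases huc : u = c
  · subst huc
    exact ⟨d, Finset.mem_erase.2 ⟨hne.symm, hd⟩, heu.trans hsub⟩
  · exact ⟨u, Finset.mem_erase.2 ⟨huc, hu⟩, heu⟩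

/-- The final CNF has no clause containing `{x}`, and only the removal of `x` can bring this about.
-/
theorem GYO.var_mem {n : ℕ} {φ : CNF n} {a : List (GYOOp n)} (h : GYO φ a {∅}) {x : Fin n}
    (hx : ∃ c ∈ φ, {x} ⊆ c) : GYOOp.var x ∈ a := by
  generalize hψ : ({∅} : CNF n) = ψ at h
  induction h with
  | nil => subst hψ; simp at hx
  | removeVar y c hc hy hu _ ih =>
    by_cases hxy : x = y
    · simp [hxy]
    · exact List.mem_cons_of_mem _
        (ih (exists_superset_removeVar hx (by simpa using Ne.symm hxy)) hψ)
  | removeClause c d hc hd hne hsub _ ih =>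
    exact List.mem_cons_of_mem _ (ih (exists_superset_removeClause hd hne hsub hx) hψ)

/-- Induction along the reduction with `c` and `c'` fixed. They need not remain clauses, so the
induction only keeps track of clauses containing them. The step that removes `x` merges these into
one. -/
theorem GYO.exists_superset_union {n : ℕ} {φ : CNF n} {a : List (GYOOp n)} (h : GYO φ a {∅})
    {σ : Equiv.Perm (Fin n)} (hσ : ReversesRemovals σ a) {x : Fin n} {c c' : Finset (Fin n)}
    (hc : ∃ e ∈ φ, c ⊆ e) (hc' : ∃ e ∈ φ, c' ⊆ e) (hx : x ∈ c) (hx' : x ∈ c')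
    (hm : ∀ y ∈ c, σ.symm y ≤ σ.symm x) (hm' : ∀ y ∈ c', σ.symm y ≤ σ.symm x) :
    ∃ e ∈ φ, c ⊆ e ∧ c' ⊆ e := by
  generalize hψ : ({∅} : CNF n) = ψ at h
  induction h with
  | nil => subst hψ; obtain ⟨e, he, hce⟩ := hc; simp at he; subst he; simpa using hce hx
  | @removeVar φ' _ _ y d hd hy hu h ih =>
    subst hψ
    by_cases hxy : x = y
    · subst hxy
      obtain ⟨e, he, hce⟩ := hc
      obtain ⟨e', he', hce'⟩ := hc'
      obtain rfl := hu e he (hce hx)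
      obtain rfl := hu e' he' (hce' hx')
      exact ⟨_, he, hce, hce'⟩
    -- `x` still has to be removed after `y`, so `y` follows `x` in the ordering and cannot lie in a
    -- set whose last variable is `x`.
    · have hlt : ∀ {u : Finset (Fin n)}, (∃ e ∈ φ', u ⊆ e) → x ∈ u →
          (∀ y ∈ u, σ.symm y ≤ σ.symm x) → y ∉ u := by
        intro u hu' hxu hmu hyu
        obtain ⟨e, he, hue⟩ := hu'
        have hxa := h.var_mem (exists_superset_removeVar (c := d) (x := y)
          ⟨e, he, Finset.singleton_subset_iff.2 (hue hxu)⟩ (by simpa using Ne.symm hxy))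
        have := hσ y x (List.Sublist.cons_cons _ (List.singleton_sublist.2 hxa))
        exact absurd (hmu y hyu) (not_le.2 this)
      obtain ⟨e, he, h1, h2⟩ := ih (fun u v huv => hσ u v (huv.cons _))
        (exists_superset_removeVar hc (hlt hc hx hm))
        (exists_superset_removeVar hc' (hlt hc' hx' hm')) rfl
      rcases Finset.mem_insert.1 he with rfl | he
      · exact ⟨d, hd, h1.trans (Finset.erase_subset _ _), h2.trans (Finset.erase_subset _ _)⟩
      · exact ⟨e, Finset.mem_of_mem_erase he, h1, h2⟩
  | removeClause d d' hd hd' hne hsub h ih =>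
    obtain ⟨e, he, h1⟩ := ih (fun u v huv => hσ u v (huv.cons _))
      (exists_superset_removeClause hd' hne hsub hc)
      (exists_superset_removeClause hd' hne hsub hc') hψ
    exact ⟨e, Finset.mem_of_mem_erase he, h1⟩

theorem CNF.mem_delta {n : ℕ} {φ : CNF n} {σ : Equiv.Perm (Fin n)} {i : Fin n}
    {c : Finset (Fin n)} :
    c ∈ φ.delta σ i ↔ c ∈ φ ∧ σ i ∈ c ∧ ∀ y ∈ c, σ.symm y ≤ i := by
  simp only [CNF.delta, CNF.initialPart, Finset.mem_sdiff, Finset.mem_filter, not_and, not_forall]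
  constructor
  · rintro ⟨⟨hc, h1⟩, h2⟩
    obtain ⟨y, hy, hlt⟩ := h2 hc
    have h3 := h1 y hy
    have : σ.symm y = i := Fin.ext (by omega)
    refine ⟨hc, ?_, fun z hz => ?_⟩
    · rw [← this]; simpa using hy
    · have := h1 z hz; exact Fin.le_def.2 (by omega)
  · rintro ⟨hc, hi, h⟩
    refine ⟨⟨hc, fun y hy => ?_⟩, fun _ => ⟨σ i, hi, by simp⟩⟩
    have := Fin.le_def.1 (h y hy); omega

theorem GYO.isDegenerateVia {n : ℕ} {φ : CNF n} {a : List (GYOOp n)} (hp : φ.IsPrime)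
    (h : GYO φ a {∅}) {σ : Equiv.Perm (Fin n)} (hσ : ReversesRemovals σ a) :
    φ.IsDegenerateVia 1 σ := by
  intro i
  rw [Finset.card_le_one]
  intro c hc c' hc'
  rw [CNF.mem_delta] at hc hc'
  obtain ⟨e, he, h1, h2⟩ := h.exists_superset_union hσ ⟨c, hc.1, le_rfl⟩ ⟨c', hc'.1, le_rfl⟩
    hc.2.1 hc'.2.1 (by simpa using hc.2.2) (by simpa using hc'.2.2)
  rw [hp.eq_of_subset hc.1 he h1, hp.eq_of_subset hc'.1 he h2]

/-- `idxOf` sees only first occurrences, which suffices because no variable is removed twice. -/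
theorem GYO.idxOf_lt {n : ℕ} [BEq (GYOOp n)] [LawfulBEq (GYOOp n)] {φ ψ : CNF n} {a : List (GYOOp n)}
    (h : GYO φ a ψ) {x y : Fin n} (hs : [GYOOp.var x, GYOOp.var y].Sublist a) :
    a.idxOf (GYOOp.var x) < a.idxOf (GYOOp.var y) := by
  induction h with
  | nil => simp at hs
  | removeVar z c hc hz hu h ih =>
    have hna := h.not_var_mem hu
    cases hs with
    | cons _ hs =>
      have hx : GYOOp.var z ≠ GYOOp.var x := fun h' => hna (h' ▸ hs.subset (by simp))
      have hy : GYOOp.var z ≠ GYOOp.var y := fun h' => hna (h' ▸ hs.subset (by simp))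
      rw [List.idxOf_cons_ne _ hx, List.idxOf_cons_ne _ hy]
      exact Nat.succ_lt_succ (ih hs)
    | cons_cons _ hs =>
      have hy : GYOOp.var x ≠ GYOOp.var y := fun h' => hna (h' ▸ List.singleton_sublist.1 hs)
      rw [List.idxOf_cons_self, List.idxOf_cons_ne _ hy]
      omega
  | removeClause c d hc hd hne hsub h ih =>
    rcases hs with _ | hs
    rename_i hs
    rw [List.idxOf_cons_ne _ (by simp), List.idxOf_cons_ne _ (by simp)]
    exact Nat.succ_lt_succ (ih hs)

open Classical in
theorem GYO.exists_reversesRemovals {n : ℕ} {φ ψ : CNF n} {a : List (GYOOp n)}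
    (h : GYO φ a ψ) : ∃ σ : Equiv.Perm (Fin n), ReversesRemovals σ a := by
  -- Sorting by `f` puts late removals first. A variable that is never removed has index `a.length`,
  -- so its key is `0`.
  let f : Fin n → ℕ := fun x => a.length - a.idxOf (GYOOp.var x)
  refine ⟨Tuple.sort f, fun x y hs => ?_⟩
  by_contra hle
  have h1 := Tuple.monotone_sort f (not_lt.1 hle)
  simp only [Function.comp, Equiv.apply_symm_apply, f] at h1
  have h2 := h.idxOf_lt hs
  have h3 : a.idxOf (GYOOp.var y) < a.length := List.idxOf_lt_length_of_mem (hs.subset (by simp))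
  omega

theorem CNF.AlphaAcyclic.isDegenerate {n : ℕ} {φ : CNF n} (hp : φ.IsPrime)
    (h : φ.AlphaAcyclic) : φ.IsDegenerate 1 := by
  rcases h with rfl | ⟨a, h⟩
  · exact ⟨1, fun i => by simp [CNF.delta, CNF.initialPart]⟩
  · obtain ⟨σ, hσ⟩ := h.exists_reversesRemovals
    exact ⟨σ, h.isDegenerateVia hp hσ⟩

/-! ### Private variables in 1-degenerate CNFs -/

/-- Take the last variable `x` that occurs in `S`. Every clause of `S` containing `x` has `x` as its
last variable, so all of them lie in the same `delta`, which has at most one element. -/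
theorem CNF.IsDegenerate.exists_private {n : ℕ} {φ : CNF n} (h : φ.IsDegenerate 1)
    {S : CNF n} (hS : S ⊆ φ) (hne : S.Nonempty) (h0 : ∀ c ∈ S, c.Nonempty) :
    ∃ c ∈ S, ∃ x ∈ c, ∀ d ∈ S, x ∈ d → d = c := by
  obtain ⟨σ, hσ⟩ := h
  have hV : (S.biUnion id).Nonempty := by
    obtain ⟨c, hc⟩ := hne
    obtain ⟨x, hx⟩ := h0 c hc
    exact ⟨x, Finset.mem_biUnion.2 ⟨c, hc, hx⟩⟩
  obtain ⟨x, hx, hmax⟩ := Finset.exists_max_image _ (fun x => σ.symm x) hV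
  obtain ⟨c, hc, hxc⟩ := Finset.mem_biUnion.1 hx
  have key : ∀ d ∈ S, x ∈ d → d ∈ φ.delta σ (σ.symm x) := fun d hd hxd =>
    CNF.mem_delta.2 ⟨hS hd, by simpa using hxd, fun y hy =>
      hmax y (Finset.mem_biUnion.2 ⟨d, hd, hy⟩)⟩
  exact ⟨c, hc, x, hxc, fun d hd hxd =>
    Finset.card_le_one.1 (hσ (σ.symm x)) d (key d hd hxd) c (key c hc hxc)⟩

/-- Each nonempty clause lies in the `delta` of its last variable. This bound lets one test take
time `O(n²)`. -/
theorem CNF.IsDegenerate.card_le {n : ℕ} {φ : CNF n} (h : φ.IsDegenerate 1)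
    (h0 : ∀ c ∈ φ, c.Nonempty) : φ.card ≤ n := by
  obtain ⟨σ, hσ⟩ := h
  have hsub : φ ⊆ Finset.univ.biUnion (φ.delta σ) := by
    intro c hc
    obtain ⟨x, hx, hmax⟩ := Finset.exists_max_image c (fun x => σ.symm x) (h0 c hc)
    exact Finset.mem_biUnion.2 ⟨σ.symm x, Finset.mem_univ _,
      CNF.mem_delta.2 ⟨hc, by simpa using hx, hmax⟩⟩
  calc φ.card ≤ (Finset.univ.biUnion (φ.delta σ)).card := Finset.card_le_card hsub
    _ ≤ ∑ i, (φ.delta σ i).card := Finset.card_biUnion_le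
    _ ≤ ∑ _i : Fin n, 1 := Finset.sum_le_sum fun i _ => hσ i
    _ = n := by simp

/-! ### Minimal transversals of the initial segments of a sequence of clauses -/

/-- `T` is a minimal transversal of the clauses `c 0, …, c (j - 1)`: it meets all of them, and
each element of `T` is the only common element of `T` and one of these clauses. -/
def MinTrans (c : ℕ → List ℕ) (j : ℕ) (T : Finset ℕ) : Prop :=
  (∀ q < j, ∃ x ∈ c q, x ∈ T) ∧ ∀ y ∈ T, ∃ q < j, y ∈ c q ∧ ∀ x ∈ c q, x ∈ T → x = y

/-- The set that the candidate `i` for an extension of `T` at the level `j` leads to. The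
candidate `0` stands for `T` itself, and the candidate `i + 1` for the addition of the `i`-th
element of `c j`. -/
def extend (c : ℕ → List ℕ) (j : ℕ) (T : Finset ℕ) (i : ℕ) : Finset ℕ :=
  if i = 0 then T else insert ((c j).getD (i - 1) 0) T

/-- The candidate `i` leads to a minimal transversal and does not duplicate an element. -/
def Admissible (c : ℕ → List ℕ) (j : ℕ) (T : Finset ℕ) (i : ℕ) : Prop :=
  (i ≠ 0 → (c j).getD (i - 1) 0 ∉ T) ∧ MinTrans c (j + 1) (extend c j T i)

open Classical in
/-- The minimal transversals that extend `T` at the level `j`, from the candidate `i` on, where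
`r` candidates are left. -/
noncomputable def childrenFrom (c : ℕ → List ℕ) (j : ℕ) (T : Finset ℕ) (i r : ℕ) :
    List (Finset ℕ) :=
  (List.range' i r).flatMap fun i => if Admissible c j T i then [extend c j T i] else []

/-- The leaves of the search tree below `T` at the level `j`, where `r` levels are left. -/
noncomputable def leaves (c : ℕ → List ℕ) : ℕ → ℕ → Finset ℕ → List (Finset ℕ)
  | 0, _, T => [T]
  | r + 1, j, T =>
    (childrenFrom c j T 0 ((c j).length + 1)).flatMap fun T' => leaves c r (j + 1) T'

theorem mem_childrenFrom {c : ℕ → List ℕ} {j : ℕ} {T S : Finset ℕ} {i r : ℕ} :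
    S ∈ childrenFrom c j T i r ↔
      ∃ k, i ≤ k ∧ k < i + r ∧ Admissible c j T k ∧ extend c j T k = S := by
  classical
  simp only [childrenFrom, List.mem_flatMap, List.mem_range'_1]
  constructor
  · rintro ⟨k, ⟨h1, h2⟩, h3⟩
    split_ifs at h3 with h
    · exact ⟨k, h1, h2, h, (List.mem_singleton.1 h3).symm⟩
    · simp at h3
  · rintro ⟨k, h1, h2, h, rfl⟩
    exact ⟨k, ⟨h1, h2⟩, by simp [h]⟩

/-- The clause that makes the new element indispensable must be `c j`, because `T` already meets
every earlier clause in another element. -/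
theorem Admissible.private_last {c : ℕ → List ℕ} {j : ℕ} {T : Finset ℕ} {i : ℕ}
    (hT : MinTrans c j T) (h : Admissible c j T i) (hi : i ≠ 0) :
    ∀ x ∈ c j, x ∈ extend c j T i → x = (c j).getD (i - 1) 0 := by
  obtain ⟨hz, h1, h2⟩ := h
  simp only [extend, hi, if_false] at h1 h2 ⊢
  obtain ⟨q, hq, hzq, hu⟩ := h2 _ (Finset.mem_insert_self _ _)
  rcases Nat.lt_succ_iff_lt_or_eq.1 hq with hq | rfl
  · obtain ⟨x, hx, hxT⟩ := hT.1 q hq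
    exact absurd (hu x hx (Finset.mem_insert_of_mem hxT) ▸ hxT) (hz hi)
  · exact hu

/-- The added element is redundant for the first `j` clauses. This separates proper extensions from
the candidate `0`. -/
theorem Admissible.not_minTrans {c : ℕ → List ℕ} {j : ℕ} {T : Finset ℕ} {i : ℕ}
    (hT : MinTrans c j T) (h : Admissible c j T i) (hi : i ≠ 0) :
    ¬ MinTrans c j (extend c j T i) := by
  rintro ⟨-, h2⟩
  simp only [extend, hi, if_false] at h2
  obtain ⟨q, hq, hzq, hu⟩ := h2 _ (Finset.mem_insert_self _ _)
  obtain ⟨x, hx, hxT⟩ := hT.1 q hq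
  exact h.1 hi (hu x hx (Finset.mem_insert_of_mem hxT) ▸ hxT)

/-- Whether `i = 0` can be read off from the child: exactly then it is already minimal at level `j`.
Otherwise the added element is the only common element of the child and `c j`, and erasing it
recovers `T`. -/
theorem Admissible.parent_unique {c : ℕ → List ℕ} {j : ℕ} {T T' : Finset ℕ} {i i' : ℕ}
    (hnd : (c j).Nodup) (hT : MinTrans c j T) (hT' : MinTrans c j T') (h : Admissible c j T i)
    (h' : Admissible c j T' i') (hi : i ≤ (c j).length) (hi' : i' ≤ (c j).length)
    (he : extend c j T i = extend c j T' i') : T = T' ∧ i = i' := by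
  by_cases h0 : i = 0
  · by_cases h0' : i' = 0
    · subst h0 h0'; simpa [extend] using he
    · exact absurd (by rw [← he, extend, if_pos h0]; exact hT) (h'.not_minTrans hT' h0')
  · by_cases h0' : i' = 0
    · exact absurd (by rw [he, extend, if_pos h0']; exact hT') (h.not_minTrans hT h0)
    · have e1 : (c j).getD (i - 1) 0 = (c j)[i - 1]'(by omega) := by
        rw [List.getD_eq_getElem]
      have e2 : (c j).getD (i' - 1) 0 = (c j)[i' - 1]'(by omega) := by
        rw [List.getD_eq_getElem]
      have hz : (c j).getD (i - 1) 0 = (c j).getD (i' - 1) 0 := by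
        refine h'.private_last hT' h0' _ (by rw [e1]; exact List.getElem_mem _) ?_
        rw [← he, extend, if_neg h0]
        exact Finset.mem_insert_self _ _
      have hii : i - 1 = i' - 1 := by
        rw [e1, e2] at hz
        exact (hnd.getElem_inj_iff).1 hz
      refine ⟨?_, by omega⟩
      have := he
      rw [extend, if_neg h0, extend, if_neg h0', ← hz] at this
      rw [← Finset.erase_insert (h.1 h0), this, hz, Finset.erase_insert (h'.1 h0')]

/-- If `S` is not minimal for the first `j` clauses, some `y ∈ S` is indispensable only because of
`c j`. Erasing this `y` gives the parent, in which the other elements keep their private clauses: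
these differ from `c j`, which meets `S` only in `y`. -/
theorem MinTrans.exists_parent {c : ℕ → List ℕ} {j : ℕ} {S : Finset ℕ}
    (h : MinTrans c (j + 1) S) :
    ∃ T i, MinTrans c j T ∧ i < (c j).length + 1 ∧ Admissible c j T i ∧ extend c j T i = S := by
  by_cases hS : MinTrans c j S
  · exact ⟨S, 0, hS, by omega, ⟨by simp, by simpa [extend] using h⟩, by simp [extend]⟩
  · have : ∃ y ∈ S, ∀ q < j, y ∈ c q → ∃ x ∈ c q, x ∈ S ∧ x ≠ y := by
      by_contra hn
      push Not at hn
      exact hS ⟨fun q hq => h.1 q (by omega), hn⟩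
    obtain ⟨y, hy, hyn⟩ := this
    obtain ⟨q, hq, hyq, hu⟩ := h.2 y hy
    have hqj : q = j := by
      by_contra hne
      obtain ⟨x, hx, hxS, hxy⟩ := hyn q (by omega) hyq
      exact hxy (hu x hx hxS)
    subst hqj
    obtain ⟨i, hi, rfl⟩ := List.getElem_of_mem hyq
    have hext : extend c q (S.erase (c q)[i]) (i + 1) = S := by
      simp only [extend, Nat.add_sub_cancel, List.getD_eq_getElem _ _ hi]
      simpa using Finset.insert_erase hy
    refine ⟨S.erase (c q)[i], i + 1, ⟨fun q' hq' => ?_, fun w hw => ?_⟩, by omega,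
      ⟨fun _ => ?_, hext.symm ▸ h⟩, hext⟩
    · by_cases hm : (c q)[i] ∈ c q'
      · obtain ⟨x, hx, hxS, hxy⟩ := hyn q' hq' hm
        exact ⟨x, hx, Finset.mem_erase.2 ⟨hxy, hxS⟩⟩
      · obtain ⟨x, hx, hxS⟩ := h.1 q' (by omega)
        exact ⟨x, hx, Finset.mem_erase.2 ⟨fun he => hm (he ▸ hx), hxS⟩⟩
    · obtain ⟨hwy, hwS⟩ := Finset.mem_erase.1 hw
      obtain ⟨q', hq', hwq, hu'⟩ := h.2 w hwS
      rcases Nat.lt_succ_iff_lt_or_eq.1 hq' with hq' | rfl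
      · exact ⟨q', hq', hwq, fun x hx hxS => hu' x hx (Finset.mem_of_mem_erase hxS)⟩
      · exact absurd (hu w hwq hwS) hwy
    · rw [Nat.add_sub_cancel, List.getD_eq_getElem _ _ hi]
      exact Finset.notMem_erase _ _

/-- If `T` meets `c j`, then `T` itself is a child. Otherwise the variable of `c j` that is new can
be added: it lies in no earlier clause, so it spoils no private clause of an element of `T`. -/
theorem MinTrans.exists_child {c : ℕ → List ℕ} {j : ℕ} {T : Finset ℕ}
    (hpr : ∃ x ∈ c j, ∀ q < j, x ∉ c q) (h : MinTrans c j T) :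
    ∃ i < (c j).length + 1, Admissible c j T i := by
  by_cases hhit : ∃ x ∈ c j, x ∈ T
  · refine ⟨0, by omega, by simp, ?_⟩
    simp only [extend, if_true]
    refine ⟨fun q hq => ?_, fun y hy => ?_⟩
    · rcases Nat.lt_succ_iff_lt_or_eq.1 hq with hq | rfl
      · exact h.1 q hq
      · exact hhit
    · obtain ⟨q, hq, hu⟩ := h.2 y hy
      exact ⟨q, by omega, hu⟩
  · obtain ⟨x, hx, hxn⟩ := hpr
    push Not at hhit
    obtain ⟨i, hi, rfl⟩ := List.getElem_of_mem hx
    have hext : extend c j T (i + 1) = insert (c j)[i] T := by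
      simp only [extend, Nat.add_sub_cancel, List.getD_eq_getElem _ _ hi]
      simp
    refine ⟨i + 1, by omega, fun _ => ?_, ?_⟩
    · rw [Nat.add_sub_cancel, List.getD_eq_getElem _ _ hi]
      exact hhit _ hx
    · rw [hext]
      refine ⟨fun q hq => ?_, fun y hy => ?_⟩
      · rcases Nat.lt_succ_iff_lt_or_eq.1 hq with hq | rfl
        · obtain ⟨x, hx, hxT⟩ := h.1 q hq
          exact ⟨x, hx, Finset.mem_insert_of_mem hxT⟩
        · exact ⟨_, hx, Finset.mem_insert_self _ _⟩
      · rcases Finset.mem_insert.1 hy with rfl | hy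
        · exact ⟨j, by omega, hx, fun w hw hwT =>
            (Finset.mem_insert.1 hwT).resolve_right (hhit w hw)⟩
        · obtain ⟨q, hq, hyq, hu⟩ := h.2 y hy
          refine ⟨q, by omega, hyq, fun w hw hwT => ?_⟩
          rcases Finset.mem_insert.1 hwT with rfl | hwT
          · exact absurd hw (hxn q hq)
          · exact hu w hw hwT

theorem childrenFrom_succ (c : ℕ → List ℕ) (j : ℕ) (T : Finset ℕ) (i r : ℕ) :
    (Admissible c j T i →
      childrenFrom c j T i (r + 1) = extend c j T i :: childrenFrom c j T (i + 1) r) ∧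
    (¬ Admissible c j T i → childrenFrom c j T i (r + 1) = childrenFrom c j T (i + 1) r) := by
  constructor <;> intro h <;> simp [childrenFrom, List.range'_succ, h]

theorem nodup_childrenFrom {c : ℕ → List ℕ} {j : ℕ} {T : Finset ℕ} (hnd : (c j).Nodup)
    (hT : MinTrans c j T) (i r : ℕ) (h : i + r ≤ (c j).length + 1) :
    (childrenFrom c j T i r).Nodup := by
  induction r generalizing i with
  | zero => simp [childrenFrom]
  | succ r ih =>
    have h' := ih (i + 1) (by omega)
    by_cases ha : Admissible c j T i
    · rw [(childrenFrom_succ c j T i r).1 ha, List.nodup_cons]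
      refine ⟨fun hm => ?_, h'⟩
      obtain ⟨k, h1, h2, h3, h4⟩ := mem_childrenFrom.1 hm
      have := (ha.parent_unique hnd hT hT h3 (by omega) (by omega) h4.symm).2
      omega
    · rwa [(childrenFrom_succ c j T i r).2 ha]

/-- The induction treats a whole level at once. Duplicate-freeness of the next level compares
children of different nodes, so it cannot be followed below a single node. -/
theorem leaves_spec_aux {c : ℕ → List ℕ} (r j : ℕ) (hnd : ∀ q < j + r, (c q).Nodup)
    (L : List (Finset ℕ)) (hL : L.Nodup) (hmem : ∀ T, T ∈ L ↔ MinTrans c j T) :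
    (L.flatMap (leaves c r j)).Nodup ∧
      ∀ S, S ∈ L.flatMap (leaves c r j) ↔ MinTrans c (j + r) S := by
  induction r generalizing j L with
  | zero =>
    have : L.flatMap (leaves c 0 j) = L := by
      have : leaves c 0 j = fun T => [T] := by funext T; rfl
      rw [this]; simp
    rw [this]
    exact ⟨hL, by simpa using hmem⟩
  | succ r ih =>
    have hj := hnd j (by omega)
    have e : L.flatMap (leaves c (r + 1) j) =
        (L.flatMap fun T => childrenFrom c j T 0 ((c j).length + 1)).flatMap
          (leaves c r (j + 1)) := by
      rw [List.flatMap_assoc]; rfl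
    rw [e, show j + (r + 1) = j + 1 + r by omega]
    refine ih (j + 1) (fun q hq => hnd q (by omega)) _ ?_ fun S => ?_
    · rw [List.nodup_flatMap]
      refine ⟨fun T hT => nodup_childrenFrom hj ((hmem T).1 hT) _ _ (by omega), ?_⟩
      refine hL.imp_of_mem fun {T T'} hT hT' hne => ?_
      intro S hS hS'
      obtain ⟨k, _, h2, h3, h4⟩ := mem_childrenFrom.1 hS
      obtain ⟨k', _, h2', h3', h4'⟩ := mem_childrenFrom.1 hS'
      exact hne (h3.parent_unique hj ((hmem T).1 hT) ((hmem T').1 hT') h3' (by omega) (by omega)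
        (h4.trans h4'.symm)).1
    · rw [List.mem_flatMap]
      constructor
      · rintro ⟨T, -, hS⟩
        obtain ⟨k, _, _, h3, rfl⟩ := mem_childrenFrom.1 hS
        exact h3.2
      · intro hS
        obtain ⟨T, i, hT, hi, ha, rfl⟩ := hS.exists_parent
        exact ⟨T, (hmem T).2 hT, mem_childrenFrom.2 ⟨i, by omega, by omega, ha, rfl⟩⟩

theorem leaves_spec {c : ℕ → List ℕ} (m : ℕ) (hnd : ∀ q < m, (c q).Nodup) :
    (leaves c m 0 ∅).Nodup ∧ ∀ S, S ∈ leaves c m 0 ∅ ↔ MinTrans c m S := by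
  have := leaves_spec_aux m 0 (by simpa using hnd) [∅] (by simp) (by
    intro T
    simp only [List.mem_singleton, MinTrans, Nat.not_lt_zero, false_and, exists_false]
    constructor
    · rintro rfl; simp
    · rintro ⟨-, h⟩; exact Finset.eq_empty_of_forall_notMem fun x hx => h x hx)
  simpa using this

theorem childrenFrom_ne_nil {c : ℕ → List ℕ} {j : ℕ} {T : Finset ℕ}
    (hpr : ∃ x ∈ c j, ∀ q < j, x ∉ c q) (h : MinTrans c j T) :
    childrenFrom c j T 0 ((c j).length + 1) ≠ [] := by
  obtain ⟨i, hi, ha⟩ := h.exists_child hpr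
  exact List.ne_nil_of_mem (mem_childrenFrom.2 ⟨i, by omega, by omega, ha, rfl⟩)

/-! ### Reasoning about programs -/

/-- The registers that a program may change. -/
def Prog.changes : Prog → ℕ → Bool
  | .set r _, x => r == x
  | .copy r _, x => r == x
  | .inc r, x => r == x
  | .dec r, x => r == x
  | .load r _ _, x => r == x
  | .store _ _ _, _ => false
  | .write _, _ => false
  | .endItem, _ => false
  | .seq p q, x => p.changes x || q.changes x
  | .ite _ _ p q, x => p.changes x || q.changes x
  | .loop _ _ p, x => p.changes x

@[simp] theorem State.reg_setReg (s : State) (r k x : ℕ) :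
    (s.setReg r k).reg x = if x = r then k else s.reg x := by
  simp [State.setReg, Function.update_apply]

@[simp] theorem State.mem_setReg (s : State) (r k : ℕ) : (s.setReg r k).mem = s.mem := rfl

@[simp] theorem State.reg_setMem (s : State) (a k : ℕ) : (s.setMem a k).reg = s.reg := rfl

theorem State.mem_setMem (s : State) (a k x : ℕ) :
    (s.setMem a k).mem x = if x = a then k else s.mem x := by
  simp [State.setMem, Function.update_apply]

theorem Runs.reg_eq {p : Prog} {s s' : State} {u : List Event} (h : Runs p s u s') {x : ℕ}
    (hx : p.changes x = false) : s'.reg x = s.reg x := by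
  induction h <;>
    simp only [Prog.changes, Bool.or_eq_false_iff, beq_eq_false_iff_ne] at hx <;>
    first
    | rw [State.reg_setReg, if_neg (Ne.symm hx)]
    | rfl
    | simp_all [Prog.changes]

theorem written_append (u v : List Event) : written (u ++ v) = written u ++ written v := by
  induction u with
  | nil => rfl
  | cons e u ih => cases e <;> simp [written, ih]

/-- Started in `s`, the program `p` halts after at most `T` units of time in a state with the
property `Q`, without completing an item of the output, and it writes `w`. -/
def Ex (p : Prog) (s : State) (T : ℕ) (w : List ℕ) (Q : State → Prop) : Prop :=
  ∃ u s', Runs p s u s' ∧ Event.endItem ∉ u ∧ written u = w ∧ u.length ≤ T ∧ Q s'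

theorem Ex.mono {p : Prog} {s : State} {T T' : ℕ} {w : List ℕ} {Q Q' : State → Prop}
    (h : Ex p s T w Q) (hT : T ≤ T') (hQ : ∀ s', Q s' → Q' s') : Ex p s T' w Q' := by
  obtain ⟨u, s', h1, h2, h3, h4, h5⟩ := h
  exact ⟨u, s', h1, h2, h3, h4.trans hT, hQ _ h5⟩

/-- A frame rule: registers that are not assigned anywhere in `p` need not be mentioned in
postconditions. -/
theorem Ex.frame {p : Prog} {s : State} {T : ℕ} {w : List ℕ} {Q : State → Prop}
    (h : Ex p s T w Q) :
    Ex p s T w fun s' => Q s' ∧ ∀ x, p.changes x = false → s'.reg x = s.reg x := by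
  obtain ⟨u, s', h1, h2, h3, h4, h5⟩ := h
  exact ⟨u, s', h1, h2, h3, h4, h5, fun x hx => h1.reg_eq hx⟩

theorem Ex.seq {p q : Prog} {s : State} {T T' : ℕ} {w w' : List ℕ} {Q : State → Prop}
    (h : Ex p s T w fun s' => Ex q s' T' w' Q) : Ex (.seq p q) s (T + T') (w ++ w') Q := by
  obtain ⟨u, s', h1, h2, rfl, h4, u', s'', h1', h2', rfl, h4', h5⟩ := h
  exact ⟨u ++ u', s'', h1.seq h1', by simp [h2, h2'], written_append _ _, by
    rw [List.length_append]; omega, h5⟩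

/-- `Ex.seq` for programs without output, with a bound for the total time. -/
theorem Ex.seq' {p q : Prog} {s : State} {T₁ T₂ T : ℕ} {Q : State → Prop}
    (h : Ex p s T₁ [] fun s' => Ex q s' T₂ [] Q) (hT : T₁ + T₂ ≤ T) :
    Ex (.seq p q) s T [] Q :=
  (Ex.seq h).mono hT fun _ h => h

theorem Ex.ite {a b : ℕ} {p q : Prog} {s : State} {T : ℕ} {w : List ℕ} {Q : State → Prop}
    (h1 : s.reg a < s.reg b → Ex p s T w Q) (h2 : ¬ s.reg a < s.reg b → Ex q s T w Q) :
    Ex (.ite a b p q) s (T + 1) w Q := by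
  by_cases h : s.reg a < s.reg b
  · obtain ⟨u, s', k1, k2, k3, k4, k5⟩ := h1 h
    exact ⟨_, s', .iteTrue h k1, by simpa using k2, by simpa [written] using k3,
      by simpa using k4, k5⟩
  · obtain ⟨u, s', k1, k2, k3, k4, k5⟩ := h2 h
    exact ⟨_, s', .iteFalse h k1, by simpa using k2, by simpa [written] using k3,
      by simpa using k4, k5⟩

/-- Programs without loops that do not complete items of the output. -/
def Prog.isBlock : Prog → Bool
  | .endItem => false
  | .loop _ _ _ => false
  | .seq p q => p.isBlock && q.isBlock
  | .ite _ _ p q => p.isBlock && q.isBlock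
  | _ => true

/-- The effect of a program without loops. -/
def Prog.eval : Prog → State → State
  | .set r k, s => s.setReg r k
  | .copy r r', s => s.setReg r (s.reg r')
  | .inc r, s => s.setReg r (s.reg r + 1)
  | .dec r, s => s.setReg r (s.reg r - 1)
  | .load r a i, s => s.setReg r (s.mem (s.reg a + s.reg i))
  | .store a i r, s => s.setMem (s.reg a + s.reg i) (s.reg r)
  | .write _, s => s
  | .endItem, s => s
  | .seq p q, s => q.eval (p.eval s)
  | .ite a b p q, s => if s.reg a < s.reg b then p.eval s else q.eval s
  | .loop _ _ _, s => s

/-- The output of a program without loops. -/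
def Prog.output : Prog → State → List ℕ
  | .write r, s => [s.reg r]
  | .seq p q, s => p.output s ++ q.output (p.eval s)
  | .ite a b p q, s => if s.reg a < s.reg b then p.output s else q.output s
  | _, _ => []

/-- A time bound for programs without loops. -/
def Prog.cost : Prog → ℕ
  | .seq p q => p.cost + q.cost
  | .ite _ _ p q => max p.cost q.cost + 1
  | _ => 1

theorem Ex.block_output {p : Prog} (hp : p.isBlock = true) (s : State) :
    Ex p s p.cost (p.output s) (· = p.eval s) := by
  induction p generalizing s with
  | set r k => exact ⟨_, _, .set s r k, by simp, rfl, le_rfl, rfl⟩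
  | copy r k => exact ⟨_, _, .copy s r k, by simp, rfl, le_rfl, rfl⟩
  | inc r => exact ⟨_, _, .inc s r, by simp, rfl, le_rfl, rfl⟩
  | dec r => exact ⟨_, _, .dec s r, by simp, rfl, le_rfl, rfl⟩
  | load r a i => exact ⟨_, _, .load s r a i, by simp, rfl, le_rfl, rfl⟩
  | store a i r => exact ⟨_, _, .store s a i r, by simp, rfl, le_rfl, rfl⟩
  | write r => exact ⟨_, _, .write s r, by simp, rfl, le_rfl, rfl⟩
  | endItem => simp [Prog.isBlock] at hp
  | loop a b p => simp [Prog.isBlock] at hp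
  | seq p q ihp ihq =>
    simp only [Prog.isBlock, Bool.and_eq_true] at hp
    exact Ex.seq ((ihp hp.1 s).mono le_rfl fun s' h => by subst h; exact ihq hp.2 _)
  | ite a b p q ihp ihq =>
    simp only [Prog.isBlock, Bool.and_eq_true] at hp
    refine Ex.ite (fun h => ?_) fun h => ?_
    · have := ihp hp.1 s
      simp only [Prog.output, Prog.eval, if_pos h]
      exact this.mono (le_max_left _ _) fun _ h => h
    · have := ihq hp.2 s
      simp only [Prog.output, Prog.eval, if_neg h]
      exact this.mono (le_max_right _ _) fun _ h => h

/-- Programs that do not write. -/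
def Prog.isSilent : Prog → Bool
  | .write _ => false
  | .seq p q => p.isSilent && q.isSilent
  | .ite _ _ p q => p.isSilent && q.isSilent
  | _ => true

theorem Prog.output_eq_nil {p : Prog} (h : p.isSilent = true) (s : State) : p.output s = [] := by
  induction p generalizing s with
  | seq p q ihp ihq =>
    simp only [Prog.isSilent, Bool.and_eq_true] at h
    simp [Prog.output, ihp h.1, ihq h.2]
  | ite a b p q ihp ihq =>
    simp only [Prog.isSilent, Bool.and_eq_true] at h
    simp [Prog.output, ihp h.1, ihq h.2]
  | write r => simp [Prog.isSilent] at h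
  | _ => rfl

/-- Reduces silent straight-line code with branches to the computation of `Prog.eval`. -/
theorem Ex.block {p : Prog} {s : State} {T : ℕ} {Q : State → Prop} (hp : p.isBlock = true)
    (hs : p.isSilent = true) (hT : p.cost ≤ T) (hQ : Q (p.eval s)) : Ex p s T [] Q := by
  rw [← Prog.output_eq_nil hs s]
  exact (Ex.block_output hp s).mono hT fun s' h => h ▸ hQ

/-- `for i < R[l] do p` -/
def Prog.forTo (i l : ℕ) (p : Prog) : Prog :=
  .seq (.set i 0) (.loop i l (.seq p (.inc i)))

/-- Each round costs the test, the body and the increment, that is `c + 2`. Initializing the counter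
and the last test account for the final `2`. The invariant is required with the counter already set
to its next value. -/
theorem Ex.forTo_output {i l : ℕ} {p : Prog} {s : State} {K c : ℕ} (w : ℕ → List ℕ)
    (I : ℕ → State → Prop) (hil : l ≠ i) (hi : p.changes i = false) (hl : p.changes l = false)
    (hK : s.reg l = K) (h0 : I 0 (s.setReg i 0))
    (hstep : ∀ k < K, ∀ s', I k s' → s'.reg i = k → s'.reg l = K →
      Ex p s' c (w k) fun s'' => I (k + 1) (s''.setReg i (k + 1))) :
    Ex (.forTo i l p) s (K * (c + 2) + 2) ((List.range K).flatMap w) (I K) := by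
  have key : ∀ r k s', k + r = K → I k s' → s'.reg i = k → s'.reg l = K →
      Ex (.loop i l (.seq p (.inc i))) s' (r * (c + 2) + 1) ((List.range' k r).flatMap w)
        (I K) := by
    intro r
    induction r with
    | zero =>
      intro k s' hk hI h1 h2
      refine ⟨_, s', .loopFalse (by omega), by simp, rfl, by simp, ?_⟩
      rwa [← hk]
    | succ r ih =>
      intro k s' hk hI h1 h2
      obtain ⟨u, s1, k1, k2, k3, k4, k5, k6⟩ := (hstep k (by omega) s' hI h1 h2).frame
      have hs1 : s1.reg i = k := by rw [k6 i hi, h1]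
      have hl1 : s1.reg l = K := by rw [k6 l hl, h2]
      obtain ⟨u', s2, j1, j2, j3, j4, j5⟩ := ih (k + 1) (s1.setReg i (k + 1)) (by omega) k5
        (by simp) (by simp [hil, hl1])
      have hinc := Runs.inc s1 i
      rw [hs1] at hinc
      refine ⟨_, s2, .loopTrue (by omega) (k1.seq hinc) j1, ?_, ?_, ?_, j5⟩
      · simp [k2, j2]
      · simp [written, written_append, k3, j3, List.range'_succ]
      · simp only [List.length_cons, List.length_append, List.length_nil]
        rw [add_mul]; omega
  have := Ex.seq (p := .set i 0) (T := 1) (w := []) (s := s)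
    ⟨_, _, .set s i 0, by simp, rfl, le_rfl,
      key K 0 (s.setReg i 0) (by omega) h0 (by simp) (by simp [hil, hK])⟩
  rw [List.range_eq_range']
  exact this.mono (by omega) fun _ h => h

theorem Ex.forTo {i l : ℕ} {p : Prog} {s : State} (K c : ℕ)
    (I : ℕ → State → Prop) (hil : l ≠ i) (hi : p.changes i = false) (hl : p.changes l = false)
    (hK : s.reg l = K) (h0 : I 0 (s.setReg i 0))
    (hstep : ∀ k < K, ∀ s', I k s' → s'.reg i = k → s'.reg l = K →
      Ex p s' c [] fun s'' => I (k + 1) (s''.setReg i (k + 1))) :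
    Ex (.forTo i l p) s (K * (c + 2) + 2) [] (I K) := by
  have := Ex.forTo_output (fun _ => []) I hil hi hl hK h0 hstep
  rwa [List.flatMap_eq_nil_iff.2 fun _ _ => rfl] at this

/-! ### Output with delay -/

/-- `OutputsWithDelay`, with a separate bound `F` for the time until the first item is complete
(or until the machine halts, if there is none). -/
def OutputsFrom (D F : ℕ) (u : List Event) : List (List ℕ) → Prop
  | [] => Event.endItem ∉ u ∧ written u = [] ∧ u.length ≤ F
  | w :: ws => ∃ v u', u = v ++ Event.endItem :: u' ∧ Event.endItem ∉ v ∧ v.length + 1 ≤ F ∧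
      written v = w ∧ OutputsWithDelay D u' ws

theorem OutputsFrom.outputsWithDelay {D F : ℕ} {u : List Event} {ws : List (List ℕ)}
    (h : OutputsFrom D F u ws) (hF : F ≤ D) : OutputsWithDelay D u ws := by
  cases ws with
  | nil => exact .halt u h.1 h.2.1 (h.2.2.trans hF)
  | cons w ws =>
    obtain ⟨v, u', rfl, h1, h2, rfl, h3⟩ := h
    exact .item v h1 (h2.trans hF) h3

theorem OutputsFrom.append {D F F' : ℕ} {u v : List Event} {ws : List (List ℕ)}
    (h : OutputsFrom D F u ws) (h1 : Event.endItem ∉ v) (h2 : written v = [])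
    (h3 : v.length + F ≤ F') : OutputsFrom D F' (v ++ u) ws := by
  cases ws with
  | nil =>
    exact ⟨by simp [h1, h.1], by simp [written_append, h2, h.2.1], by
      rw [List.length_append]; have := h.2.2; omega⟩
  | cons w ws =>
    obtain ⟨v', u', rfl, k1, k2, rfl, k3⟩ := h
    exact ⟨v ++ v', u', by simp, by simp [h1, k1], by rw [List.length_append]; omega,
      by simp [written_append, h2], k3⟩

/-- Started in `s`, the loop `while R[a] < R[b] do p` outputs `ws`, the first item in time `F` and
the others with delay at most `D`. -/
def LoopOutputs (a b : ℕ) (p : Prog) (D F : ℕ) (s : State) (ws : List (List ℕ)) : Prop :=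
  ∃ u s', Runs (.loop a b p) s u s' ∧ OutputsFrom D F u ws

theorem LoopOutputs.step {a b : ℕ} {p : Prog} {D F F' c : ℕ} {s : State} {ws : List (List ℕ)}
    (hab : s.reg a < s.reg b) (h : Ex p s c [] fun s' => LoopOutputs a b p D F s' ws)
    (hF : F + c + 1 ≤ F') : LoopOutputs a b p D F' s ws := by
  obtain ⟨u, s', h1, h2, h3, h4, u', s'', h1', h2'⟩ := h
  refine ⟨_, s'', .loopTrue hab h1 h1', ?_⟩
  have := h2'.append (v := .tick :: u) (F' := F') (by simpa using h2) (by simpa [written] using h3)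
    (by rw [List.length_cons]; omega)
  simpa using this

/-- Started in `s`, the program `p` writes `w`, completes an item of the output, and halts in a
state with the property `Q`, all this in time `T`. -/
def ExItem (p : Prog) (s : State) (T : ℕ) (w : List ℕ) (Q : State → Prop) : Prop :=
  ∃ u v s', Runs p s (u ++ .endItem :: v) s' ∧ Event.endItem ∉ u ∧ Event.endItem ∉ v ∧
    written u = w ∧ written v = [] ∧ u.length + 1 ≤ T ∧ v.length ≤ T ∧ Q s'

theorem ExItem.seq_left {p q : Prog} {s : State} {T T' : ℕ} {w : List ℕ} {Q : State → Prop}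
    (h : Ex p s T [] fun s' => ExItem q s' T' w Q) : ExItem (.seq p q) s (T + T') w Q := by
  obtain ⟨u, s', h1, h2, h3, h4, u', v, s'', k1, k2, k3, k4, k5, k6, k7, k8⟩ := h
  refine ⟨u ++ u', v, s'', by simpa using h1.seq k1, by simp [h2, k2], k3, ?_, k5, ?_, ?_, k8⟩
  · simp [written_append, h3, k4]
  · rw [List.length_append]; omega
  · omega

theorem ExItem.ite {a b : ℕ} {p q : Prog} {s : State} {T : ℕ} {w : List ℕ} {Q : State → Prop}
    (h1 : s.reg a < s.reg b → ExItem p s T w Q) (h2 : ¬ s.reg a < s.reg b → ExItem q s T w Q) :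
    ExItem (.ite a b p q) s (T + 1) w Q := by
  by_cases h : s.reg a < s.reg b
  · obtain ⟨u, v, s', k1, k2, k3, k4, k5, k6, k7, k8⟩ := h1 h
    exact ⟨.tick :: u, v, s', .iteTrue h k1, by simpa using k2, k3, by simpa [written] using k4,
      k5, by simpa using k6, by omega, k8⟩
  · obtain ⟨u, v, s', k1, k2, k3, k4, k5, k6, k7, k8⟩ := h2 h
    exact ⟨.tick :: u, v, s', .iteFalse h k1, by simpa using k2, k3, by simpa [written] using k4,
      k5, by simpa using k6, by omega, k8⟩

theorem ExItem.intro {p q : Prog} {s : State} {T : ℕ} {w : List ℕ} {Q : State → Prop}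
    (h : Ex p s T w fun s' => Ex q s' T [] Q) :
    ExItem (.seq p (.seq .endItem q)) s (T + 1) w Q := by
  obtain ⟨u, s', h1, h2, h3, h4, v, s'', k1, k2, k3, k4, k5⟩ := h
  exact ⟨u, v, s'', h1.seq ((Runs.endItem s').seq k1), h2, k2, h3, k3, by omega, by omega, k5⟩

/-- What the body does after completing the item counts towards the next delay, hence the condition
`F + c ≤ D`. -/
theorem LoopOutputs.item {a b : ℕ} {p : Prog} {D F F' c : ℕ} {s : State} {w : List ℕ}
    {ws : List (List ℕ)} (hab : s.reg a < s.reg b)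
    (h : ExItem p s c w fun s' => LoopOutputs a b p D F s' ws)
    (hD : F + c ≤ D) (hF : c + 1 ≤ F') : LoopOutputs a b p D F' s (w :: ws) := by
  obtain ⟨u, v, s', h1, h2, h3, rfl, h5, h6, h7, u', s'', k1, k2⟩ := h
  refine ⟨_, s'', .loopTrue hab h1 k1, .tick :: u, v ++ u', by simp, by simpa using h2, ?_, rfl,
    (k2.append h3 h5 le_rfl).outputsWithDelay (by omega)⟩
  rw [List.length_cons]; omega

/-! ### The program -/

infixr:60 " ;; " => Prog.seq

/-! The registers: the constant zero, the numbers of variables and of clauses, the base addresses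
of the arrays, and working registers. The arrays are the list of the addresses of the clauses,
counters or marks for the variables, the multiplicities of the variables in the current set, and
the stack of candidates. -/

notation "rZ" => 0
notation "rN" => 1
notation "rM" => 2
notation "rO" => 3
notation "rC" => 4
notation "rT" => 5
notation "rH" => 6
notation "rJ" => 7
notation "rI" => 8
notation "rGo" => 9
notation "rP" => 10
notation "rLen" => 11
notation "rQ" => 12
notation "rE" => 13
notation "rX" => 14
notation "rV" => 15
notation "rW" => 16
notation "rCnt" => 17
notation "rOk" => 18
notation "rL" => 19
notation "rF" => 20
notation "rK" => 21
notation "rD" => 22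

/-- A step without effect on the registers that matter. -/
def Prog.nop : Prog := .set rD 0

/-- Sets all marks to zero. -/
def Prog.clear : Prog := .forTo rE rN (.store rC rE rZ)

/-- Runs through the elements of a clause that starts at the address `R[rP]`. -/
def Prog.scanClause (body : Prog) : Prog :=
  .forTo rE rLen (.inc rP ;; .load rX rP rZ ;; body)

/-- Runs through the first `R[rL]` clauses. -/
def Prog.scan (pre body post : Prog) : Prog :=
  .forTo rQ rL (.load rP rO rQ ;; .load rLen rP rZ ;; pre ;; .scanClause body ;; post)

/-- Computes the base addresses of the arrays. -/
def Prog.bases : Prog :=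
  (.copy rO rM ;; .inc rO ;; .inc rO) ;; .forTo rQ rM (.forTo rE rN (.inc rO)) ;;
    .copy rC rO ;; .forTo rE rN (.inc rC) ;; .copy rT rC ;; .forTo rE rN (.inc rT) ;;
    .copy rH rT ;; .forTo rE rN (.inc rH)

/-- Stores the addresses of the clauses. -/
def Prog.parse : Prog :=
  .set rP 2 ;; .forTo rQ rM ((.store rO rQ rP ;; .load rLen rP rZ ;; .inc rP) ;;
    .forTo rE rLen (.inc rP))

/-- Counts the occurrences of the variables in the first `R[rL]` clauses. -/
def Prog.count : Prog :=
  .scan .nop (.load rV rC rX ;; .inc rV ;; .store rC rX rV) .nop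

/-- Finds one of the first `R[rL]` clauses that contains a variable with a count below `2`. -/
def Prog.find : Prog :=
  .set rF 0 ;; .scan .nop
    (.load rV rC rX ;; .set rW 2 ;; .ite rV rW (.copy rF rQ) .nop) .nop

/-- Arranges the clauses such that each one contains a variable that does not occur in the clauses
before it. -/
def Prog.arrange : Prog :=
  .copy rL rM ;; .forTo rK rM (.clear ;; .count ;; .find ;;
    (.dec rL ;; .load rV rO rF ;; .load rW rO rL ;; .store rO rF rW ;; .store rO rL rV))

/-- Tests if the current set is a minimal transversal of the first `R[rJ] + 1` clauses. -/
def Prog.check : Prog :=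
  .clear ;; (.copy rL rJ ;; .inc rL ;; .set rOk 1) ;;
    .scan (.set rCnt 0) (.load rV rT rX ;; .ite rZ rV (.inc rCnt ;; .copy rW rX) .nop)
      (.ite rZ rCnt (.set rV 2 ;; .ite rCnt rV (.set rV 1 ;; .store rC rW rV) .nop)
        (.set rOk 0)) ;;
    .forTo rE rN (.load rV rT rE ;; .load rX rC rE ;; .ite rX rV (.set rOk 0) .nop)

/-- Adds the candidate `R[rI]` at the level `R[rJ]` to the current set. -/
def Prog.add : Prog :=
  .ite rZ rI (.load rP rO rJ ;; .load rX rP rI ;; .load rV rT rX ;; .inc rV ;; .store rT rX rV)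
    .nop

/-- Removes the candidate `R[rI]` at the level `R[rJ]` and goes on to the next candidate. -/
def Prog.undo : Prog :=
  .ite rZ rI (.load rP rO rJ ;; .load rX rP rI ;; .load rV rT rX ;; .dec rV ;; .store rT rX rV)
    .nop ;; .inc rI

/-- Tries the candidate `R[rI]` at the level `R[rJ]`. -/
def Prog.attempt : Prog :=
  .add ;; .check ;; .ite rZ rOk (.store rH rJ rI ;; .inc rJ ;; .set rI 0) .undo

/-- Returns to the previous level. -/
def Prog.back : Prog :=
  .ite rZ rJ (.dec rJ ;; .load rI rH rJ ;; .undo) (.set rGo 0)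

/-- Outputs the current set. -/
def Prog.emit : Prog :=
  .forTo rE rN (.load rV rT rE ;; .ite rZ rV (.write rE) .nop) ;; .endItem ;; .inc rI

/-- The body of the main loop. -/
def Prog.body : Prog :=
  .ite rJ rM (.load rP rO rJ ;; .load rLen rP rZ) (.set rLen 0) ;;
    .ite rLen rI .back (.ite rJ rM .attempt .emit)

/-- The dualization program, for CNFs with nonempty clauses. -/
def Prog.main : Prog :=
  .bases ;; .parse ;; .arrange ;; (.set rJ 0 ;; .set rI 0 ;; .set rGo 1) ;; .loop rZ rGo .body

/-- The dualization program. -/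
def Prog.dualize : Prog :=
  (.load rN rZ rZ ;; .set rV 1 ;; .load rM rZ rV) ;;
    .ite rZ rM ((.set rV 2 ;; .load rLen rZ rV) ;; .ite rZ rLen .main .nop) .endItem

/-! ### The memory layout -/

/-- An input: `m` clauses over `n` variables, the addresses of the clauses, and the address `B` of
the free memory. -/
structure Inst where
  (n m B : ℕ)
  cl : ℕ → List ℕ
  ad : ℕ → ℕ
  pos : 1 ≤ n
  m_le : m ≤ n
  B_eq : B = m + 2 + m * n
  lt : ∀ k < m, ∀ x ∈ cl k, x < n
  nodup : ∀ k < m, (cl k).Nodup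
  ad_zero : ad 0 = 2
  ad_succ : ∀ k < m, ad (k + 1) = ad k + (cl k).length + 1
  ad_lt : ∀ k < m, ad k + (cl k).length < B

theorem Inst.length_le (D : Inst) {k : ℕ} (hk : k < D.m) : (D.cl k).length ≤ D.n := by
  rw [← List.toFinset_card_of_nodup (D.nodup k hk), ← Finset.card_range D.n]
  exact Finset.card_le_card fun x hx => Finset.mem_range.2 (D.lt k hk x (List.mem_toFinset.1 hx))

theorem Inst.getD_mem (D : Inst) {k i : ℕ} (hi : i < (D.cl k).length) :
    (D.cl k).getD i 0 ∈ D.cl k := by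
  rw [List.getD_eq_getElem _ _ hi]; exact List.getElem_mem _

/-- The memory holds the input and the arrays `O`, `C`, `τ` and `H`. -/
structure Env (D : Inst) (s : State) (O C τ H : ℕ → ℕ) : Prop where
  zero : s.reg rZ = 0
  n : s.reg rN = D.n
  m : s.reg rM = D.m
  baseO : s.reg rO = D.B
  baseC : s.reg rC = D.B + D.n
  baseT : s.reg rT = D.B + D.n + D.n
  baseH : s.reg rH = D.B + D.n + D.n + D.n
  len : ∀ k < D.m, s.mem (D.ad k) = (D.cl k).length
  elt : ∀ k < D.m, ∀ i < (D.cl k).length, s.mem (D.ad k + (i + 1)) = (D.cl k).getD i 0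
  memO : ∀ k < D.m, s.mem (D.B + k) = O k
  memC : ∀ y < D.n, s.mem (D.B + D.n + y) = C y
  memT : ∀ y < D.n, s.mem (D.B + D.n + D.n + y) = τ y
  memH : ∀ k < D.m, s.mem (D.B + D.n + D.n + D.n + k) = H k

namespace Env

variable {D : Inst} {s s' : State} {O C τ H : ℕ → ℕ}

theorem congr (h : Env D s O C τ H) (hr : ∀ r < 7, s'.reg r = s.reg r) (hm : s'.mem = s.mem) :
    Env D s' O C τ H := by
  obtain ⟨h1, h2, h3, h4, h5, h6, h7, h8, h9, h10, h11, h12, h13⟩ := h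
  constructor
  all_goals first
    | rw [hm]; assumption
    | rw [hr _ (by norm_num)]; assumption

/-- A store at or above `B` leaves the input alone. The side conditions say how each array sees the
store; the four corollaries settle them by disjointness of the arrays. -/
theorem setMem (h : Env D s O C τ H) {a v : ℕ} (ha : D.B ≤ a) {O' C' τ' H' : ℕ → ℕ}
    (hO : ∀ k < D.m, (if D.B + k = a then v else O k) = O' k)
    (hC : ∀ k < D.n, (if D.B + D.n + k = a then v else C k) = C' k)
    (hT : ∀ k < D.n, (if D.B + D.n + D.n + k = a then v else τ k) = τ' k)
    (hH : ∀ k < D.m, (if D.B + D.n + D.n + D.n + k = a then v else H k) = H' k) :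
    Env D (s.setMem a v) O' C' τ' H' := by
  obtain ⟨h1, h2, h3, h4, h5, h6, h7, h8, h9, h10, h11, h12, h13⟩ := h
  refine ⟨h1, h2, h3, h4, h5, h6, h7, ?_, ?_, ?_, ?_, ?_, ?_⟩
  · intro k hk
    have := D.ad_lt k hk
    rw [State.mem_setMem, if_neg (by omega), h8 k hk]
  · intro k hk i hi
    have := D.ad_lt k hk
    rw [State.mem_setMem, if_neg (by omega), h9 k hk i hi]
  · intro k hk; rw [State.mem_setMem, h10 k hk, hO k hk]
  · intro k hk; rw [State.mem_setMem, h11 k hk, hC k hk]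
  · intro k hk; rw [State.mem_setMem, h12 k hk, hT k hk]
  · intro k hk; rw [State.mem_setMem, h13 k hk, hH k hk]

theorem storeO (h : Env D s O C τ H) {a v y : ℕ} (hy : y < D.m) (ha : a = D.B + y) :
    Env D (s.setMem a v) (Function.update O y v) C τ H := by
  -- Consecutive bases are `n` cells apart and `O` uses `m` of them, so `m ≤ n` keeps it away from
  -- the next array.
  have := D.m_le
  refine h.setMem (by omega) ?_ ?_ ?_ ?_ <;> intro k hk
  · simp only [ha, Function.update_apply, Nat.add_left_cancel_iff]
  all_goals rw [if_neg (by omega)]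

theorem storeC (h : Env D s O C τ H) {a v y : ℕ} (hy : y < D.n) (ha : a = D.B + D.n + y) :
    Env D (s.setMem a v) O (Function.update C y v) τ H := by
  have := D.m_le
  refine h.setMem (by omega) ?_ ?_ ?_ ?_ <;> intro k hk
  · rw [if_neg (by omega)]
  · simp only [ha, Function.update_apply, Nat.add_left_cancel_iff]
  all_goals rw [if_neg (by omega)]

theorem storeT (h : Env D s O C τ H) {a v y : ℕ} (hy : y < D.n) (ha : a = D.B + D.n + D.n + y) :
    Env D (s.setMem a v) O C (Function.update τ y v) H := by
  have := D.m_le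
  refine h.setMem (by omega) ?_ ?_ ?_ ?_ <;> intro k hk
  · rw [if_neg (by omega)]
  · rw [if_neg (by omega)]
  · simp only [ha, Function.update_apply, Nat.add_left_cancel_iff]
  · rw [if_neg (by omega)]

theorem storeH (h : Env D s O C τ H) {a v y : ℕ} (hy : y < D.m)
    (ha : a = D.B + D.n + D.n + D.n + y) :
    Env D (s.setMem a v) O C τ (Function.update H y v) := by
  have := D.m_le
  refine h.setMem (by omega) ?_ ?_ ?_ ?_ <;> intro k hk
  · rw [if_neg (by omega)]
  · rw [if_neg (by omega)]
  · rw [if_neg (by omega)]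
  · simp only [ha, Function.update_apply, Nat.add_left_cancel_iff]

theorem setReg (h : Env D s O C τ H) {r v : ℕ} (hr : 7 ≤ r) : Env D (s.setReg r v) O C τ H :=
  h.congr (fun r' hr' => by rw [State.reg_setReg, if_neg (by omega)]) rfl

theorem congrC (h : Env D s O C τ H) {C' : ℕ → ℕ} (hC : ∀ y < D.n, C y = C' y) :
    Env D s O C' τ H :=
  { h with memC := fun y hy => (h.memC y hy).trans (hC y hy) }

theorem congrT (h : Env D s O C τ H) {τ' : ℕ → ℕ} (hC : ∀ y < D.n, τ y = τ' y) :
    Env D s O C τ' H :=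
  { h with memT := fun y hy => (h.memT y hy).trans (hC y hy) }

end Env

/-- The two states agree up to the registers that are used for scanning clauses. -/
def State.Similar (s s' : State) : Prop :=
  s'.mem = s.mem ∧ ∀ r, (r < 10 ∨ 15 ≤ r) → s'.reg r = s.reg r

theorem State.Similar.setReg {s s' : State} (h : s.Similar s') {r v : ℕ}
    (hr : 10 ≤ r ∧ r < 15) : s.Similar (s'.setReg r v) :=
  ⟨h.1, fun r' hr' => by rw [State.reg_setReg, if_neg (by omega), h.2 r' hr']⟩

theorem State.Similar.refl (s : State) : s.Similar s := ⟨rfl, fun _ _ => rfl⟩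

theorem Env.similar {D : Inst} {s s' : State} {O C τ H : ℕ → ℕ} (h : Env D s O C τ H)
    (hs : s.Similar s') : Env D s' O C τ H :=
  h.congr (fun r hr => hs.2 r (by omega)) hs.1

/-- `Bv i` is the invariant after `i` elements. It must ignore the scanning registers, which the
loop itself overwrites. The time is stated with `n` in place of the clause length, so that it is
uniform over the clauses. -/
theorem Ex.scanClause {D : Inst} {body : Prog} {s : State} {O : ℕ → ℕ} {k cb : ℕ} (hk : k < D.m)
    (Bv : ℕ → State → Prop)
    (hch : body.changes rP = false ∧ body.changes rLen = false ∧ body.changes rE = false)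
    (hEnv : ∀ i s, Bv i s → ∃ C τ H, Env D s O C τ H)
    (hsim : ∀ i s s', s.Similar s' → s'.reg rQ = s.reg rQ → Bv i s → Bv i s')
    (h0 : Bv 0 s) (hP : s.reg rP = D.ad k) (hLen : s.reg rLen = (D.cl k).length)
    (hbody : ∀ i < (D.cl k).length, ∀ s, Bv i s → s.reg rX = (D.cl k).getD i 0 →
      Ex body s cb [] (Bv (i + 1))) :
    Ex (.scanClause body) s (D.n * (cb + 4) + 2) [] (Bv (D.cl k).length) := by
  have hle := D.length_le hk
  refine (Ex.forTo (D.cl k).length (cb + 2)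
    (fun i s => Bv i s ∧ s.reg rP = D.ad k + i) (by decide) ?_ ?_ hLen ?_ ?_).mono ?_
    fun s h => h.1
  · simpa [Prog.changes] using hch.2.2
  · simpa [Prog.changes] using hch.2.1
  · exact ⟨hsim _ _ _ ((State.Similar.refl s).setReg (by decide)) (by simp) h0, by simpa using hP⟩
  · rintro i hi s ⟨hB, hP⟩ hE -
    obtain ⟨C, τ, H, e⟩ := hEnv _ _ hB
    refine Ex.seq' (T₁ := 1) (T₂ := 1 + cb)
      (Ex.block rfl rfl le_rfl (Ex.seq' (T₁ := 1) (Ex.block rfl rfl le_rfl ?_) le_rfl)) (by omega)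
    simp only [Prog.eval]
    have hX : (s.setReg rP (s.reg rP + 1)).mem ((s.setReg rP (s.reg rP + 1)).reg rP +
        (s.setReg rP (s.reg rP + 1)).reg rZ) = (D.cl k).getD i 0 := by
      rw [← e.elt k hk i hi]
      simp [e.zero, hP, add_assoc]
    rw [hX]
    refine (Ex.frame (hbody i hi _ (hsim _ _ _ (((State.Similar.refl s).setReg (by decide)).setReg
      (by decide)) (by simp) hB) (by simp))).mono le_rfl ?_
    rintro s' ⟨h1, h2⟩
    refine ⟨hsim _ _ _ ((State.Similar.refl s').setReg (by decide)) (by simp) h1, ?_⟩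
    have := h2 rP hch.1
    simp at this ⊢
    omega
  · have : (D.cl k).length * (cb + 2 + 2) ≤ D.n * (cb + 2 + 2) := Nat.mul_le_mul_right _ hle
    simpa using this

/-- Two nested invariants: `A q` holds between clauses, and `Bv q i` holds inside clause `q` after
`i` elements. The map `π` allows the address table to be permuted. -/
theorem Ex.scan {D : Inst} {pre body post : Prog} {s : State} {O π : ℕ → ℕ} {K cp cb cq : ℕ}
    (A : ℕ → State → Prop) (Bv : ℕ → ℕ → State → Prop)
    (hch : ∀ p ∈ [pre, body, post], ∀ r ∈ [rP, rLen, rQ, rE, rL], p.changes r = false)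
    (hEnv : ∀ q s, A q s → ∃ C τ H, Env D s O C τ H)
    (hEnv' : ∀ q i s, Bv q i s → ∃ C τ H, Env D s O C τ H)
    (hsim : ∀ q s s', s.Similar s' → A q s → A q s')
    (hsim' : ∀ q i s s', s.Similar s' → Bv q i s → Bv q i s')
    (hKm : K ≤ D.m) (hO : ∀ q < K, π q < D.m ∧ O q = D.ad (π q)) (h0 : A 0 s)
    (hK : s.reg rL = K)
    (hpre : ∀ q < K, ∀ s, A q s → Ex pre s cp [] (Bv q 0))
    (hbody : ∀ q < K, ∀ i < (D.cl (π q)).length, ∀ s, Bv q i s → s.reg rQ = q →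
      s.reg rX = (D.cl (π q)).getD i 0 → Ex body s cb [] (Bv q (i + 1)))
    (hpost : ∀ q < K, ∀ s, Bv q (D.cl (π q)).length s → s.reg rQ = q →
      Ex post s cq [] (A (q + 1))) :
    Ex (.scan pre body post) s (K * (D.n * (cb + 4) + cp + cq + 6) + 2) [] (A K) := by
  simp only [List.mem_cons, List.not_mem_nil, or_false, forall_eq_or_imp, forall_eq] at hch
  obtain ⟨⟨p1, p2, p3, p4, p5⟩, ⟨b1, b2, b3, b4, b5⟩, ⟨q1, q2, q3, q4, q5⟩⟩ := hch
  refine (Ex.forTo K (D.n * (cb + 4) + cp + cq + 4) A (by decide) ?_ ?_ hK ?_ ?_).mono le_rfl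
    fun s h => h
  · simp [Prog.changes, Prog.scanClause, Prog.forTo, *]
  · simp [Prog.changes, Prog.scanClause, Prog.forTo, *]
  · exact hsim _ _ _ ((State.Similar.refl s).setReg (by decide)) h0
  · intro q hq s hA hQ hL
    obtain ⟨hπ, hOq⟩ := hO q hq
    obtain ⟨C, τ, H, e⟩ := hEnv _ _ hA
    refine Ex.seq' (T₁ := 1) (T₂ := 1 + (cp + ((D.n * (cb + 4) + 2) + cq)))
      (Ex.block rfl rfl le_rfl ?_) (by omega)
    refine Ex.seq' (T₁ := 1) (T₂ := (cp + ((D.n * (cb + 4) + 2) + cq)))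
      (Ex.block rfl rfl le_rfl ?_) (by omega)
    have e1 : s.mem (s.reg rO + s.reg rQ) = D.ad (π q) := by
      rw [e.baseO, hQ, e.memO q (by omega), hOq]
    have e2 : s.mem (D.ad (π q) + s.reg rZ) = (D.cl (π q)).length := by
      rw [e.zero, add_zero, e.len _ hπ]
    simp only [Prog.eval, e1, State.reg_setReg, State.mem_setReg, if_true, OfNat.zero_ne_ofNat,
      if_false, e2]
    refine Ex.seq' ((hpre q hq _ (hsim _ _ _ (((State.Similar.refl s).setReg (by decide)).setReg
      (by decide)) hA)).frame.mono le_rfl ?_) le_rfl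
    rintro s1 ⟨hB1, f1⟩
    refine Ex.seq' ((Ex.frame (Ex.scanClause (O := O) (cb := cb) hπ
      (fun i s => Bv q i s ∧ s.reg rQ = q) ⟨b1, b2, b4⟩ (fun i s h => hEnv' _ _ _ h.1) ?_ ?_ ?_ ?_
      ?_)).mono le_rfl ?_) le_rfl
    · rintro i s s' hs hQ' ⟨h1, h2⟩
      exact ⟨hsim' _ _ _ _ hs h1, hQ'.trans h2⟩
    · exact ⟨hB1, by rw [f1 _ p3]; simpa using hQ⟩
    · rw [f1 _ p1]; simp
    · rw [f1 _ p2]; simp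
    · rintro i hi s2 ⟨hB2, hQ2⟩ hX
      refine (hbody q hq i hi s2 hB2 hQ2 hX).frame.mono le_rfl fun s3 h => ⟨h.1, ?_⟩
      rw [h.2 _ b3, hQ2]
    · rintro s2 ⟨⟨hB2, hQ2⟩, -⟩
      refine (hpost q hq s2 hB2 hQ2).mono le_rfl fun s3 h => ?_
      exact hsim _ _ _ ((State.Similar.refl s3).setReg (by decide)) h

/-! ### Arranging the clauses by private variables -/

theorem Ex.clear {D : Inst} {s : State} {O C τ H : ℕ → ℕ} (h : Env D s O C τ H) :
    Ex .clear s (D.n * 3 + 2) [] fun s' => Env D s' O (fun _ => 0) τ H := by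
  refine (Ex.forTo D.n 1 (fun y s => Env D s O (fun x => if x < y then 0 else C x) τ H)
    (by decide) rfl rfl h.n ?_ ?_).mono le_rfl fun s h => h.congrC fun y hy => if_pos hy
  · simpa using h.setReg (by decide)
  · intro y hy s h hE hN
    refine Ex.block rfl rfl le_rfl ?_
    simp only [Prog.eval]
    refine ((h.storeC hy (by rw [h.baseC, hE])).setReg (by decide)).congrC fun x _ => ?_
    rw [Function.update_apply, h.zero]
    split_ifs <;> first | rfl | omega

/-- The number of occurrences of `x` in the clauses `c 0, …, c (q - 1)`. -/
def occurrences (c : ℕ → List ℕ) (q x : ℕ) : ℕ := ∑ r ∈ Finset.range q, (c r).count x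

theorem Ex.count {D : Inst} {s : State} {O τ H π : ℕ → ℕ} {K : ℕ}
    (h : Env D s O (fun _ => 0) τ H) (hKm : K ≤ D.m)
    (hO : ∀ q < K, π q < D.m ∧ O q = D.ad (π q)) (hK : s.reg rL = K) :
    Ex .count s (K * (D.n * 7 + 8) + 2) []
      fun s' => Env D s' O (occurrences (fun q => D.cl (π q)) K) τ H := by
  refine (Ex.scan (D := D) (cp := 1) (cb := 3) (cq := 1)
    (fun q s => Env D s O (occurrences (fun q => D.cl (π q)) q) τ H)
    (fun q i s => Env D s O (fun x => occurrences (fun q => D.cl (π q)) q x +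
      ((D.cl (π q)).take i).count x) τ H) (by decide) (fun _ _ h => ⟨_, _, _, h⟩)
    (fun _ _ _ h => ⟨_, _, _, h⟩) (fun _ _ _ hs h => h.similar hs)
    (fun _ _ _ _ hs h => h.similar hs) hKm hO ?_ hK ?_ ?_ ?_).mono (by simp) fun s h => h
  · exact h.congrC fun y _ => by simp [occurrences]
  · intro q hq s h
    refine Ex.block rfl rfl le_rfl ?_
    exact (h.setReg (by decide)).congrC fun y _ => by simp
  · intro q hq i hi s h hQ hX
    refine Ex.block rfl rfl le_rfl ?_
    have hx : s.reg rX < D.n := hX ▸ D.lt _ (hO q hq).1 _ (D.getD_mem hi)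
    have hm := h.memC _ hx
    rw [← h.baseC] at hm
    simp only [Prog.eval, State.reg_setReg]
    simp only [if_true, Nat.reduceEqDiff, if_false, hm]
    refine (((h.setReg (by decide)).setReg (by decide)).storeC hx (by rw [h.baseC])).congrC
      fun y hy => ?_
    rw [Function.update_apply, List.take_succ_eq_append_getElem hi, List.count_append,
      ← List.getD_eq_getElem _ 0 hi, ← hX, List.count_singleton]
    by_cases hy : y = s.reg rX
    · simp [hy, add_assoc]
    · simp [hy, Ne.symm hy]
  · intro q hq s h hQ
    refine Ex.block rfl rfl le_rfl ?_
    refine (h.setReg (by decide)).congrC fun y _ => ?_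
    simp [occurrences, Finset.sum_range_succ]

theorem Ex.find {D : Inst} {s : State} {O C τ H π : ℕ → ℕ} {K : ℕ}
    (h : Env D s O C τ H) (hKm : K ≤ D.m) (hK0 : 0 < K)
    (hO : ∀ q < K, π q < D.m ∧ O q = D.ad (π q)) (hK : s.reg rL = K)
    (hex : ∃ q < K, ∃ x ∈ D.cl (π q), C x < 2) :
    Ex .find s (K * (D.n * 8 + 8) + 3) []
      fun s' => Env D s' O C τ H ∧ s'.reg rF < K ∧ ∃ x ∈ D.cl (π (s'.reg rF)), C x < 2 := by
  refine Ex.seq' (T₁ := 1) (T₂ := K * (D.n * 8 + 8) + 2) (Ex.block rfl rfl le_rfl ?_) (by omega)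
  -- The initial index `0` is in range but may be a wrong choice. So the invariant is an
  -- implication: if a suitable clause has been seen, then the stored index is suitable.
  refine (Ex.scan (D := D) (cp := 1) (cb := 4) (cq := 1)
    (fun q s => Env D s O C τ H ∧ s.reg rF < K ∧
      ((∃ r < q, ∃ x ∈ D.cl (π r), C x < 2) → ∃ x ∈ D.cl (π (s.reg rF)), C x < 2))
    (fun q i s => Env D s O C τ H ∧ s.reg rF < K ∧
      ((∃ r < q, ∃ x ∈ D.cl (π r), C x < 2) ∨ (∃ x ∈ (D.cl (π q)).take i, C x < 2) →
        ∃ x ∈ D.cl (π (s.reg rF)), C x < 2))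
    (by decide) (fun _ _ h => ⟨_, _, _, h.1⟩)
    (fun _ _ _ h => ⟨_, _, _, h.1⟩) ?_ ?_ hKm hO ?_ ?_ ?_ ?_ ?_).mono (by simp) ?_
  · rintro q s s' hs ⟨h1, h2⟩
    refine ⟨h1.similar hs, ?_⟩
    rwa [hs.2 _ (by decide)]
  · rintro q i s s' hs ⟨h1, h2⟩
    refine ⟨h1.similar hs, ?_⟩
    rwa [hs.2 _ (by decide)]
  · exact ⟨h.setReg (by decide), by simpa [Prog.eval] using hK0, by simp⟩
  · simpa [Prog.eval] using hK
  · rintro q hq s ⟨h1, h2, h3⟩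
    refine Ex.block rfl rfl le_rfl ⟨h1.setReg (by decide), ?_⟩
    simp only [Prog.eval, Prog.nop, State.reg_setReg, Nat.reduceEqDiff, if_false]
    exact ⟨h2, by simpa using h3⟩
  · rintro q hq i hi s ⟨h1, h2, h3⟩ hQ hX
    refine Ex.block rfl rfl le_rfl ?_
    have hx : s.reg rX < D.n := hX ▸ D.lt _ (hO q hq).1 _ (D.getD_mem hi)
    have hm := h1.memC _ hx
    rw [← h1.baseC] at hm
    simp only [Prog.eval, Prog.nop, State.reg_setReg]
    simp only [if_true, Nat.reduceEqDiff, if_false, hm]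
    by_cases hc : C (s.reg rX) < 2
    · rw [if_pos hc]
      refine ⟨((h1.setReg (by decide)).setReg (by decide)).setReg (by decide), ?_, fun _ => ?_⟩
      · simpa [hQ] using hq
      · simp only [State.reg_setReg, Nat.reduceEqDiff, if_false, if_true, hQ]
        exact ⟨_, D.getD_mem hi, hX ▸ hc⟩
    · rw [if_neg hc]
      refine ⟨((h1.setReg (by decide)).setReg (by decide)).setReg (by decide), ?_, ?_⟩
      · simpa using h2
      · simp only [State.reg_setReg, Nat.reduceEqDiff, if_false]
        rintro (h | ⟨x, hx, hxc⟩)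
        · exact h3 (Or.inl h)
        · rw [List.take_succ_eq_append_getElem hi, List.mem_append, List.mem_singleton,
            ← List.getD_eq_getElem _ 0 hi, ← hX] at hx
          rcases hx with hx | rfl
          · exact h3 (Or.inr ⟨x, hx, hxc⟩)
          · exact absurd hxc hc
  · rintro q hq s ⟨h1, h2, h3⟩ hQ
    refine Ex.block rfl rfl le_rfl ⟨h1.setReg (by decide), ?_⟩
    simp only [Prog.eval, Prog.nop, State.reg_setReg, Nat.reduceEqDiff, if_false]
    refine ⟨h2, ?_⟩
    rintro ⟨r, hr, hx⟩
    rcases Nat.lt_succ_iff_lt_or_eq.1 hr with hr | rfl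
    · exact h3 (Or.inl ⟨r, hr, hx⟩)
    · exact h3 (Or.inr (by simpa using hx))
  · rintro s ⟨h1, h2, h3⟩
    exact ⟨h1, h2, h3 hex⟩

/-- Every nonempty family of clauses has a member with a variable of its own. -/
def Inst.HasPrivate (D : Inst) : Prop :=
  ∀ S : Finset ℕ, S.Nonempty → (∀ k ∈ S, k < D.m) →
    ∃ k ∈ S, ∃ x ∈ D.cl k, ∀ l ∈ S, x ∈ D.cl l → l = k

/-- Selection from the back: among the first `K` clauses one has a private variable, and it is
swapped to position `K - 1`. Later rounds only permute the positions before it, so its variable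
remains absent from all predecessors. -/
theorem Ex.arrange {D : Inst} (hD : D.HasPrivate) {s : State} {C τ H : ℕ → ℕ}
    (h : Env D s D.ad C τ H) :
    Ex .arrange s (D.m * (3 * D.n + D.m * (15 * D.n + 16) + 20) + 3) [] fun s' =>
      ∃ (π : Equiv.Perm ℕ) (C : ℕ → ℕ), (∀ k ≥ D.m, π k = k) ∧
        Env D s' (fun k => D.ad (π k)) C τ H ∧
        ∀ k < D.m, ∃ x ∈ D.cl (π k), ∀ q < k, x ∉ D.cl (π q) := by
  refine Ex.seq' (T₁ := 1) (Ex.block rfl rfl le_rfl ?_) (by rw [add_comm])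
  refine (Ex.forTo D.m (3 * D.n + D.m * (15 * D.n + 16) + 18) (fun i s => s.reg rL = D.m - i ∧
    ∃ (π : Equiv.Perm ℕ) (C : ℕ → ℕ), (∀ k ≥ D.m, π k = k) ∧
        Env D s (fun k => D.ad (π k)) C τ H ∧
        ∀ k < D.m, D.m - i ≤ k → ∃ x ∈ D.cl (π k), ∀ q < k, x ∉ D.cl (π q))
    (by decide) rfl rfl ?_ ?_ ?_).mono le_rfl ?_
  · simpa [Prog.eval] using h.m
  · refine ⟨by simp [Prog.eval, h.m], 1, C, by simp, (h.setReg (by decide)).setReg (by decide), ?_⟩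
    intro k hk hk'; omega
  · rintro i hi s ⟨hL, π, C, hπ, e, hp⟩ - hM
    have hm := Nat.mul_le_mul_right (15 * D.n + 16) (show D.m - i ≤ D.m by omega)
    set K := D.m - i with hKdef
    have hπlt : ∀ q < D.m, π q < D.m := by
      intro q hq
      by_contra hn
      have := π.injective (hπ (π q) (not_lt.1 hn))
      omega
    have hO : ∀ q < K, π q < D.m ∧ D.ad (π q) = D.ad (π q) :=
      fun q hq => ⟨hπlt q (by omega), rfl⟩
    refine Ex.seq' (T₁ := D.n * 3 + 2) (T₂ := (K * (D.n * 7 + 8) + 2) +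
      ((K * (D.n * 8 + 8) + 3) + 5)) ((Ex.clear e).frame.mono le_rfl ?_) (by
        have : K * (15 * D.n + 16) = K * (D.n * 7 + 8) + K * (D.n * 8 + 8) := by ring
        omega)
    rintro s1 ⟨e1, f1⟩
    have hL1 : s1.reg rL = K := by rw [f1 _ rfl, hL]
    refine Ex.seq' ((Ex.count e1 (by omega) hO hL1).frame.mono le_rfl ?_) le_rfl
    rintro s2 ⟨e2, f2⟩
    have hL2 : s2.reg rL = K := by rw [f2 _ rfl, hL1]
    -- A private variable of the family of the first `K` clauses occurs there once, since clauses
    -- have no repetitions. So its count is below `2`.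
    have hex : ∃ q < K, ∃ x ∈ D.cl (π q), occurrences (fun q => D.cl (π q)) K x < 2 := by
      obtain ⟨k, hk, x, hx, hu⟩ := hD ((Finset.range K).image π)
        ⟨π 0, Finset.mem_image_of_mem _ (Finset.mem_range.2 (by omega))⟩ (by
          simp only [Finset.mem_image, Finset.mem_range]
          rintro _ ⟨q, hq, rfl⟩
          exact hπlt q (by omega))
      simp only [Finset.mem_image, Finset.mem_range] at hk hu
      obtain ⟨q, hq, rfl⟩ := hk
      refine ⟨q, hq, x, hx, ?_⟩
      rw [occurrences, Finset.sum_eq_single q]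
      · have := List.nodup_iff_count_le_one.1 (D.nodup _ (hπlt q (by omega))) x
        omega
      · intro r hr hrq
        rw [List.count_eq_zero]
        intro hxr
        exact hrq (π.injective (hu _ ⟨r, Finset.mem_range.1 hr, rfl⟩ hxr))
      · intro hn; simp at hn; omega
    refine Ex.seq' ((Ex.find e2 (by omega) (by omega) hO hL2 hex).frame.mono le_rfl ?_) le_rfl
    rintro s3 ⟨⟨e3, hF, x, hx, hxc⟩, f3⟩
    have hL3 : s3.reg rL = K := by rw [f3 _ rfl, hL2]
    refine Ex.block rfl rfl le_rfl ?_
    generalize hf : s3.reg rF = f at *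
    have m1 : s3.mem (s3.reg rO + f) = D.ad (π f) := by
      rw [e3.baseO]; exact e3.memO f (by omega)
    have m2 : s3.mem (s3.reg rO + (K - 1)) = D.ad (π (K - 1)) := by
      rw [e3.baseO]; exact e3.memO (K - 1) (by omega)
    simp only [Prog.eval, State.reg_setReg, State.mem_setReg, State.reg_setMem]
    simp only [if_true, Nat.reduceEqDiff, if_false, hf, hL3, m1, m2]
    refine ⟨by omega, π * Equiv.swap f (K - 1), occurrences (fun q => D.cl (π q)) K, ?_, ?_, ?_⟩
    · intro k hk
      rw [Equiv.Perm.mul_apply, Equiv.swap_apply_of_ne_of_ne (by omega) (by omega), hπ k hk]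
    · have e4 := ((((((e3.setReg (r := rL) (v := K - 1) (by decide)).setReg (r := rV)
        (v := D.ad (π f)) (by decide)).setReg (r := rW) (v := D.ad (π (K - 1)))
        (by decide)).storeO (v := D.ad (π (K - 1))) (y := f) (by omega)
        (congrArg (· + f) e3.baseO)).storeO
        (v := D.ad (π f)) (y := K - 1) (by omega)
        (congrArg (· + (K - 1)) e3.baseO)).setReg (r := rK) (v := i + 1) (by decide))
      convert e4 using 1
      funext k
      simp only [Function.update_apply, Equiv.Perm.mul_apply, Equiv.swap_apply_def]
      split_ifs <;> simp_all
    · intro k hk hk'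
      by_cases hkK : k = K - 1
      · subst hkK
        refine ⟨x, by simpa using hx, fun q hq hxq => ?_⟩
        rw [Equiv.Perm.mul_apply] at hxq
        set q' := Equiv.swap f (K - 1) q with hq'
        have hq'K : q' < K := by
          rw [hq', Equiv.swap_apply_def]; split_ifs <;> omega
        have hne : q' ≠ f := by
          intro h
          have : q = K - 1 := by
            have := congrArg (Equiv.swap f (K - 1)) (hq'.symm.trans h)
            simpa using this
          omega
        -- A second clause `q' ≠ f` containing `x` would raise the count of `x` to at least `2`.
        have h2 : ∑ r ∈ {q', f}, (D.cl (π r)).count x ≤ occurrences (fun q => D.cl (π q)) K x := by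
          refine Finset.sum_le_sum_of_subset fun r hr => ?_
          simp only [Finset.mem_insert, Finset.mem_singleton] at hr
          rw [Finset.mem_range]
          omega
        rw [Finset.sum_pair hne] at h2
        have h3 := List.count_pos_iff.2 hxq
        have h4 := List.count_pos_iff.2 hx
        omega
      · obtain ⟨y, hy, hyq⟩ := hp k hk (by omega)
        refine ⟨y, ?_, fun q hq => ?_⟩
        · rw [Equiv.Perm.mul_apply, Equiv.swap_apply_of_ne_of_ne (by omega) (by omega)]
          exact hy
        · rw [Equiv.Perm.mul_apply]
          refine hyq _ ?_
          rw [Equiv.swap_apply_def]; split_ifs <;> omega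
  · rintro s ⟨-, π, C, hπ, e, hp⟩
    exact ⟨π, C, hπ, e, fun k hk => hp k hk (by omega)⟩

/-! ### The test for minimal transversals -/

/-- The multiplicity of `y` in `l` is positive only for the element `y` of `l`. -/
def IsSole (τ : ℕ → ℕ) (l : List ℕ) (y : ℕ) : Prop :=
  y ∈ l ∧ 0 < τ y ∧ ∀ x ∈ l, 0 < τ x → x = y

open Classical in
/-- The marks of the variables that are the only common element of the current multiset and one of
the first `q` clauses. -/
noncomputable def marks (c : ℕ → List ℕ) (τ : ℕ → ℕ) (q y : ℕ) : ℕ :=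
  if ∃ r < q, IsSole τ (c r) y then 1 else 0

/-- The condition that is tested by `Prog.check`. -/
def PassesCheck (c : ℕ → List ℕ) (τ : ℕ → ℕ) (n q : ℕ) : Prop :=
  (∀ r < q, ∃ x ∈ c r, 0 < τ x) ∧ ∀ y < n, τ y ≤ marks c τ q y

theorem marks_succ_of_not {c : ℕ → List ℕ} {τ : ℕ → ℕ} {q : ℕ} (h : ∀ y, ¬ IsSole τ (c q) y)
    (y : ℕ) : marks c τ q y = marks c τ (q + 1) y := by
  have : (∃ r < q, IsSole τ (c r) y) ↔ ∃ r < q + 1, IsSole τ (c r) y := by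
    constructor
    · rintro ⟨r, hr, h'⟩; exact ⟨r, by omega, h'⟩
    · rintro ⟨r, hr, h'⟩
      rcases Nat.lt_succ_iff_lt_or_eq.1 hr with hr | rfl
      · exact ⟨r, hr, h'⟩
      · exact absurd h' (h y)
  unfold marks
  classical exact if_congr this rfl rfl

theorem marks_succ_of_sole {c : ℕ → List ℕ} {τ : ℕ → ℕ} {q w : ℕ} (h : IsSole τ (c q) w)
    (y : ℕ) : Function.update (marks c τ q) w 1 y = marks c τ (q + 1) y := by
  rw [Function.update_apply]
  by_cases hy : y = w
  · subst hy
    rw [if_pos rfl, marks, if_pos ⟨q, by omega, h⟩]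
  · have : (∃ r < q, IsSole τ (c r) y) ↔ ∃ r < q + 1, IsSole τ (c r) y := by
      constructor
      · rintro ⟨r, hr, h'⟩; exact ⟨r, by omega, h'⟩
      · rintro ⟨r, hr, h'⟩
        rcases Nat.lt_succ_iff_lt_or_eq.1 hr with hr | rfl
        · exact ⟨r, hr, h'⟩
        · exact absurd (h.2.2 y h'.1 h'.2.1) hy
    rw [if_neg hy]
    unfold marks
    classical exact if_congr this rfl rfl

/-- The elements of `l` with positive multiplicity. -/
def support (τ : ℕ → ℕ) (l : List ℕ) : List ℕ := l.filter fun x => 0 < τ x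

theorem mem_support {τ : ℕ → ℕ} {l : List ℕ} {x : ℕ} : x ∈ support τ l ↔ x ∈ l ∧ 0 < τ x := by
  simp [support]

theorem isSole_of_length {τ : ℕ → ℕ} {l : List ℕ} {w : ℕ} (hw : w ∈ support τ l)
    (h : (support τ l).length < 2) : IsSole τ l w := by
  rw [mem_support] at hw
  refine ⟨hw.1, hw.2, fun x hx hxτ => ?_⟩
  have h1 := mem_support.2 hw
  have h2 := mem_support.2 ⟨hx, hxτ⟩
  match hs : support τ l, h with
  | [], _ => simp [hs] at h1
  | [a], _ => simp [hs] at h1 h2; omega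

theorem IsSole.length_support {τ : ℕ → ℕ} {l : List ℕ} {y : ℕ} (hl : l.Nodup)
    (h : IsSole τ l y) : (support τ l).length < 2 := by
  have h1 : (support τ l).Nodup := hl.filter _
  have h2 : (support τ l).toFinset ⊆ {y} := fun x hx => by
    rw [List.mem_toFinset, mem_support] at hx
    exact Finset.mem_singleton.2 (h.2.2 x hx.1 hx.2)
  have := Finset.card_le_card h2
  rw [List.toFinset_card_of_nodup h1, Finset.card_singleton] at this
  omega

theorem support_take_succ {τ : ℕ → ℕ} {l : List ℕ} {i : ℕ} (hi : i < l.length) :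
    support τ (l.take (i + 1)) =
      support τ (l.take i) ++ if 0 < τ (l.getD i 0) then [l.getD i 0] else [] := by
  rw [support, support, List.take_succ_eq_append_getElem hi, List.filter_append,
    ← List.getD_eq_getElem _ 0 hi, List.filter_singleton]
  simp

/-- For each clause the scan keeps the number of hits and the last hit, and a clause with exactly
one hit marks it. As clauses have no repetitions, a single hit is the same as `IsSole`. The last
loop compares the multiplicities with the marks. -/
theorem Ex.check {D : Inst} {s : State} {O C τ H π : ℕ → ℕ} {j : ℕ}
    (h : Env D s O C τ H) (hj : s.reg rJ = j) (hjm : j < D.m)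
    (hO : ∀ q < D.m, π q < D.m ∧ O q = D.ad (π q)) :
    Ex .check s ((j + 1) * (D.n * 8 + 12) + 9 * D.n + 9) [] fun s' =>
      (∃ C, Env D s' O C τ H) ∧
        (0 < s'.reg rOk ↔ PassesCheck (fun q => D.cl (π q)) τ D.n (j + 1)) := by
  set c : ℕ → List ℕ := fun q => D.cl (π q) with hc
  refine Ex.seq' (T₁ := D.n * 3 + 2) (T₂ := 3 + (((j + 1) * (D.n * 8 + 12) + 2) +
    (D.n * 6 + 2))) ((Ex.clear h).frame.mono le_rfl ?_) (by omega)
  rintro s1 ⟨e1, f1⟩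
  refine Ex.seq' (T₁ := 3) (Ex.block rfl rfl le_rfl ?_) le_rfl
  have hj1 : s1.reg rJ = j := by rw [f1 _ rfl, hj]
  refine Ex.seq' (T₁ := (j + 1) * (D.n * 8 + 12) + 2) ((Ex.scan (D := D) (O := O) (π := π)
    (K := j + 1) (cp := 1) (cb := 4) (cq := 5)
    (fun q s => Env D s O (marks c τ q) τ H ∧
      (0 < s.reg rOk ↔ ∀ r < q, ∃ x ∈ c r, 0 < τ x))
    (fun q i s => Env D s O (marks c τ q) τ H ∧
      (0 < s.reg rOk ↔ ∀ r < q, ∃ x ∈ c r, 0 < τ x) ∧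
      s.reg rCnt = (support τ ((c q).take i)).length ∧
      (0 < s.reg rCnt → s.reg rW ∈ support τ ((c q).take i)))
    (by decide) (fun _ _ h => ⟨_, _, _, h.1⟩)
    (fun _ _ _ h => ⟨_, _, _, h.1⟩) ?_ ?_ (by omega) (fun q hq => hO q (by omega)) ?_ ?_ ?_ ?_
    ?_).mono (by simp) ?_) le_rfl
  · rintro q s s' hs ⟨h1, h2⟩
    refine ⟨h1.similar hs, ?_⟩
    rwa [hs.2 _ (by decide)]
  · rintro q i s s' hs ⟨h1, h2⟩
    refine ⟨h1.similar hs, ?_⟩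
    rwa [hs.2 _ (by decide), hs.2 _ (by decide), hs.2 _ (by decide)]
  · refine ⟨Env.congrC (C := fun _ => 0) (((e1.setReg (by decide)).setReg (by decide)).setReg
      (by decide)) fun y _ => by simp [marks], ?_⟩
    simp [Prog.eval]
  · simp [Prog.eval, hj1]
  · rintro q hq s ⟨h1, h2⟩
    refine Ex.block rfl rfl le_rfl ⟨h1.setReg (by decide), ?_⟩
    simp only [Prog.eval, State.reg_setReg, Nat.reduceEqDiff, if_false, if_true]
    exact ⟨h2, by simp [support], by simp⟩
  · rintro q hq i hi s ⟨h1, h2, h3, h4⟩ hQ hX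
    refine Ex.block rfl rfl le_rfl ?_
    have hx : s.reg rX < D.n := hX ▸ D.lt _ (hO q (by omega)).1 _ (D.getD_mem hi)
    have hm := h1.memT _ hx
    rw [← h1.baseT] at hm
    have hi' : i < (c q).length := hi
    rw [show D.cl (π q) = c q from rfl] at hX
    rw [support_take_succ hi', ← hX]
    simp only [Prog.eval, Prog.nop, State.reg_setReg, if_true, Nat.reduceEqDiff, if_false, hm,
      OfNat.zero_ne_ofNat, h1.zero]
    by_cases hv : 0 < τ (s.reg rX)
    · simp only [if_pos hv]
      refine ⟨((h1.setReg (by decide)).setReg (by decide)).setReg (by decide), ?_⟩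
      simp only [State.reg_setReg, if_true, Nat.reduceEqDiff, if_false]
      exact ⟨h2, by simp [h3], by simp⟩
    · simp only [if_neg hv]
      refine ⟨(h1.setReg (by decide)).setReg (by decide), ?_⟩
      simp only [State.reg_setReg, Nat.reduceEqDiff, if_false]
      exact ⟨h2, by simp [h3], by simpa using h4⟩
  · rintro q hq s ⟨h1, h2, h3, h4⟩ hQ
    refine Ex.block rfl rfl le_rfl ?_
    rw [show D.cl (π q) = c q from rfl, List.take_length] at h3 h4
    have hnd : (c q).Nodup := D.nodup _ (hO q (by omega)).1
    simp only [Prog.eval, Prog.nop, State.reg_setReg, if_true, Nat.reduceEqDiff, if_false,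
      h1.zero]
    by_cases hcnt : 0 < s.reg rCnt
    · have hw := h4 hcnt
      have hhit : (∀ r < q + 1, ∃ x ∈ c r, 0 < τ x) ↔ ∀ r < q, ∃ x ∈ c r, 0 < τ x := by
        refine ⟨fun h r hr => h r (by omega), fun h r hr => ?_⟩
        rcases Nat.lt_succ_iff_lt_or_eq.1 hr with hr | rfl
        · exact h r hr
        · exact ⟨_, mem_support.1 hw⟩
      rw [if_pos hcnt, hhit]
      by_cases h1c : s.reg rCnt < 2
      · rw [if_pos h1c]
        have hsole := isSole_of_length hw (h3 ▸ h1c)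
        have hwn : s.reg rW < D.n := D.lt _ (hO q (by omega)).1 _ hsole.1
        refine ⟨(((h1.setReg (by decide)).setReg (by decide)).storeC hwn ?_).congrC
          fun y _ => marks_succ_of_sole hsole y, ?_⟩
        · simp [h1.baseC]
        · simpa using h2
      · rw [if_neg h1c]
        refine ⟨((h1.setReg (by decide)).setReg (by decide)).congrC
          fun y _ => marks_succ_of_not (fun y hy => ?_) y, by simpa using h2⟩
        have := hy.length_support hnd
        omega
    · rw [if_neg hcnt]
      have hno : ∀ x ∈ c q, ¬ 0 < τ x := fun x hx hxτ => by
        have := List.length_pos_of_mem (mem_support.2 ⟨hx, hxτ⟩)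
        omega
      refine ⟨(h1.setReg (by decide)).congrC
        fun y _ => marks_succ_of_not (fun y hy => hno y hy.1 hy.2.1) y, ?_⟩
      simp only [State.reg_setReg, if_true, lt_irrefl, false_iff]
      intro h
      obtain ⟨x, hx, hxτ⟩ := h q (by omega)
      exact hno x hx hxτ
  · rintro s2 ⟨h1, h2⟩
    refine (Ex.forTo D.n 4 (fun y s => Env D s O (marks c τ (j + 1)) τ H ∧
      (0 < s.reg rOk ↔ (∀ r < j + 1, ∃ x ∈ c r, 0 < τ x) ∧
        ∀ x < y, τ x ≤ marks c τ (j + 1) x)) (by decide) rfl rfl h1.n ?_ ?_).mono le_rfl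
        fun s h => ⟨⟨_, h.1⟩, h.2⟩
    · exact ⟨h1.setReg (by decide), by simpa using h2⟩
    · rintro y hy s ⟨h1, h2⟩ hE -
      refine Ex.block rfl rfl le_rfl ?_
      have m1 := h1.memT y hy
      have m2 := h1.memC y hy
      rw [← h1.baseT, ← hE] at m1
      rw [← h1.baseC, ← hE] at m2
      have hsucc : (∀ x < y + 1, τ x ≤ marks c τ (j + 1) x) ↔
          (∀ x < y, τ x ≤ marks c τ (j + 1) x) ∧ τ y ≤ marks c τ (j + 1) y :=
        Nat.forall_lt_succ_right
      rw [hsucc]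
      rw [hE] at m1 m2
      simp only [Prog.eval, Prog.nop, State.reg_setReg, State.mem_setReg, if_true,
        Nat.reduceEqDiff, if_false, hE, m1, m2]
      by_cases hv : marks c τ (j + 1) y < τ y
      · rw [if_pos hv]
        refine ⟨(((h1.setReg (by decide)).setReg (by decide)).setReg (by decide)).setReg
          (by decide), ?_⟩
        simp [not_le.2 hv]
      · rw [if_neg hv]
        refine ⟨(((h1.setReg (by decide)).setReg (by decide)).setReg (by decide)).setReg
          (by decide), ?_⟩
        simp [not_lt.1 hv, h2]

/-! ### Search steps -/

/-- The multiplicities of the elements of a set. -/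
def multiplicity (T : Finset ℕ) (y : ℕ) : ℕ := if y ∈ T then 1 else 0

/-- The multiplicities after the candidate `i` at the level `j` has been added to `T`. -/
def candidate (c : ℕ → List ℕ) (j : ℕ) (T : Finset ℕ) (i y : ℕ) : ℕ :=
  multiplicity T y + if i ≠ 0 ∧ y = (c j).getD (i - 1) 0 then 1 else 0

theorem candidate_pos {c : ℕ → List ℕ} {j : ℕ} {T : Finset ℕ} {i y : ℕ} :
    0 < candidate c j T i y ↔ y ∈ extend c j T i := by
  by_cases hi : i = 0
  · simp [candidate, extend, multiplicity, hi, Nat.pos_iff_ne_zero]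
  · simp only [candidate, multiplicity, extend, hi, if_false, Finset.mem_insert, ne_eq,
      not_false_eq_true, true_and]
    split_ifs <;> simp_all

theorem Admissible.candidate_eq {c : ℕ → List ℕ} {j : ℕ} {T : Finset ℕ} {i : ℕ}
    (h : Admissible c j T i) (y : ℕ) :
    candidate c j T i y = multiplicity (extend c j T i) y := by
  by_cases hi : i = 0
  · simp [candidate, extend, hi]
  · have := h.1 hi
    simp only [candidate, multiplicity, extend, hi, if_false, Finset.mem_insert, ne_eq,
      not_false_eq_true, true_and]
    split_ifs <;> simp_all

/-- Marks are at most `1`, while an element added twice has multiplicity `2`. So the single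
inequality between multiplicities and marks tests both minimality and absence of duplication. -/
theorem passesCheck_candidate {c : ℕ → List ℕ} {j n : ℕ} {T : Finset ℕ} {i : ℕ}
    (hn : ∀ y ∈ extend c j T i, y < n) :
    PassesCheck c (candidate c j T i) n (j + 1) ↔ Admissible c j T i := by
  have hsole : ∀ l y, IsSole (candidate c j T i) l y ↔
      y ∈ extend c j T i ∧ y ∈ l ∧ ∀ x ∈ l, x ∈ extend c j T i → x = y := by
    intro l y
    simp only [IsSole, candidate_pos]
    tauto
  simp only [PassesCheck, candidate_pos, Admissible, MinTrans]
  constructor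
  · rintro ⟨h1, h2⟩
    have h3 : ∀ y, candidate c j T i y ≤ 1 := by
      intro y
      by_cases hy : y < n
      · refine (h2 y hy).trans ?_
        rw [marks]; split_ifs <;> omega
      · have : ¬ 0 < candidate c j T i y := fun h => hy (hn y (candidate_pos.1 h))
        omega
    refine ⟨fun hi hz => ?_, h1, fun y hy => ?_⟩
    · have := h3 ((c j).getD (i - 1) 0)
      rw [candidate, multiplicity, if_pos hz, if_pos ⟨hi, rfl⟩] at this
      omega
    · have h4 := (candidate_pos.2 hy).trans_le (h2 y (hn y hy))
      rw [marks] at h4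
      split_ifs at h4 with h5
      · obtain ⟨r, hr, h6⟩ := h5
        exact ⟨r, hr, ((hsole _ _).1 h6).2⟩
      · omega
  · rintro ⟨h1, h2, h3⟩
    refine ⟨h2, fun y hy => ?_⟩
    by_cases hyT : y ∈ extend c j T i
    · obtain ⟨r, hr, h4⟩ := h3 y hyT
      rw [marks, if_pos ⟨r, hr, (hsole _ _).2 ⟨hyT, h4⟩⟩,
        Admissible.candidate_eq ⟨h1, h2, h3⟩, multiplicity, if_pos hyT]
    · have := (not_congr candidate_pos).2 hyT
      omega

/-- The machine is at the level `j` of the search, the current set is `T`, the next candidate is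
`i`, and the candidates that have been used at the levels below `j` are given by `h`. -/
def AtNode (D : Inst) (π : ℕ → ℕ) (j : ℕ) (T : Finset ℕ) (i : ℕ) (h : ℕ → ℕ) (s : State) : Prop :=
  (∃ C H, Env D s (fun k => D.ad (π k)) C (multiplicity T) H ∧ ∀ k < j, H k = h k) ∧
    s.reg rJ = j ∧ s.reg rI = i ∧ s.reg rGo = 1

section Steps

variable {D : Inst} {s : State} {C H π h : ℕ → ℕ} {j i : ℕ} {T : Finset ℕ}

theorem Ex.add (e : Env D s (fun k => D.ad (π k)) C (multiplicity T) H) (hj : s.reg rJ = j)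
    (hi : s.reg rI = i) (hjm : j < D.m) (hπ : π j < D.m) (hil : i ≤ (D.cl (π j)).length) :
    Ex .add s 6 [] fun s' =>
      Env D s' (fun k => D.ad (π k)) C (candidate (fun q => D.cl (π q)) j T i) H := by
  refine Ex.block rfl rfl le_rfl ?_
  simp only [Prog.add, Prog.eval, e.zero, hi]
  by_cases h0 : i = 0
  · rw [if_neg (by omega)]
    exact (e.setReg (by decide)).congrT fun y _ => by simp [candidate, h0]
  · rw [if_pos (by omega)]
    have m1 := e.memO j hjm
    rw [← e.baseO] at m1
    -- The cell at the clause address holds the length, so candidate `i` is found exactly at offset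
    -- `i`.
    have m2 := e.elt _ hπ (i - 1) (by omega)
    rw [Nat.sub_add_cancel (by omega)] at m2
    set x := (D.cl (π j)).getD (i - 1) 0 with hx
    have hxn : x < D.n := D.lt _ hπ _ (D.getD_mem (by omega))
    have m3 := e.memT x hxn
    rw [← e.baseT] at m3
    simp only [State.reg_setReg, State.mem_setReg, if_true, Nat.reduceEqDiff, if_false, hj, hi,
      m1, m2, m3]
    refine (((((e.setReg (by decide)).setReg (by decide)).setReg (by decide)).setReg
      (by decide)).storeT hxn (by rw [e.baseT])).congrT fun y _ => ?_
    rw [Function.update_apply, candidate, ← hx]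
    split_ifs <;> simp_all

theorem Ex.undo (e : Env D s (fun k => D.ad (π k)) C (candidate (fun q => D.cl (π q)) j T i) H)
    (hj : s.reg rJ = j) (hi : s.reg rI = i) (hjm : j < D.m) (hπ : π j < D.m)
    (hil : i ≤ (D.cl (π j)).length) :
    Ex .undo s 7 [] fun s' =>
      Env D s' (fun k => D.ad (π k)) C (multiplicity T) H ∧ s'.reg rI = i + 1 := by
  refine Ex.block rfl rfl le_rfl ?_
  simp only [Prog.undo, Prog.eval, e.zero, hi]
  by_cases h0 : i = 0
  · rw [if_neg (by omega)]
    exact ⟨((e.setReg (by decide)).setReg (by decide)).congrT fun y _ => by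
      simp [candidate, h0], by simp [Prog.nop, Prog.eval, hi]⟩
  · rw [if_pos (by omega)]
    have m1 := e.memO j hjm
    rw [← e.baseO] at m1
    have m2 := e.elt _ hπ (i - 1) (by omega)
    rw [Nat.sub_add_cancel (by omega)] at m2
    set x := (D.cl (π j)).getD (i - 1) 0 with hx
    have hxn : x < D.n := D.lt _ hπ _ (D.getD_mem (by omega))
    have m3 := e.memT x hxn
    rw [← e.baseT] at m3
    simp only [State.reg_setReg, State.mem_setReg, State.reg_setMem, if_true, Nat.reduceEqDiff,
      if_false, hj, hi, m1, m2, m3]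
    refine ⟨((((((e.setReg (by decide)).setReg (by decide)).setReg (by decide)).setReg
      (by decide)).storeT hxn (by rw [e.baseT])).setReg (by decide)).congrT fun y _ => ?_, trivial⟩
    rw [Function.update_apply, candidate, candidate, ← hx]
    split_ifs <;> simp_all

/-- A time bound for one step of the search. -/
def Inst.stepTime (D : Inst) : ℕ := 64 * D.n ^ 2

theorem Inst.checkTime_le (D : Inst) (hjm : j < D.m) :
    (j + 1) * (D.n * 8 + 12) + 9 * D.n + 9 + 26 ≤ D.stepTime := by
  have h1 := D.pos
  have h2 : j + 1 ≤ D.n := by have := D.m_le; omega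
  rw [Inst.stepTime]
  -- With `j + 1 ≤ n` the left side is at most `8n² + 21n + 35`, and `8 + 21 + 35 = 64`.
  nlinarith [Nat.mul_le_mul_right (D.n * 8 + 12) h2]

theorem Ex.body_read (hs : AtNode D π j T i h s) (hπ : ∀ q < D.m, π q < D.m) :
    Ex (.ite rJ rM (.load rP rO rJ ;; .load rLen rP rZ) (.set rLen 0)) s 3 [] fun s' =>
      AtNode D π j T i h s' ∧ s'.reg rLen = if j < D.m then (D.cl (π j)).length else 0 := by
  obtain ⟨⟨C, H, e, hH⟩, h1, h2, h3⟩ := hs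
  refine Ex.block rfl rfl le_rfl ?_
  simp only [Prog.eval, h1, e.m]
  by_cases hj : j < D.m
  · have m1 := e.memO j hj
    rw [← e.baseO] at m1
    have m2 := e.len _ (hπ j hj)
    simp only [if_pos hj, State.reg_setReg, State.mem_setReg, if_true, OfNat.zero_ne_ofNat,
      if_false, m1, e.zero, add_zero, m2]
    exact ⟨⟨⟨C, H, (e.setReg (by decide)).setReg (by decide), hH⟩, by simpa, by simpa, by simpa⟩,
      trivial⟩
  · simp only [if_neg hj]
    exact ⟨⟨⟨C, H, e.setReg (by decide), hH⟩, by simpa, by simpa, by simpa⟩, by simp⟩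

theorem Ex.body_attempt (hs : AtNode D π j T i h s) (hπ : ∀ q < D.m, π q < D.m) (hjm : j < D.m)
    (hT : MinTrans (fun q => D.cl (π q)) j T) (hil : i ≤ (D.cl (π j)).length) :
    Ex .body s D.stepTime [] fun s' =>
      (Admissible (fun q => D.cl (π q)) j T i →
        AtNode D π (j + 1) (extend (fun q => D.cl (π q)) j T i) 0 (Function.update h j i) s') ∧
      (¬ Admissible (fun q => D.cl (π q)) j T i → AtNode D π j T (i + 1) h s') := by
  have hn : ∀ y ∈ extend (fun q => D.cl (π q)) j T i, y < D.n := by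
    intro y hy
    have hyT : y ∈ T → y < D.n := fun hyT => by
      obtain ⟨q, hq, hyq, -⟩ := hT.2 y hyT
      exact D.lt _ (hπ q (by omega)) y hyq
    rw [extend] at hy
    split_ifs at hy with h0
    · exact hyT hy
    · rcases Finset.mem_insert.1 hy with rfl | hy
      · exact D.lt _ (hπ j hjm) _ (D.getD_mem (by omega))
      · exact hyT hy
  refine Ex.seq' (T₁ := 3) (T₂ := (6 + ((j + 1) * (D.n * 8 + 12) + 9 * D.n + 9 + 8)) + 1 + 1)
    ((Ex.body_read hs hπ).mono le_rfl ?_) (by have := D.checkTime_le hjm; omega)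
  rintro s1 ⟨⟨⟨C, H, e, hH⟩, h1, h2, h3⟩, h4⟩
  rw [if_pos hjm] at h4
  refine Ex.ite (fun hlt => absurd hlt (by rw [h2, h4]; omega)) fun _ => ?_
  refine Ex.ite (fun _ => ?_) fun hlt => absurd hjm (by rw [h1, e.m] at hlt; exact hlt)
  refine Ex.seq' ((Ex.add e h1 h2 hjm (hπ j hjm) hil).frame.mono le_rfl ?_) le_rfl
  rintro s2 ⟨e2, f2⟩
  have hj2 : s2.reg rJ = j := by rw [f2 _ rfl, h1]
  have hi2 : s2.reg rI = i := by rw [f2 _ rfl, h2]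
  have hg2 : s2.reg rGo = 1 := by rw [f2 _ rfl, h3]
  refine Ex.seq' ((Ex.check (π := π) e2 hj2 hjm fun q hq => ⟨hπ q hq, rfl⟩).frame.mono le_rfl ?_)
    le_rfl
  rintro s3 ⟨⟨⟨C', e3⟩, hok⟩, f3⟩
  have hj3 : s3.reg rJ = j := by rw [f3 _ rfl, hj2]
  have hi3 : s3.reg rI = i := by rw [f3 _ rfl, hi2]
  have hg3 : s3.reg rGo = 1 := by rw [f3 _ rfl, hg2]
  rw [passesCheck_candidate hn] at hok
  refine Ex.ite (fun hlt => ?_) fun hlt => ?_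
  · rw [e3.zero, hok] at hlt
    refine Ex.block rfl rfl (by decide) ⟨fun _ => ?_, fun h => absurd hlt h⟩
    simp only [Prog.eval]
    have e4 := e3.congrT fun y _ => hlt.candidate_eq y
    refine ⟨⟨C', _, ((e4.storeH hjm ?_).setReg (by decide)).setReg (by decide), ?_⟩, ?_, ?_, ?_⟩
    · rw [e3.baseH, hj3]
    · intro k hk
      rw [Function.update_apply, Function.update_apply, hi3]
      by_cases hkj : k = j
      · simp [hkj]
      · rw [if_neg hkj, if_neg hkj, hH k (by omega)]
    · simpa using hj3
    · simp
    · simpa using hg3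
  · rw [e3.zero, hok] at hlt
    refine (Ex.undo e3 hj3 hi3 hjm (hπ j hjm) hil).frame.mono le_rfl ?_
    rintro s4 ⟨⟨e4, hi4⟩, f4⟩
    exact ⟨fun h => absurd h hlt, fun _ => ⟨⟨C', H, e4, hH⟩, by rw [f4 _ rfl, hj3], hi4, by
      rw [f4 _ rfl, hg3]⟩⟩

/-- A level is exhausted when the candidate number is one past the last. Leaves fit this pattern
with length `0`: after the output the number is `1`. -/
theorem Ex.body_back (hs : AtNode D π (j + 1) (extend (fun q => D.cl (π q)) j T i)
      ((if j + 1 < D.m then (D.cl (π (j + 1))).length else 0) + 1) (Function.update h j i) s)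
    (hπ : ∀ q < D.m, π q < D.m) (hjm : j < D.m)
    (ha : Admissible (fun q => D.cl (π q)) j T i) (hil : i ≤ (D.cl (π j)).length) :
    Ex .body s D.stepTime [] (AtNode D π j T (i + 1) h) := by
  refine Ex.seq' (T₁ := 3) (T₂ := (2 + 7) + 1 + 1)
    ((Ex.body_read hs hπ).mono le_rfl ?_) (by have := D.checkTime_le hjm; omega)
  rintro s1 ⟨⟨⟨C, H, e, hH⟩, h1, h2, h3⟩, h4⟩
  refine Ex.ite (fun _ => ?_) fun hlt => absurd hlt (by rw [h2, h4]; omega)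
  refine Ex.ite (fun _ => ?_) fun hlt => absurd hlt (by rw [h1, e.zero]; omega)
  refine Ex.seq' (T₁ := 1) (T₂ := 1 + 7) (Ex.block rfl rfl le_rfl ?_) le_rfl
  refine Ex.seq' (T₁ := 1) (Ex.block rfl rfl le_rfl ?_) le_rfl
  have m1 := e.memH j hjm
  rw [← e.baseH, hH j (by omega), Function.update_self] at m1
  simp only [Prog.eval, State.reg_setReg, State.mem_setReg, if_true, Nat.reduceEqDiff, if_false,
    h1, Nat.add_sub_cancel, m1]
  refine (Ex.undo (j := j) (i := i) (T := T) (((e.setReg (by decide)).setReg (by decide)).congrT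
    fun y _ => (ha.candidate_eq y).symm) (by simp) (by simp) hjm (hπ j hjm) hil).frame.mono
    le_rfl ?_
  rintro s4 ⟨⟨e4, hi4⟩, f4⟩
  refine ⟨⟨C, H, e4, fun k hk => ?_⟩, by rw [f4 _ rfl]; simp, hi4, by
    rw [f4 _ rfl]; simpa using h3⟩
  rw [hH k (by omega), Function.update_of_ne (by omega)]

theorem Ex.body_stop (hs : AtNode D π 0 T
      ((if 0 < D.m then (D.cl (π 0)).length else 0) + 1) h s)
    (hπ : ∀ q < D.m, π q < D.m) :
    Ex .body s D.stepTime [] fun s' => ¬ s'.reg rZ < s'.reg rGo := by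
  refine Ex.seq' (T₁ := 3) (T₂ := 1 + 1 + 1)
    ((Ex.body_read hs hπ).mono le_rfl ?_) (by
      have := Nat.pow_le_pow_left D.pos 2
      rw [Inst.stepTime]; omega)
  rintro s1 ⟨⟨⟨C, H, e, hH⟩, h1, h2, h3⟩, h4⟩
  refine Ex.ite (fun _ => ?_) fun hlt => absurd hlt (by rw [h2, h4]; omega)
  refine Ex.ite (fun hlt => absurd hlt (by rw [h1, e.zero]; omega)) fun _ => ?_
  refine Ex.block rfl rfl le_rfl ?_
  simp [Prog.eval]

theorem ExItem.body_emit (hs : AtNode D π D.m T 0 h s) (hπ : ∀ q < D.m, π q < D.m) :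
    ExItem .body s D.stepTime ((List.range D.n).filter (· ∈ T)) (AtNode D π D.m T 1 h) := by
  have key : ExItem .body s (3 + (D.n * 5 + 2 + 1 + 1 + 1)) ((List.range D.n).filter (· ∈ T))
      (AtNode D π D.m T 1 h) := by
    refine ExItem.seq_left ((Ex.body_read hs hπ).mono le_rfl ?_)
    rintro s1 ⟨⟨⟨C, H, e, hH⟩, h1, h2, h3⟩, h4⟩
    refine ExItem.ite (fun hlt => absurd hlt (by rw [h2]; omega)) fun _ => ?_
    refine ExItem.ite (fun hlt => absurd hlt (by rw [h1, e.m]; omega)) fun _ => ?_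
    refine ExItem.intro ?_
    have hw : (List.range D.n).filter (· ∈ T) =
        (List.range D.n).flatMap fun y => if y ∈ T then [y] else [] := by
      induction List.range D.n with
      | nil => rfl
      | cons a l ih => by_cases ha : a ∈ T <;> simp [ha, ih]
    rw [hw]
    refine (Ex.frame (Ex.forTo_output (K := D.n) (c := 3) _
      (fun _ s => Env D s (fun k => D.ad (π k)) C (multiplicity T) H) (by decide) rfl rfl e.n
      (e.setReg (by decide)) ?_)).mono le_rfl ?_
    · intro y hy s e hE hN
      have m1 := e.memT y hy
      rw [← e.baseT] at m1
      have hb := Ex.block_output (p := .load rV rT rE ;; .ite rZ rV (.write rE) .nop) rfl s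
      have ho : Prog.output (.load rV rT rE ;; .ite rZ rV (.write rE) .nop) s =
          if y ∈ T then [y] else [] := by
        simp only [Prog.output, Prog.eval, Prog.nop, State.reg_setReg, if_true, Nat.reduceEqDiff,
          OfNat.zero_ne_ofNat, if_false, hE, m1, e.zero, multiplicity]
        by_cases hy : y ∈ T <;> simp [hy]
      rw [ho] at hb
      refine hb.mono (by decide) ?_
      rintro s' rfl
      simp only [Prog.eval, Prog.nop]
      split_ifs
      · exact (e.setReg (by decide)).setReg (by decide)
      · exact ((e.setReg (by decide)).setReg (by decide)).setReg (by decide)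
    · rintro s2 ⟨e2, f2⟩
      refine Ex.block rfl rfl (by simp [Prog.cost]) ⟨⟨C, H, e2.setReg (by decide), hH⟩, ?_, ?_, ?_⟩
      · simpa [Prog.eval, f2 rJ rfl] using h1
      · simpa [Prog.eval, f2 rI rfl] using h2
      · simpa [Prog.eval, f2 rGo rfl] using h3
  obtain ⟨u, v, s', k1, k2, k3, k4, k5, k6, k7, k8⟩ := key
  have : 3 + (D.n * 5 + 2 + 1 + 1 + 1) ≤ D.stepTime := by
    have := D.pos
    rw [Inst.stepTime]; nlinarith
  exact ⟨u, v, s', k1, k2, k3, k4, k5, by omega, by omega, k8⟩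

end Steps

/-! ### The search -/

/-- A time bound for the search from the level `j` to the first leaf, or from the last leaf back to
the level `j`, where `r` levels are left and a step takes time `K`. -/
def descentTime (c : ℕ → List ℕ) (K : ℕ) : ℕ → ℕ → ℕ
  | 0, _ => K
  | r + 1, j => K * ((c j).length + 1) + descentTime c K r (j + 1)

/-- The list of the elements of `T` below `n`. -/
def elements (n : ℕ) (T : Finset ℕ) : List ℕ := (List.range n).filter (· ∈ T)

/-- The number of elements that can be tried at a level; it is zero at the leaves. -/
def Inst.candidates (D : Inst) (π : ℕ → ℕ) (j : ℕ) : ℕ :=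
  if j < D.m then (D.cl (π j)).length else 0

theorem AtNode.go {D : Inst} {π : ℕ → ℕ} {j i : ℕ} {T : Finset ℕ} {h : ℕ → ℕ} {s : State}
    (hs : AtNode D π j T i h s) : s.reg rZ < s.reg rGo := by
  obtain ⟨⟨C, H, e, hH⟩, h1, h2, h3⟩ := hs
  rw [e.zero, h3]; decide

/-- The proof is in continuation style: `ws` and `G` describe what the loop does once the subtree is
exhausted. The bound `hG` covers the gap from the last leaf of the subtree to the next item or halt,
and `hL` covers gaps inside the subtree, where one climb and one descent occur. -/
theorem AtNode.outputs {D : Inst} {π : ℕ → ℕ} (hπ : ∀ q < D.m, π q < D.m)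
    (hp : ∀ k < D.m, ∃ x ∈ D.cl (π k), ∀ q < k, x ∉ D.cl (π q)) {L K : ℕ}
    (hK : K = D.stepTime + 1) (r j : ℕ) (T : Finset ℕ) (h : ℕ → ℕ) (G : ℕ)
    (ws : List (List ℕ)) (hj : j + r = D.m) (hT : MinTrans (fun q => D.cl (π q)) j T)
    (hend : ∀ s, AtNode D π j T (D.candidates π j + 1) h s →
      LoopOutputs rZ rGo .body L G s ws)
    (hG : G + descentTime (fun q => D.cl (π q)) K r j ≤ L)
    (hL : 2 * descentTime (fun q => D.cl (π q)) K r j ≤ L) (s : State)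
    (hs : AtNode D π j T 0 h s) :
    LoopOutputs rZ rGo .body L (descentTime (fun q => D.cl (π q)) K r j) s
      ((leaves (fun q => D.cl (π q)) r j T).map (elements D.n) ++ ws) := by
  induction r generalizing j T h G ws s with
  | zero =>
    obtain rfl : j = D.m := by omega
    simp only [descentTime] at hG hL ⊢
    obtain ⟨u, v, s', k1, k2, k3, k4, k5, k6, k7, k8⟩ := ExItem.body_emit hs hπ
    refine LoopOutputs.item hs.go ⟨u, v, s', k1, k2, k3, k4, k5, k6, k7, hend s' ?_⟩
      (F := G) (by omega) (by omega)
    simpa [Inst.candidates] using k8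
  | succ r ih =>
    set c : ℕ → List ℕ := fun q => D.cl (π q) with hc
    have hjm : j < D.m := by omega
    have hcand : D.candidates π j = (c j).length := if_pos hjm
    rw [hcand] at hend
    simp only [descentTime] at hG hL ⊢
    set W := descentTime c K r (j + 1) with hW
    -- With `x` candidates left, either no child remains and the continuation follows after the
    -- failures, or a child is reached and a first leaf below it within `W`.
    have key : ∀ x i, i + x = (c j).length + 1 → ∀ s, AtNode D π j T i h s →
        LoopOutputs rZ rGo .body L
          (if childrenFrom c j T i x = [] then K * x + G else K * x + W) s
          (((childrenFrom c j T i x).flatMap (leaves c r (j + 1))).map (elements D.n) ++ ws) := by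
      intro x
      induction x with
      | zero =>
        intro i hi s hs
        have hnil : childrenFrom c j T i 0 = [] := by simp [childrenFrom]
        rw [hnil, if_pos rfl, mul_zero, zero_add]
        obtain rfl : i = (c j).length + 1 := hi
        exact hend s hs
      | succ x ihx =>
        intro i hi s hs
        have hKx : K * (x + 1) ≤ K * ((c j).length + 1) := Nat.mul_le_mul_left _ (by omega)
        rw [Nat.mul_succ] at hKx
        rw [Nat.mul_succ]
        have hil : i ≤ (D.cl (π j)).length := by change i ≤ (c j).length; omega
        have hatt := Ex.body_attempt hs hπ hjm hT hil
        by_cases ha : Admissible c j T i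
        · rw [(childrenFrom_succ c j T i x).1 ha, if_neg (List.cons_ne_nil _ _),
            List.flatMap_cons, List.map_append, List.append_assoc]
          refine LoopOutputs.step hs.go (hatt.mono le_rfl fun s' hs' => ?_) (F := W) (by omega)
          -- The continuation of the child's subtree is the step back to this level followed by the
          -- remaining candidates, hence the extra `K`.
          refine ih (j + 1) _ (Function.update h j i)
            (K + if childrenFrom c j T (i + 1) x = [] then K * x + G else K * x + W) _ (by omega)
            ha.2 ?_ ?_ ?_ _ (hs'.1 ha)
          · intro s2 hs2
            exact LoopOutputs.step hs2.go ((Ex.body_back hs2 hπ hjm ha hil).mono le_rfl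
              fun s3 hs3 => ihx (i + 1) (by omega) s3 hs3) (by omega)
          · split_ifs <;> omega
          · omega
        · rw [(childrenFrom_succ c j T i x).2 ha]
          refine LoopOutputs.step hs.go (hatt.mono le_rfl fun s' hs' =>
            ihx (i + 1) (by omega) s' (hs'.2 ha)) ?_
          split_ifs <;> omega
    have := key ((c j).length + 1) 0 (by omega) s hs
    rwa [if_neg (childrenFrom_ne_nil (hp j hjm) hT)] at this

theorem descentTime_eq (c : ℕ → List ℕ) (K r j : ℕ) :
    descentTime c K r j = K * (∑ q ∈ Finset.range r, ((c (j + q)).length + 1) + 1) := by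
  induction r generalizing j with
  | zero => simp [descentTime]
  | succ r ih =>
    rw [descentTime, ih, Finset.sum_range_succ']
    simp only [add_zero, show ∀ q, j + 1 + q = j + (q + 1) from fun q => by ring]
    ring

theorem Inst.loop_outputs {D : Inst} {π : ℕ → ℕ} (hπ : ∀ q < D.m, π q < D.m)
    (hp : ∀ k < D.m, ∃ x ∈ D.cl (π k), ∀ q < k, x ∉ D.cl (π q)) {h : ℕ → ℕ} {s : State}
    (hs : AtNode D π 0 ∅ 0 h s) {F L : ℕ}
    (hF : descentTime (fun q => D.cl (π q)) (D.stepTime + 1) D.m 0 = F) (hL : 3 * F ≤ L) :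
    LoopOutputs rZ rGo .body L F s
      ((leaves (fun q => D.cl (π q)) D.m 0 ∅).map (elements D.n)) := by
  have hKF : D.stepTime + 1 ≤ F := by
    rw [← hF, descentTime_eq]
    exact Nat.le_mul_of_pos_right _ (by omega)
  -- After the whole tree there remain one loop test, the stopping step and the failing last test:
  -- `stepTime + 2`.
  have := AtNode.outputs hπ hp (L := L) rfl D.m 0 ∅ h (D.stepTime + 2) []
    (by omega) ⟨by simp, by simp⟩ (fun s hs => ?_) (by omega) (by omega) s hs
  · simpa [hF] using this
  · refine LoopOutputs.step hs.go ((Ex.body_stop hs hπ).mono le_rfl fun s' hs' => ?_) (F := 1)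
      (by omega)
    exact ⟨_, _, .loopFalse hs', by simp, rfl, by simp⟩

/-! ### The initial phases -/

theorem Ex.addTo {r l i : ℕ} {s : State} (hri : r ≠ i) (hrl : r ≠ l) (hil : l ≠ i) :
    Ex (.forTo i l (.inc r)) s (s.reg l * 3 + 2) [] fun s' =>
      s'.reg r = s.reg r + s.reg l ∧ s'.mem = s.mem := by
  refine (Ex.forTo (s.reg l) 1 (fun k s' => s'.reg r = s.reg r + k ∧ s'.mem = s.mem) hil
    (by simpa [Prog.changes] using hri) (by simpa [Prog.changes] using hrl) rfl ?_ ?_).mono le_rfl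
    fun s h => h
  · simp [hri]
  · rintro k hk s' ⟨h1, h2⟩ - -
    refine Ex.block rfl rfl le_rfl ?_
    simp [Prog.eval, hri, h1, h2, add_assoc]

theorem Ex.bases {D : Inst} {s : State} (hz : s.reg rZ = 0) (hn : s.reg rN = D.n)
    (hm : s.reg rM = D.m) (hlen : ∀ k < D.m, s.mem (D.ad k) = (D.cl k).length)
    (helt : ∀ k < D.m, ∀ i < (D.cl k).length, s.mem (D.ad k + (i + 1)) = (D.cl k).getD i 0)
    (h0 : ∀ a ≥ D.B, s.mem a = 0) :
    Ex .bases s (D.m * (D.n * 3 + 4) + 9 * D.n + 20) [] fun s' =>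
      Env D s' (fun _ => 0) (fun _ => 0) (multiplicity ∅) (fun _ => 0) := by
  refine Ex.seq' (T₁ := 3) (T₂ := (D.m * (D.n * 3 + 4) + 2) + (1 + ((D.n * 3 + 2) + (1 +
    ((D.n * 3 + 2) + (1 + (D.n * 3 + 2))))))) (Ex.block rfl rfl le_rfl ?_) (by omega)
  -- The product `m * n` is computed by nested increments, as the machine has no addition or
  -- multiplication of registers.
  refine Ex.seq' (Ex.frame (Ex.forTo D.m (D.n * 3 + 2)
    (fun k s' => s'.reg rO = D.m + 2 + k * D.n ∧ s'.mem = s.mem ∧ s'.reg rN = D.n) (by decide)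
    rfl rfl ?_ ?_ ?_) |>.mono le_rfl ?_) le_rfl
  · simp [Prog.eval, hm]
  · simp [Prog.eval, hm, hn]
  · rintro k hk s' ⟨h1, h2, h3⟩ - -
    refine (Ex.addTo (by decide) (by decide) (by decide)).frame.mono (by rw [h3]) ?_
    rintro s2 ⟨⟨k1, k2⟩, f2⟩
    refine ⟨?_, ?_, ?_⟩
    · simp [k1, h1, h3]; ring
    · simp [k2, h2]
    · simp [f2 rN rfl, h3]
  rintro s1 ⟨⟨o1, m1, n1⟩, f1⟩
  rw [← D.B_eq] at o1
  have z1 : s1.reg rZ = 0 := by rw [f1 _ rfl]; simpa [Prog.eval] using hz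
  have mm1 : s1.reg rM = D.m := by rw [f1 _ rfl]; simpa [Prog.eval] using hm
  refine Ex.seq' (T₁ := 1) (Ex.block rfl rfl le_rfl ?_) le_rfl
  refine Ex.seq' ((Ex.addTo (by decide) (by decide) (by decide)).frame.mono
    (by simp [Prog.eval, n1]) ?_) le_rfl
  rintro s2 ⟨⟨c2, m2⟩, f2⟩
  refine Ex.seq' (T₁ := 1) (Ex.block rfl rfl le_rfl ?_) le_rfl
  have n2 : s2.reg rN = D.n := by rw [f2 _ rfl]; simpa [Prog.eval] using n1
  refine Ex.seq' ((Ex.addTo (by decide) (by decide) (by decide)).frame.mono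
    (by simp [Prog.eval, n2]) ?_) le_rfl
  rintro s3 ⟨⟨c3, m3⟩, f3⟩
  refine Ex.seq' (T₁ := 1) (Ex.block rfl rfl le_rfl ?_) le_rfl
  have n3 : s3.reg rN = D.n := by rw [f3 _ rfl]; simpa [Prog.eval] using n2
  refine (Ex.addTo (by decide) (by decide) (by decide)).frame.mono
    (by simp [Prog.eval, n3]) ?_
  rintro s4 ⟨⟨c4, m4⟩, f4⟩
  have hmem : s4.mem = s.mem := by
    rw [m4, ← m1]; simp only [Prog.eval, State.mem_setReg]
    rw [m3]; simp only [Prog.eval, State.mem_setReg]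
    rw [m2]; simp [Prog.eval]
  simp only [Prog.eval, State.reg_setReg, if_true, if_false,
    OfNat.one_ne_ofNat, o1, n1, n2, n3] at c2 c3 c4 f2 f3 f4
  constructor
  · simp [f4 rZ rfl, f3 rZ rfl, f2 rZ rfl, z1]
  · simp [f4 rN rfl, n3]
  · simp [f4 rM rfl, f3 rM rfl, f2 rM rfl, mm1]
  · simp [f4 rO rfl, f3 rO rfl, f2 rO rfl, o1]
  · simp [f4 rC rfl, f3 rC rfl, c2]
  · simp [f4 rT rfl, c3, c2]
  · simp [c4, c3, c2]
  · rwa [hmem]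
  · rwa [hmem]
  all_goals
    intro k hk
    rw [hmem]
    exact (h0 _ (by omega)).trans (by simp [multiplicity])

theorem Ex.parse {D : Inst} {s : State} {C τ H : ℕ → ℕ}
    (e : Env D s (fun _ => 0) C τ H) :
    Ex .parse s (D.m * (D.n * 3 + 7) + 3) [] fun s' => Env D s' D.ad C τ H := by
  refine Ex.seq' (T₁ := 1) (T₂ := D.m * (D.n * 3 + 7) + 2) (Ex.block rfl rfl le_rfl ?_) (by omega)
  refine (Ex.forTo D.m (D.n * 3 + 5) (fun k s => s.reg rP = D.ad k ∧
    Env D s (fun q => if q < k then D.ad q else 0) C τ H) (by decide) rfl rfl ?_ ?_ ?_).mono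
    le_rfl ?_
  · simpa [Prog.eval] using e.m
  · refine ⟨by simp [Prog.eval, D.ad_zero], ?_⟩
    simpa [Prog.eval] using (e.setReg (r := rP) (v := 2) (by decide)).setReg (r := rQ) (v := 0) (by decide)
  · rintro k hk s1 ⟨hP, e1⟩ hQ -
    refine Ex.seq' (T₁ := 3) (T₂ := D.n * 3 + 2) (Ex.block rfl rfl le_rfl ?_) (by omega)
    have e2 := e1.storeO (v := D.ad k) hk (congrArg (· + k) e1.baseO)
    have m2 := e2.len k hk
    simp only [Prog.eval, State.reg_setReg, State.reg_setMem, hP, hQ, e1.zero,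
      add_zero, m2]
    have hle := D.length_le hk
    refine (Ex.frame (Ex.addTo (by decide) (by decide) (by decide))).mono ?_ ?_
    · simp only [State.reg_setReg, if_true, Nat.reduceEqDiff, if_false]; omega
    rintro s3 ⟨⟨p3, m3⟩, f3⟩
    refine ⟨?_, ?_⟩
    · have := D.ad_succ k hk
      simp at p3 ⊢
      omega
    · refine Env.congr (s := s1.setMem (s1.reg rO + k) (D.ad k)) ?_ (fun r hr => ?_) ?_
      · convert e2 using 1
        funext q
        rw [Function.update_apply]
        split_ifs <;> first | omega | (subst_vars; rfl)
      · rw [State.reg_setReg, if_neg (by omega), f3 r (by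
          simp [Prog.forTo, Prog.changes]; omega)]
        simp only [State.reg_setReg, State.reg_setMem]
        rw [if_neg (by omega), if_neg (by omega)]
      · simpa using m3
  · rintro s1 ⟨-, e1⟩
    constructor
    all_goals first
      | exact e1.zero | exact e1.n | exact e1.m | exact e1.baseO | exact e1.baseC | exact e1.baseT
      | exact e1.baseH | exact e1.len | exact e1.elt | exact e1.memC | exact e1.memT
      | exact e1.memH | skip
    intro k hk
    rw [e1.memO k hk, if_pos hk]

theorem Inst.HasPrivate.length_pos {D : Inst} (hD : D.HasPrivate) {k : ℕ} (hk : k < D.m) :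
    1 ≤ (D.cl k).length := by
  obtain ⟨l, hl, x, hx, -⟩ := hD {k} ⟨k, by simp⟩ (by simpa using hk)
  rw [Finset.mem_singleton] at hl
  exact hl ▸ List.length_pos_of_mem hx

theorem Prog.main_outputs {D : Inst} (hD : D.HasPrivate) {s : State} (hz : s.reg rZ = 0)
    (hn : s.reg rN = D.n) (hm : s.reg rM = D.m)
    (hlen : ∀ k < D.m, s.mem (D.ad k) = (D.cl k).length)
    (helt : ∀ k < D.m, ∀ i < (D.cl k).length, s.mem (D.ad k + (i + 1)) = (D.cl k).getD i 0)
    (h0 : ∀ a ≥ D.B, s.mem a = 0) (hm0 : 0 < D.m) {ℓ : ℕ}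
    (hℓ : ∑ k ∈ Finset.range D.m, (D.cl k).length = ℓ) {L : ℕ} (hL : 900 * (ℓ * D.n ^ 2) ≤ L) :
    ∃ (π : Equiv.Perm ℕ) (u : List Event) (s' : State), (∀ k ≥ D.m, π k = k) ∧
      Runs .main s u s' ∧ OutputsFrom L (900 * (ℓ * D.n ^ 2)) u
        ((leaves (fun q => D.cl (π q)) D.m 0 ∅).map (elements D.n)) := by
  obtain ⟨u1, s1, r1, i1, w1, l1, e1⟩ := Ex.bases hz hn hm hlen helt h0
  obtain ⟨u2, s2, r2, i2, w2, l2, e2⟩ := Ex.parse e1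
  obtain ⟨u3, s3, r3, i3, w3, l3, π, C, hπ, e3, hp⟩ := Ex.arrange hD e2
  obtain ⟨u4, s4, r4, i4, w4, l4, e4⟩ : Ex (.set rJ 0 ;; .set rI 0 ;; .set rGo 1) s3 3 []
      (AtNode D π 0 ∅ 0 (fun _ => 0)) :=
    Ex.block rfl rfl le_rfl ⟨⟨C, _, ((e3.setReg (by decide)).setReg (by decide)).setReg
      (by decide), by simp⟩, by simp [Prog.eval], by simp [Prog.eval], by simp [Prog.eval]⟩
  have hπlt : ∀ q < D.m, π q < D.m := by
    intro q hq
    by_contra hn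
    have := π.injective (hπ (π q) (not_lt.1 hn))
    omega
  have hsum : ∑ q ∈ Finset.range D.m, (D.cl (π q)).length = ℓ := by
    rw [← hℓ]
    refine Finset.sum_nbij π (fun q hq => ?_) π.injective.injOn (fun q hq => ?_) fun _ _ => rfl
    · exact Finset.mem_range.2 (hπlt q (Finset.mem_range.1 hq))
    · refine ⟨π.symm q, ?_, by simp⟩
      simp only [Finset.coe_range, Set.mem_Iio] at hq ⊢
      by_contra hn
      have := hπ _ (not_lt.1 hn)
      rw [Equiv.apply_symm_apply] at this
      omega
  have hmℓ : D.m ≤ ℓ := by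
    rw [← hℓ]
    calc D.m = ∑ _k ∈ Finset.range D.m, 1 := by simp
      _ ≤ _ := Finset.sum_le_sum fun k hk => hD.length_pos (Finset.mem_range.1 hk)
  have hn1 := D.pos
  have hmn := D.m_le
  have hT : descentTime (fun q => D.cl (π q)) (D.stepTime + 1) D.m 0 =
      (64 * D.n ^ 2 + 1) * (ℓ + D.m + 1) := by
    rw [descentTime_eq]
    simp only [zero_add, Finset.sum_add_distrib, hsum, Finset.sum_const, Finset.card_range,
      smul_eq_mul, mul_one, Inst.stepTime]
  have hX : 1 ≤ D.n ^ 2 := Nat.one_le_pow _ _ hn1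
  -- Here `64n² + 1 ≤ 65n²`, and `ℓ + m + 1 ≤ 3ℓ` because the clauses are nonempty; `195 = 65 * 3`.
  have hF : (64 * D.n ^ 2 + 1) * (ℓ + D.m + 1) ≤ 195 * (ℓ * D.n ^ 2) := by
    calc (64 * D.n ^ 2 + 1) * (ℓ + D.m + 1) ≤ (65 * D.n ^ 2) * (3 * ℓ) :=
          Nat.mul_le_mul (by omega) (by omega)
      _ = _ := by ring
  have hmX : D.m * D.n ≤ ℓ * D.n ^ 2 := Nat.mul_le_mul hmℓ (Nat.le_self_pow (by decide) _)
  have hmm : D.m * (D.m * D.n) ≤ ℓ * D.n ^ 2 :=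
    Nat.mul_le_mul hmℓ (by rw [sq]; exact Nat.mul_le_mul_right _ hmn)
  have hmm' : D.m * D.m ≤ ℓ * D.n ^ 2 :=
    Nat.mul_le_mul hmℓ (hmn.trans (Nat.le_self_pow (by decide) _))
  have hmm2 : D.m ≤ ℓ * D.n ^ 2 := hmℓ.trans (Nat.le_mul_of_pos_right _ hX)
  have hnn : D.n ≤ ℓ * D.n ^ 2 :=
    (Nat.le_self_pow (by decide) _).trans (Nat.le_mul_of_pos_left _ (by omega))
  -- Every monomial in the bounds for the initial phases, the largest being `m²n`, is at most `ℓ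
  -- n²`. The constant `900` also leaves room for the `3 * 195` required by `Inst.loop_outputs`.
  have hbound : u1.length + (u2.length + (u3.length + u4.length)) + 195 * (ℓ * D.n ^ 2) ≤
      900 * (ℓ * D.n ^ 2) := by
    ring_nf at l1 l2 l3 hmX hmm hmm' hmm2 hnn ⊢
    omega
  obtain ⟨u5, s5, r5, o5⟩ := Inst.loop_outputs hπlt hp e4 hT (L := L) (by omega)
  refine ⟨π, _, s5, hπ, r1.seq (r2.seq (r3.seq (r4.seq r5))), ?_⟩
  have := o5.append (v := u1 ++ (u2 ++ (u3 ++ u4))) (F' := 900 * (ℓ * D.n ^ 2))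
    (by simp [i1, i2, i3, i4]) (by simp [written_append, w1, w2, w3, w4])
    (by simp only [List.length_append]; omega)
  simpa using this

/-! ### The input -/

/-- The variables of the clause number `k` of the input. -/
def clauseVars {n : ℕ} (I : List (List (Fin n))) (k : ℕ) : List ℕ :=
  (I.getD k []).map Fin.val

/-- The address of the clause number `k` of the input. -/
def clauseAddr {n : ℕ} (I : List (List (Fin n))) (k : ℕ) : ℕ :=
  2 + ∑ q ∈ Finset.range k, ((clauseVars I q).length + 1)

theorem mem_clauseVars {n : ℕ} {I : List (List (Fin n))} {k : ℕ} {x : Fin n} :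
    (x : ℕ) ∈ clauseVars I k ↔ x ∈ I.getD k [] := by
  simp only [clauseVars, List.mem_map]
  constructor
  · rintro ⟨y, hy, h⟩; rwa [← Fin.ext h]
  · intro h; exact ⟨x, h, rfl⟩

theorem lt_of_mem_clauseVars {n : ℕ} {I : List (List (Fin n))} {k x : ℕ}
    (h : x ∈ clauseVars I k) : x < n := by
  obtain ⟨y, -, rfl⟩ := List.mem_map.1 h
  exact y.2

theorem getD_flatMap_encode {n : ℕ} (I : List (List (Fin n))) (k i : ℕ) (hk : k < I.length)
    (hi : i ≤ (clauseVars I k).length) :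
    (I.flatMap fun c => c.length :: c.map Fin.val).getD
      (∑ q ∈ Finset.range k, ((clauseVars I q).length + 1) + i) 0 =
    ((clauseVars I k).length :: clauseVars I k).getD i 0 := by
  induction I generalizing k with
  | nil => simp at hk
  | cons c I ih =>
    rw [List.flatMap_cons]
    cases k with
    | zero =>
      have : clauseVars (c :: I) 0 = c.map Fin.val := by simp [clauseVars]
      rw [this] at hi ⊢
      rw [Finset.range_zero, Finset.sum_empty, zero_add, List.getD_append _ _ _ _ (by simpa [Nat.lt_succ_iff] using hi), List.length_map]
    | succ k =>
      have hs : ∀ q, clauseVars (c :: I) (q + 1) = clauseVars I q := by simp [clauseVars]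
      have h0 : (clauseVars (c :: I) 0).length = c.length := by simp [clauseVars]
      rw [hs] at hi ⊢
      rw [Finset.sum_range_succ', h0, List.getD_append_right _ _ _ _ (by simp; omega)]
      simp only [hs]
      rw [← ih k (by simpa using hk) hi]
      congr 1
      simp only [List.length_cons, List.length_map]
      omega

theorem length_flatMap_encode {n : ℕ} (I : List (List (Fin n))) :
    (I.flatMap fun c => c.length :: c.map Fin.val).length =
      ∑ q ∈ Finset.range I.length, ((clauseVars I q).length + 1) := by
  induction I with
  | nil => simp
  | cons c I ih =>
    have hs : ∀ q, clauseVars (c :: I) (q + 1) = clauseVars I q := by simp [clauseVars]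
    rw [List.flatMap_cons, List.length_append, ih, List.length_cons,
      List.length_cons, Finset.sum_range_succ']
    simp only [hs]
    simp [clauseVars, add_comm]

theorem map_coe_eq {n : ℕ} (l : List (Fin n)) : (l.map fun x => (x : ℕ)) = l.map Fin.val := by
  induction l with
  | nil => rfl
  | cons a l ih => exact congrArg (List.cons (a : ℕ)) ih

theorem encode_eq {n : ℕ} (I : List (List (Fin n))) :
    encode I = n :: I.length :: I.flatMap fun c => c.length :: c.map Fin.val := by
  simp only [encode, map_coe_eq]

theorem encode_clauseAddr {n : ℕ} (I : List (List (Fin n))) (k i : ℕ) (hk : k < I.length)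
    (hi : i ≤ (clauseVars I k).length) :
    (encode I).getD (clauseAddr I k + i) 0 =
      ((clauseVars I k).length :: clauseVars I k).getD i 0 := by
  rw [← getD_flatMap_encode I k i hk hi, encode_eq, clauseAddr, add_assoc, add_comm 2,
    List.getD_cons_succ, List.getD_cons_succ]

theorem length_clauseVars_le {n : ℕ} {I : List (List (Fin n))} (h : ∀ c ∈ I, c.Nodup) (k : ℕ) :
    (clauseVars I k).Nodup ∧ (clauseVars I k).length ≤ n := by
  have : (I.getD k []).Nodup := by
    by_cases hk : k < I.length
    · rw [List.getD_eq_getElem _ _ hk]; exact h _ (List.getElem_mem _)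
    · rw [List.getD_eq_default _ _ (not_lt.1 hk)]; exact List.nodup_nil
  refine ⟨this.map Fin.val_injective, ?_⟩
  rw [clauseVars, List.length_map]
  simpa using this.length_le_card

/-- Each clause takes at most `n + 1` cells after the two header cells, so the working arrays lie
beyond the input. -/
theorem clauseAddr_le {n : ℕ} {I : List (List (Fin n))} (h : ∀ c ∈ I, c.Nodup) (k : ℕ)
    (hk : k ≤ I.length) : clauseAddr I k ≤ I.length + 2 + I.length * n := by
  have h1 : ∑ q ∈ Finset.range k, ((clauseVars I q).length + 1) ≤ k * (n + 1) := by
    rw [← smul_eq_mul]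
    simpa using Finset.sum_le_card_nsmul (Finset.range k) _ (n + 1) fun q _ =>
      Nat.succ_le_succ (length_clauseVars_le h q).2
  have h2 := Nat.mul_le_mul_right (n + 1) hk
  rw [clauseAddr]
  rw [Nat.mul_succ I.length] at h2
  omega

/-- The input as an instance for the program. -/
def listInst {n : ℕ} (I : List (List (Fin n))) (h : ∀ c ∈ I, c.Nodup) (h0 : 1 ≤ n)
    (hle : I.length ≤ n) : Inst where
  n := n
  m := I.length
  B := I.length + 2 + I.length * n
  cl := clauseVars I
  ad := clauseAddr I
  pos := h0
  m_le := hle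
  B_eq := rfl
  lt _ _ _ := lt_of_mem_clauseVars
  nodup k _ := (length_clauseVars_le h k).1
  ad_zero := by simp [clauseAddr]
  ad_succ k _ := by rw [clauseAddr, clauseAddr, Finset.sum_range_succ]; ring
  ad_lt k hk := by
    have := clauseAddr_le h (k + 1) hk
    rw [clauseAddr, Finset.sum_range_succ] at this
    rw [clauseAddr]
    omega

theorem IsListing.mem_iff {n : ℕ} {I : List (List (Fin n))} {φ : CNF n} (h : IsListing I φ)
    {d : Finset (Fin n)} : d ∈ φ ↔ ∃ k < I.length, (I.getD k []).toFinset = d := by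
  rw [← h.2.2, List.mem_toFinset, List.mem_map]
  constructor
  · rintro ⟨c, hc, rfl⟩
    obtain ⟨k, hk, rfl⟩ := List.getElem_of_mem hc
    exact ⟨k, hk, by rw [List.getD_eq_getElem _ _ hk]⟩
  · rintro ⟨k, hk, rfl⟩
    exact ⟨_, List.getElem_mem hk, by rw [List.getD_eq_getElem _ _ hk]⟩

theorem IsListing.injective {n : ℕ} {I : List (List (Fin n))} {φ : CNF n} (h : IsListing I φ)
    {k l : ℕ} (hk : k < I.length) (hl : l < I.length)
    (he : (I.getD k []).toFinset = (I.getD l []).toFinset) : k = l := by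
  rw [List.getD_eq_getElem _ _ hk, List.getD_eq_getElem _ _ hl] at he
  have := h.2.1.getElem_inj_iff (i := k) (j := l) (hi := by simpa) (hj := by simpa)
  rw [List.getElem_map, List.getElem_map] at this
  exact this.1 he

theorem IsListing.card_eq {n : ℕ} {I : List (List (Fin n))} {φ : CNF n} (h : IsListing I φ) :
    I.length = φ.card := by
  rw [← h.2.2, List.toFinset_card_of_nodup h.2.1, List.length_map]

theorem IsListing.length_eq {n : ℕ} {I : List (List (Fin n))} {φ : CNF n} (h : IsListing I φ) :
    ∑ k ∈ Finset.range I.length, (clauseVars I k).length = φ.length := by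
  rw [CNF.length]
  refine Finset.sum_bij (fun k _ => (I.getD k []).toFinset) (fun k hk => ?_) (fun k hk l hl he =>
    ?_) (fun d hd => ?_) fun k hk => ?_
  · exact h.mem_iff.2 ⟨k, Finset.mem_range.1 hk, rfl⟩
  · exact h.injective (Finset.mem_range.1 hk) (Finset.mem_range.1 hl) he
  · obtain ⟨k, hk, rfl⟩ := h.mem_iff.1 hd
    exact ⟨k, Finset.mem_range.2 hk, rfl⟩
  · rw [Finset.mem_range] at hk
    rw [clauseVars, List.length_map, List.toFinset_card_of_nodup]
    rw [List.getD_eq_getElem _ _ hk]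
    exact h.1 _ (List.getElem_mem _)

theorem IsListing.hasPrivate {n : ℕ} {I : List (List (Fin n))} {φ : CNF n} (h : IsListing I φ)
    (hd : φ.IsDegenerate 1) (hne : ∀ c ∈ φ, c.Nonempty) (h0 : 1 ≤ n) (hle : I.length ≤ n) :
    (listInst I h.1 h0 hle).HasPrivate := by
  intro S hS hlt
  change ∀ k ∈ S, k < I.length at hlt
  change ∃ k ∈ S, ∃ x ∈ clauseVars I k, ∀ l ∈ S, x ∈ clauseVars I l → l = k
  have hsub : S.image (fun k => (I.getD k []).toFinset) ⊆ φ := by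
    intro d hd
    obtain ⟨k, hk, rfl⟩ := Finset.mem_image.1 hd
    exact h.mem_iff.2 ⟨k, hlt k hk, rfl⟩
  obtain ⟨c, hc, x, hx, hu⟩ := hd.exists_private hsub (hS.image _) fun c hc => hne c (hsub hc)
  obtain ⟨k, hk, rfl⟩ := Finset.mem_image.1 hc
  refine ⟨k, hk, x, mem_clauseVars.2 (List.mem_toFinset.1 hx), fun l hl hxl => ?_⟩
  exact h.injective (hlt l hl) (hlt k hk) (hu _ (Finset.mem_image_of_mem _ hl)
    (List.mem_toFinset.2 (mem_clauseVars.1 hxl)))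

/-! ### The output -/

theorem CNF.isMinTransversal_iff {n : ℕ} {φ : CNF n} {s : Finset (Fin n)} :
    φ.IsMinTransversal s ↔ φ.IsTransversal s ∧
      ∀ y ∈ s, ∃ c ∈ φ, y ∈ c ∧ ∀ x ∈ c, x ∈ s → x = y := by
  refine and_congr_right fun hs => ⟨fun h y hy => ?_, fun h s' hs' ht => ?_⟩
  · by_contra hn
    push Not at hn
    have := h (s.erase y) (Finset.erase_subset _ _) fun c hc => by
      by_cases hyc : y ∈ c
      · obtain ⟨x, hx, hxs, hxy⟩ := hn c hc hyc
        exact ⟨x, hx, Finset.mem_erase.2 ⟨hxy, hxs⟩⟩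
      · obtain ⟨x, hx, hxs⟩ := hs c hc
        exact ⟨x, hx, Finset.mem_erase.2 ⟨fun he => hyc (he ▸ hx), hxs⟩⟩
    exact Finset.notMem_erase y s (this.symm ▸ hy)
  · refine Finset.Subset.antisymm hs' fun y hy => ?_
    obtain ⟨c, hc, hyc, hu⟩ := h y hy
    obtain ⟨x, hx, hxs⟩ := ht c hc
    exact hu x hx (hs' hxs) ▸ hxs

/-- The elements of `T` below `n`, as elements of `Fin n`. -/
def toFin (n : ℕ) (T : Finset ℕ) : Finset (Fin n) := Finset.univ.filter fun x => (x : ℕ) ∈ T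

theorem mem_toFin {n : ℕ} {T : Finset ℕ} {x : Fin n} : x ∈ toFin n T ↔ (x : ℕ) ∈ T := by
  simp [toFin]

theorem represents_elements (n : ℕ) (T : Finset ℕ) :
    Represents (elements n T) (positive (toFin n T)) := by
  refine ⟨(List.finRange n).filter fun x => (x : ℕ) ∈ T, (List.nodup_finRange n).filter _, ?_, ?_⟩
  · rw [map_coe_eq, elements, ← List.map_coe_finRange_eq_range, List.filter_map]
    rfl
  · congr 1
    ext x
    simp [mem_toFin]

section Output

variable {n : ℕ} {I : List (List (Fin n))} {φ : CNF n} {π : Equiv.Perm ℕ}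

theorem IsListing.mem_iff_perm (h : IsListing I φ) (hπ : ∀ k ≥ I.length, π k = k)
    {d : Finset (Fin n)} : d ∈ φ ↔ ∃ k < I.length, (I.getD (π k) []).toFinset = d := by
  have hiff : ∀ k, π k < I.length ↔ k < I.length := by
    intro k
    constructor
    · intro hk
      by_contra hn
      rw [hπ k (not_lt.1 hn)] at hk
      exact hn hk
    · intro hk
      by_contra hn
      have := π.injective (hπ (π k) (not_lt.1 hn))
      omega
  rw [h.mem_iff]
  constructor
  · rintro ⟨k, hk, rfl⟩
    exact ⟨π.symm k, by rw [← hiff]; simpa using hk, by simp⟩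
  · rintro ⟨k, hk, rfl⟩
    exact ⟨π k, (hiff k).2 hk, rfl⟩

theorem MinTrans.lt {k : ℕ} {T : Finset ℕ} (h : MinTrans (fun q => clauseVars I (π q)) k T) :
    ∀ y ∈ T, y < n := by
  intro y hy
  obtain ⟨q, -, hq, -⟩ := h.2 y hy
  exact lt_of_mem_clauseVars hq

theorem IsListing.minTrans_iff (h : IsListing I φ) (hπ : ∀ k ≥ I.length, π k = k)
    {T : Finset ℕ} (hT : ∀ y ∈ T, y < n) :
    MinTrans (fun q => clauseVars I (π q)) I.length T ↔ φ.IsMinTransversal (toFin n T) := by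
  rw [CNF.isMinTransversal_iff]
  refine and_congr ?_ ?_
  · constructor
    · intro h' c hc
      obtain ⟨k, hk, rfl⟩ := (h.mem_iff_perm hπ).1 hc
      obtain ⟨x, hx, hxT⟩ := h' k hk
      exact ⟨⟨x, hT x hxT⟩, List.mem_toFinset.2 (mem_clauseVars.1 hx), mem_toFin.2 hxT⟩
    · intro h' k hk
      obtain ⟨x, hx, hxT⟩ := h' _ ((h.mem_iff_perm hπ).2 ⟨k, hk, rfl⟩)
      exact ⟨x, mem_clauseVars.2 (List.mem_toFinset.1 hx), mem_toFin.1 hxT⟩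
  · constructor
    · intro h' y hy
      obtain ⟨k, hk, hyk, hu⟩ := h' y (mem_toFin.1 hy)
      refine ⟨_, (h.mem_iff_perm hπ).2 ⟨k, hk, rfl⟩, List.mem_toFinset.2 (mem_clauseVars.1 hyk),
        fun x hx hxT => Fin.ext (hu x (mem_clauseVars.2 (List.mem_toFinset.1 hx))
          (mem_toFin.1 hxT))⟩
    · intro h' y hy
      obtain ⟨c, hc, hyc, hu⟩ := h' ⟨y, hT y hy⟩ (mem_toFin.2 hy)
      obtain ⟨k, hk, rfl⟩ := (h.mem_iff_perm hπ).1 hc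
      refine ⟨k, hk, mem_clauseVars.2 (List.mem_toFinset.1 hyc), fun x hx hxT => ?_⟩
      have := hu ⟨x, hT x hxT⟩ (List.mem_toFinset.2 (mem_clauseVars.1 hx)) (mem_toFin.2 hxT)
      exact congrArg Fin.val this

theorem IsListing.output_spec (h : IsListing I φ) (hπ : ∀ k ≥ I.length, π k = k)
    {L : List (Finset ℕ)} (hL : L.Nodup)
    (hmem : ∀ T, T ∈ L ↔ MinTrans (fun q => clauseVars I (π q)) I.length T) :
    List.Forall₂ Represents (L.map (elements n)) (L.map fun T => positive (toFin n T)) ∧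
      (L.map fun T => positive (toFin n T)).Nodup ∧
      ∀ t, t ∈ (L.map fun T => positive (toFin n T)) ↔ IsPrimeImplicant φ.fn t := by
  refine ⟨?_, ?_, fun t => ?_⟩
  · rw [List.forall₂_map_left_iff, List.forall₂_map_right_iff, List.forall₂_same]
    exact fun T _ => represents_elements n T
  · refine hL.map_on fun T hT T' hT' he => ?_
    have he' := positive_injective he
    have h1 := ((hmem T).1 hT).lt
    have h2 := ((hmem T').1 hT').lt
    ext y
    by_cases hy : y < n
    · have := congrArg (fun s => (⟨y, hy⟩ : Fin n) ∈ s) he'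
      simpa [mem_toFin] using this
    · exact ⟨fun h => absurd (h1 y h) hy, fun h => absurd (h2 y h) hy⟩
  · rw [List.mem_map, isPrimeImplicant_iff]
    constructor
    · rintro ⟨T, hT, rfl⟩
      rw [hmem] at hT
      exact ⟨_, rfl, (h.minTrans_iff hπ hT.lt).1 hT⟩
    · rintro ⟨s, rfl, hs⟩
      have he : toFin n (s.map Fin.valEmbedding) = s := by
        ext x
        rw [mem_toFin, Finset.mem_map]
        exact ⟨fun ⟨y, hy, he⟩ => Fin.ext he ▸ hy, fun hx => ⟨x, hx, rfl⟩⟩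
      refine ⟨s.map Fin.valEmbedding, ?_, by rw [he]⟩
      rw [hmem, h.minTrans_iff hπ, he]
      · exact hs
      · intro y hy
        obtain ⟨x, -, rfl⟩ := Finset.mem_map.1 hy
        exact x.2

end Output

/-! ### The theorem -/

theorem dualizesWithDelay_of_isDegenerate {n : ℕ} {φ : CNF n} (hp : φ.IsPrime)
    (hd : φ.IsDegenerate 1) :
    DualizesWithDelay .dualize φ (1000 * (φ.length * n ^ 2 + 1)) := by
  intro I hI
  suffices H : ∃ (tr : List Event) (s : State) (ws : List (List ℕ))
      (ts : List (Finset (Literal n))),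
      Runs .dualize (initialState I) tr s ∧
      OutputsWithDelay (1000 * (φ.length * n ^ 2 + 1)) tr ws ∧
      List.Forall₂ Represents ws ts ∧ ts.Nodup ∧
      (∀ t : Finset (Literal n), t ∈ ts ↔ IsPrimeImplicant φ.fn t) by
    obtain ⟨tr, s, ws, ts, h1, h2, h3, h4, h5⟩ := H
    exact ⟨tr, s, ws, ts, h1, h2, h3, h4, fun t => by rw [h5, isPrimeImplicate_dual_iff], h5⟩
  obtain ⟨u1, s1, r1, i1, w1, l1, z1, n1, m1, me1⟩ :
      Ex (.load rN rZ rZ ;; .set rV 1 ;; .load rM rZ rV) (initialState I) 3 [] fun s =>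
        s.reg rZ = 0 ∧ s.reg rN = n ∧ s.reg rM = I.length ∧ s.mem = (initialState I).mem := by
    refine Ex.block rfl rfl le_rfl ?_
    simp [Prog.eval, initialState, encode]
  have hrun : ∀ {u s}, Runs (.ite rZ rM ((.set rV 2 ;; .load rLen rZ rV) ;;
      .ite rZ rLen .main .nop) .endItem) s1 u s → Runs .dualize (initialState I) (u1 ++ u) s :=
    fun h => r1.seq h
  cases hIc : I with
  | nil =>
    rw [← hIc]
    have hφ : ∀ d, d ∉ φ := fun d hd => by
      obtain ⟨k, hk, -⟩ := hI.mem_iff.1 hd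
      simp [hIc] at hk
    -- For the constant `1` the only prime implicant is the empty term, output as an item without
    -- numbers.
    refine ⟨_, _, [[]], [positive ∅], hrun (.iteFalse (by simp [z1, m1, hIc]) (.endItem s1)), ?_,
      ?_, by simp, fun t => ?_⟩
    · have := OutputsWithDelay.item (D := 1000 * (φ.length * n ^ 2 + 1)) (u1 ++ [.tick])
        (tr := []) (ws := []) (by simp [i1]) (by simp; omega)
        (.halt [] (by simp) rfl (by simp))
      simpa [written_append, w1, written] using this
    · refine .cons ⟨[], by simp, rfl, by simp⟩ .nil
    · rw [List.mem_singleton, isPrimeImplicant_iff]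
      constructor
      · rintro rfl
        exact ⟨∅, rfl, fun c hc => absurd hc (hφ c), fun s' hs' _ => Finset.subset_empty.1 hs'⟩
      · rintro ⟨s, rfl, -, hs⟩
        rw [hs ∅ (Finset.empty_subset _) fun c hc => absurd hc (hφ c)]
  | cons c I' =>
    rw [← hIc]
    have hlpos : 0 < I.length := by simp [hIc]
    have hc0 : I.getD 0 [] = c := by simp [hIc]
    have hcφ : c.toFinset ∈ φ := hI.mem_iff.2 ⟨0, hlpos, by rw [hc0]⟩
    obtain ⟨u2, s2, r2, i2, w2, l2, z2, n2, m2, len2, me2⟩ :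
        Ex (.set rV 2 ;; .load rLen rZ rV) s1 2 [] fun s =>
          s.reg rZ = 0 ∧ s.reg rN = n ∧ s.reg rM = I.length ∧ s.reg rLen = c.length ∧
            s.mem = (initialState I).mem := by
      refine Ex.block rfl rfl le_rfl ?_
      simp [Prog.eval, z1, n1, m1, me1, initialState, encode, hIc]
    have hrun' : ∀ {u s}, Runs (.ite rZ rLen .main .nop) s2 u s →
        Runs .dualize (initialState I) (u1 ++ (.tick :: (u2 ++ u))) s :=
      fun h => hrun (.iteTrue (by rw [z1, m1]; exact hlpos) (r2.seq h))
    by_cases hcl : c = []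
    -- An empty clause cannot be met, so there is nothing to output.
    · refine ⟨_, _, [], [], hrun' (.iteFalse (by rw [z2, len2, hcl]; simp) (.set _ _ _)), ?_,
        .nil, List.nodup_nil, fun t => ?_⟩
      · refine .halt _ (by simp [i1, i2]) (by simp [written_append, written, w1, w2]) ?_
        simp only [List.length_append, List.length_cons, List.length_nil]
        omega
      · rw [isPrimeImplicant_iff]
        simp only [List.not_mem_nil, false_iff]
        rintro ⟨s, -, hs, -⟩
        obtain ⟨x, hx, -⟩ := hs _ hcφ
        simp [hcl] at hx
    -- Inspecting the first clause suffices: by primality an empty clause would be the only clause.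
    · have hne : ∀ d ∈ φ, d.Nonempty := by
        intro d hd
        rw [Finset.nonempty_iff_ne_empty]
        rintro rfl
        have := hp.eq_of_subset hd hcφ (Finset.empty_subset _)
        exact hcl (by simpa using this.symm)
      have hn : 1 ≤ n := by
        obtain ⟨x, hx⟩ := hne _ hcφ
        have := x.2
        omega
      have hle : I.length ≤ n := hI.card_eq ▸ hd.card_le hne
      have hlen : ∀ k < I.length, s2.mem (clauseAddr I k) = (clauseVars I k).length := by
        intro k hk
        rw [me2]
        exact encode_clauseAddr I k 0 hk (Nat.zero_le _)
      have helt : ∀ k < I.length, ∀ i < (clauseVars I k).length,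
          s2.mem (clauseAddr I k + (i + 1)) = (clauseVars I k).getD i 0 := by
        intro k hk i hi
        rw [me2]
        exact (encode_clauseAddr I k (i + 1) hk hi).trans (by rw [List.getD_cons_succ])
      have hfree : ∀ a ≥ I.length + 2 + I.length * n, s2.mem a = 0 := by
        intro a ha
        rw [me2]
        refine List.getD_eq_default _ _ ?_
        have h2 := clauseAddr_le hI.1 I.length le_rfl
        rw [clauseAddr] at h2
        simp only [encode_eq, List.length_cons, length_flatMap_encode]
        omega
      obtain ⟨π, u, s', hπ, hr, ho⟩ := Prog.main_outputs (hI.hasPrivate hd hne hn hle) (s := s2)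
        z2 n2 m2 hlen helt hfree hlpos hI.length_eq
        (L := 1000 * (φ.length * n ^ 2 + 1)) (by change 900 * (φ.length * n ^ 2) ≤ _; omega)
      obtain ⟨hnd, hmem⟩ := leaves_spec (c := fun q => clauseVars I (π q)) I.length
        fun q _ => (length_clauseVars_le hI.1 _).1
      obtain ⟨h1, h2, h3⟩ := hI.output_spec hπ hnd hmem
      refine ⟨_, _, _, _, hrun' (.iteTrue ?_ hr), ?_, h1, h2, h3⟩
      · rw [z2, len2]; exact List.length_pos_iff.2 hcl
      · have hl : (u1 ++ Event.tick :: (u2 ++ [Event.tick])).length + 900 * (φ.length * n ^ 2) ≤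
            1000 * (φ.length * n ^ 2 + 1) := by
          simp only [List.length_append, List.length_cons, List.length_nil]; omega
        have := (ho.append (v := u1 ++ .tick :: (u2 ++ [.tick])) (by simp [i1, i2])
          (by simp [written_append, written, w1, w2]) hl).outputsWithDelay le_rfl
        simp only [List.append_assoc, List.cons_append, List.nil_append] at this
        exact this

end MonotoneDual

theorem mainTheorem10 :
    (∃ (P : Prog) (C : ℕ), ∀ (n : ℕ) (φ : CNF n), φ.IsPrime → φ.AlphaAcyclic →
      DualizesWithDelay P φ (C * (φ.length * n ^ 2 + 1))) ∧
    (∀ (n : ℕ) (φ : CNF n), φ.IsPrime → φ.AlphaAcyclic → φ.IsDegenerate 1) ∧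
    (∀ (n : ℕ) (φ : CNF n) (a : List (GYOOp n)), φ.IsPrime → GYO φ a {∅} →
      (∃ σ : Equiv.Perm (Fin n), ReversesRemovals σ a) ∧
      ∀ σ : Equiv.Perm (Fin n), ReversesRemovals σ a → φ.IsDegenerateVia 1 σ) :=
  ⟨⟨.dualize, 1000, fun _ _ hp ha => dualizesWithDelay_of_isDegenerate hp (ha.isDegenerate hp)⟩,
    fun _ _ hp ha => ha.isDegenerate hp,
    fun _ _ _ hp h => ⟨h.exists_reversesRemovals, fun _ hσ => h.isDegenerateVia hp hσ⟩⟩
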